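/- Let $n,\ell,h,r$ be integers with $1\le \ell\le n$, $0\le r\le n-\ell$, $0\le h\le \ell$, and let $I_0=\{1,\dots,n\}$ with the Cartan matrix $C_{i,j}=\alpha_j(\alpha_i^\vee)$ of finite type $C_n$ ($C_{i,i}=2$, $C_{i,j}=-1$ if $|i-j|=1$ except $C_{n-1,n}=-2$, and $C_{i,j}=0$ otherwise). **Monomials.** Consider monomials $m=\prod_{i\in I_0,\,l\in\mathbb Z}Y_{i,l}^{u_{i,l}(m)}$ (finite products, $u_{i,l}(m)\in\mathbb Z$), with the convention $Y_{0,l}=1$. The weight $\mathrm{wt}(m)$ is given by $\mathrm{wt}(m)(\alpha_i^\vee)=\sum_l u_{i,l}(m)$. Put $\varphi_{i,L}(m)=\sum_{l\le L}u_{i,l}(m)$, $\varphi_i(m)=\max_L\varphi_{i,L}(m)$, $\varepsilon_{i,L}(m)=-\sum_{l\ge L}u_{i,l}(m)$, $\varepsilon_i(m)=\max_L\varepsilon_{i,L}(m)$, $q_i(m)=\min\{L:\varphi_{i,L}(m)=\varphi_i(m)\}$, $p_i(m)=\max\{L:\varepsilon_{i,L}(m)=\varepsilon_i(m)\}$, and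 $A_{i,l}=Y_{i,l-1}Y_{i,l+1}\prod_{j\ne i}Y_{j,l}^{C_{j,i}}$. Let $\tilde f_i m=mA_{i,q_i(m)+1}^{-1}$ if $\varphi_i(m)>0$ and $\tilde f_im=0$ otherwise; $\tilde e_i m=mA_{i,p_i(m)-1}$ if $\varepsilon_i(m)>0$ and $\tilde e_im=0$ otherwise. For $s\colon I_0\to\{0,1\}$ with $s_i+s_j=1$ whenever $C_{i,j}\le -1$, let $\mathcal M=\{m : u_{i,l}(m)=0 \text{ if } l\equiv s_i+1 \bmod 2\}$. Let $\mathcal M_{I_0}(m)$ be the set of monomials generated by $m$ under all $\tilde e_i,\tilde f_i$, $i\in I_0$. Put $$M_{\ell,h,r}=Y_{h,\ell-h}Y_{h,\ell-h-2r}^{-1}Y_{\ell,-2r}.$$ **Tableaux.** Let $\mathbf B=\{1\prec 2\prec\dots\prec n\prec\overline n\prec\dots\prec\overline 2\prec\overline 1\}$ and, for $p\in\mathbb Z$, $1\le i\le n$, $$\boxed{i}_p=Y_{i-1,p+i}^{-1}Y_{i,p+i-1},\qquad \boxed{\overline i}_p=Y_{i-1,p+2n-i}Y_{i,p+2n+1-i}^{-1}.$$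 For $T=((i_1,\dots,i_h),(i_{h+1},\dots,i_\ell))$ put $m_T=\prod_{a=1}^h\boxed{i_a}_{\ell+1-2a}\prod_{a=h+1}^\ell\boxed{i_a}_{\ell+1-2a-2r}$. Let $C_{\ell,h,r}$ be the set of those $T$ such that (conditions on $i_h$, $i_{h+1}$ being void when one of them does not exist): * (C.1) $i_a\in\mathbf B$, $i_1\prec\dots\prec i_h$ and $i_{h+1}\prec\dots\prec i_\ell$. * (C.2) There are no $1\le a<b\le h$ and $k$ with $i_a=k$, $i_b=\overline k$, $b-a=n-k$. * (C.3) There are no $h+1\le a<b\le\ell$ and $k$ with $i_a=k$, $i_b=\overline k$, $b-a=n-k$. * (C.4) There are no $a\le h$, $b\ge h+1$ and $k$ with $i_a=k$, $i_b=\overline k$, $b-a=n+1-\max(r,1)-k$. * (C.5) If $i_{h+1}=k\in\{1,\dots,n\}$ and $i_h\succeq i_{h+1}$, then $i_h=k'\in\{1,\dots,n\}$, and $(\overline{k'},\overline{k'-1},\dots,\overline k)$ appears as $(i_{b'},i_{b'+1},\dots,i_b)$ with $n-r-k+1<b-h\le n-k$. * (C.6) If $i_{h+1}=\overline k\in\{\overline1,\dots,\overline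 n\}$ and $i_h\succeq i_{h+1}$, then $i_h=\overline{k'}$ with $k'\in\{1,\dots,n\}$, and $(k',k'+1,\dots,k)$ appears as $(i_{a'},\dots,i_a)$ with $n-r-k+1\le h-a<n-k$. The crystal structure on tableaux: $\mathrm{wt},\varepsilon_k,\varphi_k$ of $T$ are those of $m_T$. If $\varphi_k(m_T)>0$, then $\tilde f_kT$ is obtained by replacing, by the next letter of $\mathbf B$, an entry whose box contributes $Y_{k,q}^{+1}$, $q=q_k(m_T)$; if there are two such entries $i_a=k$ and $i_b=\overline{k+1}$, one replaces $i_a$ if $r=0$ or $a,b$ lie in the same column, and $i_b$ otherwise. If $\varphi_k(m_T)=0$, then $\tilde f_kT=0$. Likewise, if $\varepsilon_k(m_T)>0$, then $\tilde e_kT$ is obtained by replacing, by the preceding letter, an entry whose box contributes $Y_{k,p}^{-1}$, $p=p_k(m_T)$; if there are two such entries $i_a=k+1$ and $i_b=\overline k$, one replaces $i_b$ if $r=0$ or $a,b$ lie in the same column, and $i_a$ otherwise. If $\varepsilon_k(m_T)=0$, then $\tilde e_kT=0$. **The map $\tau_{\ell,h,r}$** ($h\le\ell-1$). For $T\in C_{\ell,h,r}$: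 * (C.a) If $i_{h+1}=k\in\{1,\dots,n\}$ and there is an entry $i_b=\overline k$ with $n-r-k+1<b-h\le n-k$, let $(i_{b''},\dots,i_b)=(\overline{k''},\overline{k''-1},\dots,\overline k)$ be the maximal run of successive letters ending at $i_b$ (so $i_{b''-1}\ne\overline{k''+1}$), and $$\tau_{\ell,h,r}(T)=((i_1,\dots,i_h,k''+1),(i_{h+2},\dots,i_{b''-1},\overline{k''+1},\overline{k''},\dots,\overline{k+1},i_{b+1},\dots,i_\ell)).$$ * (C.b) If $i_{h+1}=\overline k$ and there is an entry $i_a=k$ with $n-r-k+1\le h-a<n-k$, let $(i_{a''},\dots,i_a)=(k'',k''+1,\dots,k)$ be the maximal run of successive letters ending at $i_a$ (so $i_{a''-1}\ne k''-1$), and $$\tau_{\ell,h,r}(T)=((i_1,\dots,i_{a''-1},k''-1,\dots,k-1,i_{a+1},\dots,i_h,\overline{k''-1}),(i_{h+2},\dots,i_\ell)).$$ * (C.c) Otherwise $\tau_{\ell,h,r}(T)=((i_1,\dots,i_{h+1}),(i_{h+2},\dots,i_\ell))$. **Theorem.** For a suitable $s$ the set $\mathcal M_{I_0}(M_{\ell,h,r})$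 is contained in $\mathcal M$, and: (1) With the operations above, $C_{\ell,h,r}$ and $\mathcal M_{I_0}(M_{\ell,h,r})$ are crystals of type $C_n$, and $T\mapsto m_T$ is a crystal isomorphism from $C_{\ell,h,r}$ onto $\mathcal M_{I_0}(M_{\ell,h,r})$, i.e. a bijection that preserves $\mathrm{wt}$, $\varepsilon_k$, $\varphi_k$ and commutes with $\tilde e_k,\tilde f_k$ ($k\in I_0$). (2) If $h\le\ell-1$, then $\tau_{\ell,h,r}$ maps $C_{\ell,h,r}$ into $C_{\ell,h+1,r}$, and $m_T\mapsto m_{\tau_{\ell,h,r}(T)}$ ($T\in C_{\ell,h,r}$) is a crystal isomorphism from $\mathcal M_{I_0}(M_{\ell,h,r})$ onto $\mathcal M_{I_0}(M_{\ell,h+1,r})$. -/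

import Mathlib

namespace CrystalTypeC

/-- The index set `{1, …, m}`. For `m = n` it is the vertex set `I₀ = {1, …, n}` of the Dynkin
diagram of finite type `C_n`, for `m = ℓ` it is the set of positions of a tableau with `ℓ` boxes. -/
abbrev Idx (m : ℤ) : Type := Set.Icc (1 : ℤ) m

/-- The Cartan matrix of finite type `C_n`: `cartan n i j = α_j(α_i^∨)`, where `α_n` is the long
simple root. -/
def cartan (n : ℤ) (i j : Idx n) : ℤ :=
  if i = j then 2
  else if |(i : ℤ) - j| = 1 then (if (i : ℤ) = n - 1 ∧ (j : ℤ) = n then -2 else -1)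
  else 0

/-! ### Crystals -/

/-- The operations of a crystal of type `C_n` on a type `B`. The weight lattice `P` is identified
with `ℤ^{I₀}` through `λ ↦ (λ(α_i^∨))_i`, and `none` stands for `0`. -/
structure CrystalOps (n : ℤ) (B : Type) where
  wt : B → Idx n → ℤ
  eps : Idx n → B → ℤ
  phi : Idx n → B → ℤ
  e : Idx n → B → Option B
  f : Idx n → B → Option B

/-- The subset `S` with the operations `D` is a crystal. -/
structure IsCrystalOn {n : ℤ} {B : Type} (D : CrystalOps n B) (S : Set B) : Prop where
  e_mem : ∀ i, ∀ b ∈ S, ∀ b', D.e i b = some b' → b' ∈ S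
  f_mem : ∀ i, ∀ b ∈ S, ∀ b', D.f i b = some b' → b' ∈ S
  phi_eq : ∀ i, ∀ b ∈ S, D.phi i b = D.eps i b + D.wt b i
  e_wt : ∀ i, ∀ b ∈ S, ∀ b', D.e i b = some b' → ∀ j, D.wt b' j = D.wt b j + cartan n j i
  e_eps : ∀ i, ∀ b ∈ S, ∀ b', D.e i b = some b' → D.eps i b' = D.eps i b - 1
  e_phi : ∀ i, ∀ b ∈ S, ∀ b', D.e i b = some b' → D.phi i b' = D.phi i b + 1
  f_wt : ∀ i, ∀ b ∈ S, ∀ b', D.f i b = some b' → ∀ j, D.wt b' j = D.wt b j - cartan n j i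
  f_eps : ∀ i, ∀ b ∈ S, ∀ b', D.f i b = some b' → D.eps i b' = D.eps i b + 1
  f_phi : ∀ i, ∀ b ∈ S, ∀ b', D.f i b = some b' → D.phi i b' = D.phi i b - 1
  e_iff_f : ∀ i, ∀ b ∈ S, ∀ b' ∈ S, D.e i b = some b' ↔ D.f i b' = some b

/-- `ψ` restricts to an isomorphism from the crystal `(S, D)` to the crystal `(S', D')`. -/
structure IsCrystalIso {n : ℤ} {B B' : Type} (D : CrystalOps n B) (D' : CrystalOps n B')
    (S : Set B) (S' : Set B') (ψ : B → B') : Prop where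
  source : IsCrystalOn D S
  target : IsCrystalOn D' S'
  bijOn : Set.BijOn ψ S S'
  wt_eq : ∀ b ∈ S, D'.wt (ψ b) = D.wt b
  eps_eq : ∀ i, ∀ b ∈ S, D'.eps i (ψ b) = D.eps i b
  phi_eq : ∀ i, ∀ b ∈ S, D'.phi i (ψ b) = D.phi i b
  e_eq : ∀ i, ∀ b ∈ S, D'.e i (ψ b) = (D.e i b).map ψ
  f_eq : ∀ i, ∀ b ∈ S, D'.f i (ψ b) = (D.f i b).map ψ

/-- The subset generated by `b₀` under all operators `ẽ_i`, `f̃_i`. -/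
inductive Generated {n : ℤ} {B : Type} (D : CrystalOps n B) (b₀ : B) : B → Prop
  | base : Generated D b₀ b₀
  | e_step (i : Idx n) (b b' : B) : Generated D b₀ b → D.e i b = some b' → Generated D b₀ b'
  | f_step (i : Idx n) (b b' : B) : Generated D b₀ b → D.f i b = some b' → Generated D b₀ b'

/-! ### The monomial crystal -/

/-- Monomials in the variables `Y_{i,l}^{±1}`, `i ∈ I₀`, `l ∈ ℤ`, written additively:
`m i l` is the exponent `u_{i,l}(m)`, so that a product of monomials is a sum of exponents.
The factor `e^{ω(m)}` is determined by the exponents (`ω(m)(α_i^∨) = ∑_l u_{i,l}(m)`). -/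
abbrev Monomial (n : ℤ) : Type := Idx n → ℤ →₀ ℤ

/-- The variable `Y_{i,l}`, with the convention that `Y_{i,l} = 1` for `i ∉ I₀`
(in particular `Y_{0,l} = 1`). -/
noncomputable def Y (n : ℤ) (i l : ℤ) : Monomial n :=
  if hi : i ∈ Set.Icc (1 : ℤ) n then Pi.single ⟨i, hi⟩ (Finsupp.single l 1) else 0

/-- `A_{i,l} = Y_{i,l-1} Y_{i,l+1} ∏_{j ≠ i} Y_{j,l}^{C_{j,i}}`. -/
noncomputable def rootMonomial (n : ℤ) (i : Idx n) (l : ℤ) : Monomial n :=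
  Y n i (l - 1) + Y n i (l + 1) +
    ∑ j ∈ Finset.univ.filter (fun j : Idx n => j ≠ i), cartan n j i • Y n j l

/-- `φ_{i,L}(m) = ∑_{l ≤ L} u_{i,l}(m)`. -/
def phiAt {n : ℤ} (i : Idx n) (m : Monomial n) (L : ℤ) : ℤ :=
  ∑ l ∈ (m i).support.filter (fun l => l ≤ L), m i l

/-- `ε_{i,L}(m) = - ∑_{l ≥ L} u_{i,l}(m)`. -/
def epsAt {n : ℤ} (i : Idx n) (m : Monomial n) (L : ℤ) : ℤ :=
  - ∑ l ∈ (m i).support.filter (fun l => L ≤ l), m i l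

/-- `φ_i(m) = max_L φ_{i,L}(m)`; only finitely many values occur, so the maximum exists. -/
noncomputable def phi {n : ℤ} (i : Idx n) (m : Monomial n) : ℤ := ⨆ L : ℤ, phiAt i m L

/-- `ε_i(m) = max_L ε_{i,L}(m)`; only finitely many values occur, so the maximum exists. -/
noncomputable def eps {n : ℤ} (i : Idx n) (m : Monomial n) : ℤ := ⨆ L : ℤ, epsAt i m L

/-- `q_i(m) = min {L | φ_{i,L}(m) = φ_i(m)}`; the minimum exists and is used only
if `φ_i(m) > 0`. -/
noncomputable def qGrade {n : ℤ} (i : Idx n) (m : Monomial n) : ℤ :=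
  sInf {L : ℤ | phiAt i m L = phi i m}

/-- `p_i(m) = max {L | ε_{i,L}(m) = ε_i(m)}`; the maximum exists and is used only
if `ε_i(m) > 0`. -/
noncomputable def pGrade {n : ℤ} (i : Idx n) (m : Monomial n) : ℤ :=
  sSup {L : ℤ | epsAt i m L = eps i m}

/-- The operations on monomials. -/
noncomputable def monomialOps (n : ℤ) : CrystalOps n (Monomial n) where
  wt m i := ∑ l ∈ (m i).support, m i l
  eps := eps
  phi := phi
  e i m := if eps i m = 0 then none else some (m + rootMonomial n i (pGrade i m - 1))
  f i m := if phi i m = 0 then none else some (m - rootMonomial n i (qGrade i m + 1))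

/-- `s : I₀ → {0, 1}` with `s_i + s_j = 1` whenever `C_{i,j} ≤ -1`. -/
def IsColoring (n : ℤ) (s : Idx n → ℤ) : Prop :=
  (∀ i, s i = 0 ∨ s i = 1) ∧ ∀ i j, cartan n i j ≤ -1 → s i + s j = 1

/-- The set `𝓜` of monomials with `u_{i,l}(m) = 0` if `l ≡ s_i + 1 mod 2`. -/
def monomialSet (n : ℤ) (s : Idx n → ℤ) : Set (Monomial n) :=
  {m | ∀ i l, l ≡ s i + 1 [ZMOD 2] → m i l = 0}

/-- `𝓜_{I₀}(m)`: the subset of the monomials generated by `m` under `ẽ_i`, `f̃_i`, `i ∈ I₀`. -/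
def component {n : ℤ} (m : Monomial n) : Set (Monomial n) :=
  {m' | Generated (monomialOps n) m m'}

/-- `M_{ℓ,h,r} = Y_{h,ℓ-h} Y_{h,ℓ-h-2r}^{-1} Y_{ℓ,-2r}`. -/
noncomputable def highestMonomial (n ℓ h r : ℤ) : Monomial n :=
  Y n h (ℓ - h) - Y n h (ℓ - h - 2 * r) + Y n ℓ (-2 * r)

/-! ### Letters, boxes and tableaux -/

/-- `Letter.plain k` is the letter `k`, `Letter.bar k` the letter `k` with a bar. -/
inductive Letter : Type
  | plain (k : ℤ) : Letter
  | bar (k : ℤ) : Letter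

/-- Membership in the alphabet `𝐁 = {1, …, n, n̄, …, 1̄}`. -/
def Letter.InB (n : ℤ) : Letter → Prop
  | .plain k => 1 ≤ k ∧ k ≤ n
  | .bar k => 1 ≤ k ∧ k ≤ n

/-- The place of a letter in the list `1, 2, …, n, n̄, …, 2̄, 1̄`. -/
def Letter.rank (n : ℤ) : Letter → ℤ
  | .plain k => k
  | .bar k => 2 * n + 1 - k

/-- The order `1 ≺ 2 ≺ ⋯ ≺ n ≺ n̄ ≺ ⋯ ≺ 2̄ ≺ 1̄`. -/
def prec (n : ℤ) (x y : Letter) : Prop := x.rank n < y.rank n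

/-- `x ⪰ y`. -/
def succEq (n : ℤ) (x y : Letter) : Prop := y.rank n ≤ x.rank n

/-- The letter that follows in the list `1, 2, …, n, n̄, …, 2̄, 1̄`. In the vector
representation `f̃_k` replaces `k` (and, if `k < n`, also the barred `k + 1`) by it. -/
def Letter.next (n : ℤ) : Letter → Letter
  | .plain k => if k = n then .bar n else .plain (k + 1)
  | .bar k => .bar (k - 1)

/-- The letter that precedes in the list `1, 2, …, n, n̄, …, 2̄, 1̄`. -/
def Letter.prev (n : ℤ) : Letter → Letter
  | .plain k => .plain (k - 1)
  | .bar k => if k = n then .plain n else .bar (k + 1)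

/-- The box monomials: letter `i` and suffix `p` give `Y_{i-1,p+i}^{-1} Y_{i,p+i-1}`, a barred
`i` and suffix `p` give `Y_{i-1,p+2n-i} Y_{i,p+2n+1-i}^{-1}`. -/
noncomputable def box (n : ℤ) : Letter → ℤ → Monomial n
  | .plain i, p => Y n i (p + i - 1) - Y n (i - 1) (p + i)
  | .bar i, p => Y n (i - 1) (p + 2 * n - i) - Y n i (p + 2 * n + 1 - i)

/-- `T = ((i_1, …, i_h), (i_{h+1}, …, i_ℓ))`, written as the sequence `(i_1, …, i_ℓ)`. -/
abbrev Tableau (ℓ : ℤ) : Type := Idx ℓ → Letter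

/-- The suffix of the box at position `a`: `ℓ + 1 - 2a` in the first column (`a ≤ h`) and
`ℓ + 1 - 2a - 2r` in the second one. -/
def suffix (ℓ h r : ℤ) (a : Idx ℓ) : ℤ :=
  if (a : ℤ) ≤ h then ℓ + 1 - 2 * a else ℓ + 1 - 2 * a - 2 * r

/-- The monomial `m_T`. -/
noncomputable def tabMonomial (n ℓ h r : ℤ) (T : Tableau ℓ) : Monomial n :=
  ∑ a : Idx ℓ, box n (T a) (suffix ℓ h r a)

/-- The conditions (C.1)–(C.6). -/
structure IsTableauC (n ℓ h r : ℤ) (T : Tableau ℓ) : Prop where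
  mem : ∀ a, (T a).InB n
  col₁ : ∀ a b : Idx ℓ, a < b → (b : ℤ) ≤ h → prec n (T a) (T b)
  col₂ : ∀ a b : Idx ℓ, a < b → h + 1 ≤ (a : ℤ) → prec n (T a) (T b)
  c2 : ¬ ∃ (a b : Idx ℓ) (k : ℤ), a < b ∧ (b : ℤ) ≤ h ∧
    T a = .plain k ∧ T b = .bar k ∧ (b : ℤ) - a = n - k
  c3 : ¬ ∃ (a b : Idx ℓ) (k : ℤ), h + 1 ≤ (a : ℤ) ∧ a < b ∧
    T a = .plain k ∧ T b = .bar k ∧ (b : ℤ) - a = n - k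
  c4 : ¬ ∃ (a b : Idx ℓ) (k : ℤ), (a : ℤ) ≤ h ∧ h + 1 ≤ (b : ℤ) ∧
    T a = .plain k ∧ T b = .bar k ∧ (b : ℤ) - a = n + 1 - max r 1 - k
  c5 : ∀ (u v : Idx ℓ) (k : ℤ), (u : ℤ) = h → (v : ℤ) = h + 1 →
    T v = .plain k → succEq n (T u) (T v) →
    ∃ k' : ℤ, T u = .plain k' ∧ ∃ b' b : Idx ℓ, (b : ℤ) - b' = k' - k ∧
      (∀ c : Idx ℓ, b' ≤ c → c ≤ b → T c = .bar (k' - ((c : ℤ) - b'))) ∧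
      n - r - k + 1 < (b : ℤ) - h ∧ (b : ℤ) - h ≤ n - k
  c6 : ∀ (u v : Idx ℓ) (k : ℤ), (u : ℤ) = h → (v : ℤ) = h + 1 →
    T v = .bar k → succEq n (T u) (T v) →
    ∃ k' : ℤ, T u = .bar k' ∧ ∃ a' a : Idx ℓ, (a : ℤ) - a' = k - k' ∧
      (∀ c : Idx ℓ, a' ≤ c → c ≤ a → T c = .plain (k' + ((c : ℤ) - a'))) ∧
      n - r - k + 1 ≤ h - (a : ℤ) ∧ h - (a : ℤ) < n - k

/-- The set `C_{ℓ,h,r}`. -/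
def tableauSet (n ℓ h r : ℤ) : Set (Tableau ℓ) := {T | IsTableauC n ℓ h r T}

/-! ### The crystal structure on tableaux -/

open Classical in
/-- The positions of `T` whose box contains `Y_{k,q}` with exponent `x`. -/
noncomputable def boxesAt (n ℓ h r : ℤ) (k : Idx n) (T : Tableau ℓ) (q x : ℤ) :
    Finset (Idx ℓ) :=
  Finset.univ.filter fun a => box n (T a) (suffix ℓ h r a) k q = x

/-- `r ≠ 0` and the set of positions meets both columns. -/
def Crossing (ℓ h r : ℤ) (s : Finset (Idx ℓ)) : Prop :=
  r ≠ 0 ∧ (∃ a ∈ s, (a : ℤ) ≤ h) ∧ ∃ b ∈ s, h + 1 ≤ (b : ℤ)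

open Classical in
/-- The crystal operations on tableaux. The functions `wt`, `ε_k`, `φ_k` are those of `m_T`.
If `φ_k(m_T) > 0`, then `f̃_k` replaces by the next letter an entry whose box contributes
`Y_{k,q}` with `q = q_k(m_T)`. There are two such entries only if `i_a = k` and `i_b` is the barred
`k + 1` for some `a < b`; then `i_a` is replaced if `r = 0` or `a`, `b` lie in the same column,
and `i_b` is replaced otherwise. The rule for `ẽ_k` is the reverse one. -/
noncomputable def tableauOps (n ℓ h r : ℤ) : CrystalOps n (Tableau ℓ) where
  wt T := (monomialOps n).wt (tabMonomial n ℓ h r T)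
  eps k T := eps k (tabMonomial n ℓ h r T)
  phi k T := phi k (tabMonomial n ℓ h r T)
  e k T :=
    let m := tabMonomial n ℓ h r T
    let s := boxesAt n ℓ h r k T (pGrade k m) (-1)
    if hs : eps k m ≠ 0 ∧ s.Nonempty then
      let c := if Crossing ℓ h r s then s.min' hs.2 else s.max' hs.2
      some (Function.update T c ((T c).prev n))
    else none
  f k T :=
    let m := tabMonomial n ℓ h r T
    let s := boxesAt n ℓ h r k T (qGrade k m) 1
    if hs : phi k m ≠ 0 ∧ s.Nonempty then
      let c := if Crossing ℓ h r s then s.max' hs.2 else s.min' hs.2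
      some (Function.update T c ((T c).next n))
    else none

/-! ### The map `τ_{ℓ,h,r}` -/

/-- Case (C.a): `i_{h+1} = k` and there is an entry `i_b = k̄` with
`n - r - k + 1 < b - h ≤ n - k`. Moreover `(i_{b''}, …, i_b)` is the maximal run of successive
letters (`k''` with a bar, `k'' - 1` with a bar, …, `k` with a bar) that ends at `i_b`, so that
`k'' = k + (b - b'')`. -/
structure CaseA (n ℓ h r : ℤ) (T : Tableau ℓ) (k : ℤ) (b b'' : Idx ℓ) : Prop where
  entry : ∃ v : Idx ℓ, (v : ℤ) = h + 1 ∧ T v = .plain k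
  partner : T b = .bar k
  lower : n - r - k + 1 < (b : ℤ) - h
  upper : (b : ℤ) - h ≤ n - k
  le : b'' ≤ b
  run : ∀ c : Idx ℓ, b'' ≤ c → c ≤ b → T c = .bar (k + ((b : ℤ) - c))
  maximal : ∀ c : Idx ℓ, (c : ℤ) = b'' - 1 → T c ≠ .bar (k + ((b : ℤ) - c))

/-- Case (C.b): `i_{h+1} = k̄` and there is an entry `i_a = k` with
`n - r - k + 1 ≤ h - a < n - k`. Moreover `(i_{a''}, …, i_a) = (k'', k'' + 1, …, k)` is the
maximal run of successive letters that ends at `i_a`, so that `k'' = k - (a - a'')`. -/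
structure CaseB (n ℓ h r : ℤ) (T : Tableau ℓ) (k : ℤ) (a a'' : Idx ℓ) : Prop where
  entry : ∃ v : Idx ℓ, (v : ℤ) = h + 1 ∧ T v = .bar k
  partner : T a = .plain k
  lower : n - r - k + 1 ≤ h - (a : ℤ)
  upper : h - (a : ℤ) < n - k
  le : a'' ≤ a
  run : ∀ c : Idx ℓ, a'' ≤ c → c ≤ a → T c = .plain (k - ((a : ℤ) - c))
  maximal : ∀ c : Idx ℓ, (c : ℤ) = a'' - 1 → T c ≠ .plain (k - ((a : ℤ) - c))

open Classical in
/-- In case (C.a) the entry `i_{h+1}` becomes `k'' + 1`, and the labels of the entries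
`i_{b''}, …, i_b` grow by one. -/
noncomputable def tauA {ℓ : ℤ} (h : ℤ) (T : Tableau ℓ) (k : ℤ) (b b'' : Idx ℓ) : Tableau ℓ :=
  fun c =>
    if (c : ℤ) = h + 1 then .plain (k + ((b : ℤ) - b'') + 1)
    else if b'' ≤ c ∧ c ≤ b then .bar (k + ((b : ℤ) - c) + 1)
    else T c

open Classical in
/-- In case (C.b) the entry `i_{h+1}` becomes `k'' - 1` with a bar, and the labels of the entries
`i_{a''}, …, i_a` decrease by one. -/
noncomputable def tauB {ℓ : ℤ} (h : ℤ) (T : Tableau ℓ) (k : ℤ) (a a'' : Idx ℓ) : Tableau ℓ :=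
  fun c =>
    if (c : ℤ) = h + 1 then .bar (k - ((a : ℤ) - a'') - 1)
    else if a'' ≤ c ∧ c ≤ a then .plain (k - ((a : ℤ) - c) - 1)
    else T c

open Classical in
/-- The map `τ_{ℓ,h,r}` on tableaux. In case (C.c) the sequence `(i_1, …, i_ℓ)` is unchanged and
only the columns are cut differently, after position `h + 1`. For tableaux in `C_{ℓ,h,r}` the
data `(k, b, b'')` and `(k, a, a'')` are unique if they exist. -/
noncomputable def tau (n ℓ h r : ℤ) (T : Tableau ℓ) : Tableau ℓ :=
  if hA : ∃ x : ℤ × Idx ℓ × Idx ℓ, CaseA n ℓ h r T x.1 x.2.1 x.2.2 then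
    tauA h T hA.choose.1 hA.choose.2.1 hA.choose.2.2
  else if hB : ∃ x : ℤ × Idx ℓ × Idx ℓ, CaseB n ℓ h r T x.1 x.2.1 x.2.2 then
    tauB h T hB.choose.1 hB.choose.2.1 hB.choose.2.2
  else T

end CrystalTypeC

/-! A tableau is encoded by its profile: for each `0 ≤ j ≤ n` the four counts in `Quad`, that is,
four lattice paths. For `r ≥ 1` everything becomes local in `j`.

The exponents of the variables `Y_{k,l}` in `m_T` are the second differences of the four paths at
`k`, each placed at one level that is determined by the height of its path
(`IsFilling.tabMonomial_apply`). The operators `ẽ_k`, `f̃_k` with `k < n` move one path by one, at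
`j = k` only; for `k = n` two paths move together at `j = n`. Membership in `C_{ℓ,h,r}` amounts to
conditions on consecutive quadruples and one condition at `n` (`IsTableauC.adm`, `Adm.isTableauC`),
because the runs demanded by `c5` and `c6` can be checked letter by letter. So the stability of
`C_{ℓ,h,r}` and the fact that `ẽ_k`, `f̃_k` are inverse to each other are statements of linear
arithmetic about three consecutive quadruples, given that the partial sums have their first maximum
at the chosen level (`loc_raise`, `minusPick_unique`). A duality that swaps the columns and reflects
the levels deduces `ẽ` from `f̃`. As moving a letter up multiplies its box by `A_{k,l}^{-1}`, the
map `T ↦ m_T` commutes with the operators.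

Bijectivity onto the component follows once the tableau `1, …, ℓ` is the only one killed by all
`ẽ_k` (`isCrystalIso_of_source`): applying `ẽ` lowers the sum of the ranks, so every tableau can be
traced back to it.

This uniqueness is obtained from `τ`. On profiles `τ` is a finite automaton: to each `j` belongs a
state `Cut`, which names two paths that keep their counts while the other two change by one. A
letter that simply changes its column gives the states `vy` and then `xy` or `vw`; the two
exceptional cases of `τ` insert a stretch of `wy` or `vx`. The states are determined by the profile,
so the image is the only possible shift (`IsShift.unique`). If `f̃_k` acts on a tableau and on its
image, the results are again related by states, with a change at `k` only (`Cut.exists_next`). Hence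
`τ` commutes with `f̃_k`, and then preserves `φ_k`, `ε_k` and commutes with `ẽ_k`. Induction on `ℓ -
h` carries a source to a single column, where a source is found by an extremal argument
(`eq_highestTableau_of_eps`). The same facts show that `m_T ↦ m_{τ(T)}` is an isomorphism.

For `r = 0` the two columns merge into one: sets, operations and monomials are those of `h = ℓ`, `r
= 1`, and `τ` is the identity. -/

namespace CrystalTypeC

/-! ### Partial sums of finitely supported sequences -/

/-- `∑_{l ≤ L} u_l`. -/
noncomputable def partialSum (u : ℤ →₀ ℤ) (L : ℤ) : ℤ := u.sum fun l c => if l ≤ L then c else 0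

/-- `∑_l u_l`. -/
noncomputable def totalSum (u : ℤ →₀ ℤ) : ℤ := u.sum fun _ c => c

theorem partialSum_add (u v : ℤ →₀ ℤ) (L : ℤ) :
    partialSum (u + v) L = partialSum u L + partialSum v L := by
  unfold partialSum
  apply Finsupp.sum_add_index'
  · intro a; simp
  · intro a b c; split_ifs <;> simp

theorem partialSum_single (a e L : ℤ) :
    partialSum (Finsupp.single a e) L = if a ≤ L then e else 0 := by
  unfold partialSum
  rw [Finsupp.sum_single_index]; simp

theorem partialSum_neg (u : ℤ →₀ ℤ) (L : ℤ) : partialSum (-u) L = -partialSum u L := by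
  have h := partialSum_add u (-u) L
  have h0 : partialSum (0 : ℤ →₀ ℤ) L = 0 := by simp [partialSum]
  rw [add_neg_cancel, h0] at h
  linarith

theorem partialSum_sub (u v : ℤ →₀ ℤ) (L : ℤ) :
    partialSum (u - v) L = partialSum u L - partialSum v L := by
  rw [sub_eq_add_neg, partialSum_add, partialSum_neg, sub_eq_add_neg]

theorem totalSum_add (u v : ℤ →₀ ℤ) : totalSum (u + v) = totalSum u + totalSum v := by
  unfold totalSum
  apply Finsupp.sum_add_index'
  · intro a; rfl
  · intro a b c; rfl

theorem totalSum_single (a e : ℤ) : totalSum (Finsupp.single a e) = e := by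
  simp [totalSum]

theorem totalSum_neg (u : ℤ →₀ ℤ) : totalSum (-u) = -totalSum u := by
  have h := totalSum_add u (-u)
  have h0 : totalSum (0 : ℤ →₀ ℤ) = 0 := by simp [totalSum]
  rw [add_neg_cancel, h0] at h
  linarith

theorem totalSum_sub (u v : ℤ →₀ ℤ) : totalSum (u - v) = totalSum u - totalSum v := by
  rw [sub_eq_add_neg, totalSum_add, totalSum_neg, sub_eq_add_neg]

theorem partialSum_sub_one (u : ℤ →₀ ℤ) (L : ℤ) :
    partialSum u L = partialSum u (L - 1) + u L := by
  induction u using Finsupp.induction_linear with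
  | zero => simp [partialSum]
  | add f g hf hg => rw [partialSum_add, partialSum_add, hf, hg, Finsupp.add_apply]; ring
  | single a b =>
    rw [partialSum_single, partialSum_single, Finsupp.single_apply]
    split_ifs <;> omega

/-- Outside a bounded range the partial sums are constant. Therefore all the suprema and infima over
`ℤ` in the definitions of `φ`, `ε`, `q`, `p` can be treated as maxima and minima. -/
theorem exists_partialSum_bounds (u : ℤ →₀ ℤ) :
    ∃ A B : ℤ, A ≤ B ∧ (∀ L < A, partialSum u L = 0) ∧ ∀ L ≥ B, partialSum u L = totalSum u := by
  induction u using Finsupp.induction_linear with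
  | zero => exact ⟨0, 0, le_rfl, by simp [partialSum], by simp [partialSum, totalSum]⟩
  | add f g hf hg =>
    obtain ⟨A, B, h, h1, h2⟩ := hf
    obtain ⟨A', B', h', h1', h2'⟩ := hg
    refine ⟨min A A', max B B', by omega, ?_, ?_⟩
    · intro L hL
      rw [partialSum_add, h1 L (by omega), h1' L (by omega)]; rfl
    · intro L hL
      rw [partialSum_add, totalSum_add, h2 L (by omega), h2' L (by omega)]
  | single a b =>
    refine ⟨a, a, le_rfl, ?_, ?_⟩
    · intro L hL
      rw [partialSum_single, if_neg (by omega)]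
    · intro L hL
      rw [partialSum_single, totalSum_single, if_pos (by omega)]

theorem exists_partialSum_max (u : ℤ →₀ ℤ) : ∃ L₀, ∀ L, partialSum u L ≤ partialSum u L₀ := by
  obtain ⟨A, B, h, h1, h2⟩ := exists_partialSum_bounds u
  obtain ⟨L₀, h3, h4⟩ := Finset.exists_max_image (Finset.Icc (A - 1) B) (partialSum u)
    ⟨A - 1, by simp; omega⟩
  refine ⟨L₀, fun L => ?_⟩
  by_cases hA : L < A
  · rw [h1 L hA, ← h1 (A - 1) (by omega)]
    exact h4 _ (by simp; omega)
  · by_cases hB : L ≥ B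
    · rw [h2 L hB, ← h2 B le_rfl]
      exact h4 _ (by simp; omega)
    · exact h4 _ (by simp; omega)

theorem phiAt_eq {n : ℤ} (i : Idx n) (m : Monomial n) (L : ℤ) :
    phiAt i m L = partialSum (m i) L := by
  unfold phiAt partialSum Finsupp.sum
  rw [Finset.sum_filter]

/-- A tail sum is the total minus an initial sum. So `ε` and `p` concern the same partial sums as
`φ` and `q`: `q` is the first place of their maximum and `p - 1` the last one. -/
theorem epsAt_eq {n : ℤ} (i : Idx n) (m : Monomial n) (L : ℤ) :
    epsAt i m L = partialSum (m i) (L - 1) - totalSum (m i) := by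
  unfold epsAt partialSum totalSum Finsupp.sum
  rw [Finset.sum_filter, ← Finset.sum_neg_distrib, ← Finset.sum_sub_distrib]
  refine Finset.sum_congr rfl fun l _ => ?_
  dsimp only
  split_ifs <;> omega

theorem wt_eq {n : ℤ} (i : Idx n) (m : Monomial n) :
    (monomialOps n).wt m i = totalSum (m i) := rfl

variable {n : ℤ} {i : Idx n} {m : Monomial n}

theorem phi_eq_of_isMax {L₀ : ℤ} (h : ∀ L, partialSum (m i) L ≤ partialSum (m i) L₀) :
    phi i m = partialSum (m i) L₀ := by
  unfold phi
  simp only [phiAt_eq]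
  exact le_antisymm (ciSup_le h) (le_ciSup ⟨_, by rintro _ ⟨L, rfl⟩; exact h L⟩ L₀)

theorem partialSum_le_phi (i : Idx n) (m : Monomial n) (L : ℤ) :
    partialSum (m i) L ≤ phi i m := by
  obtain ⟨L₀, h⟩ := exists_partialSum_max (m i)
  rw [phi_eq_of_isMax h]
  exact h L

theorem exists_partialSum_eq_phi (i : Idx n) (m : Monomial n) :
    ∃ L, partialSum (m i) L = phi i m := by
  obtain ⟨L₀, h⟩ := exists_partialSum_max (m i)
  exact ⟨L₀, (phi_eq_of_isMax h).symm⟩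

theorem phi_eq {Φ : ℤ} (h : ∀ L, partialSum (m i) L ≤ Φ) {L₀ : ℤ} (h₀ : partialSum (m i) L₀ = Φ) :
    phi i m = Φ := by
  rw [← h₀]
  exact phi_eq_of_isMax fun L => h₀ ▸ h L

theorem phi_nonneg (i : Idx n) (m : Monomial n) : 0 ≤ phi i m := by
  obtain ⟨A, B, h, h1, h2⟩ := exists_partialSum_bounds (m i)
  rw [← h1 (A - 1) (by omega)]
  exact partialSum_le_phi i m _

theorem eps_eq (i : Idx n) (m : Monomial n) : eps i m = phi i m - totalSum (m i) := by
  unfold eps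
  simp only [epsAt_eq]
  obtain ⟨L₀, h⟩ := exists_partialSum_eq_phi i m
  refine le_antisymm (ciSup_le fun L => ?_) ?_
  · linarith [partialSum_le_phi i m (L - 1)]
  · refine le_trans ?_ (le_ciSup (f := fun L => partialSum (m i) (L - 1) - totalSum (m i))
      ⟨phi i m - totalSum (m i), ?_⟩ (L₀ + 1))
    · simp [h]
    · rintro _ ⟨L, rfl⟩
      linarith [partialSum_le_phi i m (L - 1)]

theorem eps_nonneg (i : Idx n) (m : Monomial n) : 0 ≤ eps i m := by
  obtain ⟨A, B, h, h1, h2⟩ := exists_partialSum_bounds (m i)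
  rw [eps_eq, ← h2 B le_rfl]
  linarith [partialSum_le_phi i m B]

theorem qGrade_eq {q : ℤ} (h : partialSum (m i) q = phi i m)
    (hlt : ∀ L < q, partialSum (m i) L < phi i m) : qGrade i m = q := by
  unfold qGrade
  simp only [phiAt_eq]
  exact IsLeast.csInf_eq ⟨h, fun L hL => not_lt.1 fun hlt' => (hlt L hlt').ne hL⟩

theorem pGrade_eq {p : ℤ} (h : partialSum (m i) (p - 1) = phi i m)
    (hlt : ∀ L, p ≤ L → partialSum (m i) L < phi i m) : pGrade i m = p := by
  unfold pGrade
  simp only [epsAt_eq, eps_eq]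
  refine IsGreatest.csSup_eq ⟨by simp [h], fun L hL => not_lt.1 fun hlt' => ?_⟩
  have := hlt (L - 1) (by omega)
  simp only [Set.mem_ofPred_eq] at hL
  omega

/-- The partial sums vanish far to the left, so `φ ≠ 0` is what bounds the set of maximal places
from below and gives `sInf` its intended meaning. -/
theorem qGrade_spec (h : phi i m ≠ 0) : partialSum (m i) (qGrade i m) = phi i m ∧
    ∀ L < qGrade i m, partialSum (m i) L < phi i m := by
  obtain ⟨A, B, hAB, h1, h2⟩ := exists_partialSum_bounds (m i)
  obtain ⟨L₀, h₀⟩ := exists_partialSum_eq_phi i m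
  obtain ⟨q, hq, hmin⟩ := Int.exists_least_of_bdd (P := fun L => partialSum (m i) L = phi i m)
    ⟨A, fun z hz => not_lt.1 fun hlt => h (by rw [← hz, h1 z hlt])⟩ ⟨L₀, h₀⟩
  have hlt : ∀ L < q, partialSum (m i) L < phi i m := fun L hL =>
    lt_of_le_of_ne (partialSum_le_phi i m L) fun hL' => absurd (hmin L hL') (by omega)
  rw [qGrade_eq hq hlt]
  exact ⟨hq, hlt⟩

/-- Far to the right the partial sums equal the total, and `ε ≠ 0` says that the total is not the
maximum; hence a last maximal place exists. -/
theorem pGrade_spec (h : eps i m ≠ 0) : partialSum (m i) (pGrade i m - 1) = phi i m ∧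
    ∀ L, pGrade i m ≤ L → partialSum (m i) L < phi i m := by
  obtain ⟨A, B, hAB, h1, h2⟩ := exists_partialSum_bounds (m i)
  obtain ⟨L₀, h₀⟩ := exists_partialSum_eq_phi i m
  rw [eps_eq] at h
  obtain ⟨q, hq, hmax⟩ := Int.exists_greatest_of_bdd (P := fun L => partialSum (m i) L = phi i m)
    ⟨B, fun z hz => not_lt.1 fun hlt => h (by rw [← hz, h2 z hlt.le, sub_self])⟩ ⟨L₀, h₀⟩
  have hlt : ∀ L, q + 1 ≤ L → partialSum (m i) L < phi i m := fun L hL =>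
    lt_of_le_of_ne (partialSum_le_phi i m L) fun hL' => absurd (hmax L hL') (by omega)
  rw [pGrade_eq (p := q + 1) (by simpa using hq) hlt]
  exact ⟨by simpa using hq, hlt⟩

theorem apply_qGrade_ne_zero (h : phi i m ≠ 0) : 0 < m i (qGrade i m) := by
  have h1 := qGrade_spec h
  have := h1.2 (qGrade i m - 1) (by omega)
  rw [partialSum_sub_one, ] at h1
  omega

theorem apply_pGrade_ne_zero (h : eps i m ≠ 0) : m i (pGrade i m) < 0 := by
  have h1 := pGrade_spec h
  have := h1.2 (pGrade i m) le_rfl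
  rw [partialSum_sub_one] at this
  omega

/-! ### The monomial crystal -/

theorem cartan_self (i : Idx n) : cartan n i i = 2 := by simp [cartan]

theorem Y_apply (i l : ℤ) (k : Idx n) :
    Y n i l k = if (k : ℤ) = i then Finsupp.single l 1 else 0 := by
  unfold Y
  split_ifs with h1 h2 h3
  · have : k = ⟨i, h1⟩ := Subtype.ext h2
    subst this; simp
  · rw [Pi.single_apply, if_neg]
    rintro rfl; exact h2 rfl
  · exact absurd (h3 ▸ k.2) h1
  · rfl

theorem rootMonomial_self (i : Idx n) (l : ℤ) :
    rootMonomial n i l i = Finsupp.single (l - 1) 1 + Finsupp.single (l + 1) 1 := by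
  unfold rootMonomial
  rw [Pi.add_apply, Pi.add_apply, Finset.sum_apply, Finset.sum_eq_zero, Y_apply, Y_apply]
  · simp
  · intro j hj
    rw [Pi.smul_apply, Y_apply, if_neg, smul_zero]
    simp only [Finset.mem_filter] at hj
    intro h; exact hj.2 (Subtype.ext h.symm)

theorem rootMonomial_of_ne {i j : Idx n} (h : j ≠ i) (l : ℤ) :
    rootMonomial n i l j = Finsupp.single l (cartan n j i) := by
  have h' : (j : ℤ) ≠ i := fun h' => h (Subtype.ext h')
  unfold rootMonomial
  rw [Pi.add_apply, Pi.add_apply, Finset.sum_apply, Finset.sum_eq_single j, Y_apply, Y_apply,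
    if_neg h', if_neg h', Pi.smul_apply, Y_apply, if_pos rfl]
  · simp
  · intro k _ hk
    rw [Pi.smul_apply, Y_apply, if_neg, smul_zero]
    intro h; exact hk (Subtype.ext h.symm)
  · simp [h]

theorem totalSum_rootMonomial (i j : Idx n) (l : ℤ) :
    totalSum (rootMonomial n i l j) = cartan n j i := by
  by_cases h : j = i
  · subst h
    rw [rootMonomial_self, totalSum_add, totalSum_single, totalSum_single, cartan_self]; rfl
  · rw [rootMonomial_of_ne h, totalSum_single]

theorem partialSum_rootMonomial_self (i : Idx n) (l L : ℤ) :
    partialSum (rootMonomial n i l i) L =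
      (if l - 1 ≤ L then 1 else 0) + if l + 1 ≤ L then 1 else 0 := by
  rw [rootMonomial_self, partialSum_add, partialSum_single, partialSum_single]

variable {s : Idx n → ℤ}

theorem apply_eq_zero_of_mem (hm : m ∈ monomialSet n s) {a b : ℤ} (ha : m i a ≠ 0)
    (hb : b = a + 1 ∨ b = a - 1) : m i b = 0 := by
  have h0 : ¬ a ≡ s i + 1 [ZMOD 2] := fun h => ha (hm i a h)
  apply hm
  unfold Int.ModEq at *
  omega

/-- Dividing by `A_{i,q+1}` lowers the partial sums by 1 at `q` and `q + 1` and by 2 from `q + 2`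
on. Parity forces the exponent at `q + 1` to vanish, so the old maximum persists at `q + 1`; the new
maximum is smaller by one and is attained there for the last time. -/
theorem sub_rootMonomial_phi (hm : m ∈ monomialSet n s) (h : phi i m ≠ 0) :
    phi i (m - rootMonomial n i (qGrade i m + 1)) = phi i m - 1 ∧
    pGrade i (m - rootMonomial n i (qGrade i m + 1)) = qGrade i m + 2 := by
  set q := qGrade i m with hq
  obtain ⟨h1, h2⟩ := qGrade_spec h
  have h3 : m i (q + 1) = 0 :=
    apply_eq_zero_of_mem hm (apply_qGrade_ne_zero h).ne' (Or.inl rfl)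
  have h4 : partialSum (m i) (q + 1) = phi i m := by
    rw [partialSum_sub_one, h3, add_sub_cancel_right, h1, add_zero]
  have key : ∀ L, partialSum ((m - rootMonomial n i (q + 1)) i) L = partialSum (m i) L -
      ((if q ≤ L then 1 else 0) + if q + 2 ≤ L then 1 else 0) := by
    intro L
    rw [Pi.sub_apply, partialSum_sub, partialSum_rootMonomial_self]
    simp only [add_sub_cancel_right, add_assoc]; rfl
  have hphi : phi i (m - rootMonomial n i (q + 1)) = phi i m - 1 := by
    apply phi_eq (L₀ := q + 1)
    · intro L
      rw [key]
      have := partialSum_le_phi i m L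
      by_cases hL : q ≤ L
      · rw [if_pos hL]; split_ifs <;> omega
      · have := h2 L (by omega)
        rw [if_neg hL]; split_ifs <;> omega
    · rw [key, h4, if_pos (by omega), if_neg (by omega)]; omega
  refine ⟨hphi, pGrade_eq ?_ ?_⟩
  · rw [hphi, key, show q + 2 - 1 = q + 1 by ring, h4, if_pos (by omega), if_neg (by omega)]; omega
  · intro L hL
    rw [hphi, key, if_pos (by omega), if_pos hL]
    have := partialSum_le_phi i m L
    omega

/-- The mirror image: by parity the last maximum also occurs at `p - 2`, and there the sum grows by
one before it grows by two at `p`, where it was already strictly smaller. -/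
theorem add_rootMonomial_phi (hm : m ∈ monomialSet n s) (h : eps i m ≠ 0) :
    phi i (m + rootMonomial n i (pGrade i m - 1)) = phi i m + 1 ∧
    qGrade i (m + rootMonomial n i (pGrade i m - 1)) = pGrade i m - 2 := by
  set p := pGrade i m with hp
  obtain ⟨h1, h2⟩ := pGrade_spec h
  have h3 : m i (p - 1) = 0 :=
    apply_eq_zero_of_mem hm (apply_pGrade_ne_zero h).ne (Or.inr rfl)
  have h4 : partialSum (m i) (p - 2) = phi i m := by
    rw [partialSum_sub_one, h3, add_zero, sub_sub] at h1
    exact h1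
  have key : ∀ L, partialSum ((m + rootMonomial n i (p - 1)) i) L = partialSum (m i) L +
      ((if p - 2 ≤ L then 1 else 0) + if p ≤ L then 1 else 0) := by
    intro L
    rw [Pi.add_apply, partialSum_add, partialSum_rootMonomial_self]
    simp only [sub_add_cancel, sub_sub]; rfl
  have hphi : phi i (m + rootMonomial n i (p - 1)) = phi i m + 1 := by
    apply phi_eq (L₀ := p - 2)
    · intro L
      rw [key]
      have := partialSum_le_phi i m L
      by_cases hL : p ≤ L
      · have := h2 L hL
        rw [if_pos hL]; split_ifs <;> omega
      · rw [if_neg hL]; split_ifs <;> omega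
    · rw [key, h4, if_pos le_rfl, if_neg (by omega)]; omega
  refine ⟨hphi, qGrade_eq ?_ ?_⟩
  · rw [hphi, key, h4, if_pos le_rfl, if_neg (by omega)]; omega
  · intro L hL
    rw [hphi, key, if_neg (by omega), if_neg (by omega)]
    have := partialSum_le_phi i m L
    omega

theorem rootMonomial_mem (hs : IsColoring n s) {i : Idx n} {l : ℤ} (hl : l ≡ s i + 1 [ZMOD 2]) :
    rootMonomial n i l ∈ monomialSet n s := by
  intro j l' hl'
  by_cases h : j = i
  · subst h
    rw [rootMonomial_self, Finsupp.add_apply, Finsupp.single_apply, Finsupp.single_apply]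
    unfold Int.ModEq at *
    rw [if_neg (by omega), if_neg (by omega)]; rfl
  · rw [rootMonomial_of_ne h, Finsupp.single_apply]
    split_ifs with hll
    -- A nonzero off-diagonal entry of the Cartan matrix is at most `-1`, so the colors of `i` and
    -- `j` differ, and `l` has the parity that is allowed for `j`.
    · by_contra hc
      have hc' : cartan n j i ≤ -1 := by
        unfold cartan at hc ⊢
        rw [if_neg h] at hc ⊢
        split_ifs at hc ⊢ <;> omega
      have := hs.2 _ _ hc'
      unfold Int.ModEq at *
      have := hs.1 i
      have := hs.1 j
      omega
    · rfl

theorem monomialSet_add {m m' : Monomial n} (h : m ∈ monomialSet n s) (h' : m' ∈ monomialSet n s) :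
    m + m' ∈ monomialSet n s := by
  intro i l hl
  rw [Pi.add_apply, Finsupp.add_apply, h i l hl, h' i l hl]; rfl

theorem monomialSet_sub {m m' : Monomial n} (h : m ∈ monomialSet n s) (h' : m' ∈ monomialSet n s) :
    m - m' ∈ monomialSet n s := by
  intro i l hl
  rw [Pi.sub_apply, Finsupp.sub_apply, h i l hl, h' i l hl]; rfl

theorem modEq_of_apply_ne_zero (hm : m ∈ monomialSet n s) {l : ℤ}
    (h : m i l ≠ 0) : l ≡ s i [ZMOD 2] := by
  have h0 : ¬ l ≡ s i + 1 [ZMOD 2] := fun h' => h (hm i l h')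
  unfold Int.ModEq at *
  omega

theorem f_mem (hs : IsColoring n s) (hm : m ∈ monomialSet n s) (h : phi i m ≠ 0) :
    m - rootMonomial n i (qGrade i m + 1) ∈ monomialSet n s :=
  monomialSet_sub hm (rootMonomial_mem hs
    ((modEq_of_apply_ne_zero hm (apply_qGrade_ne_zero h).ne').add_right 1))

theorem e_mem (hs : IsColoring n s) (hm : m ∈ monomialSet n s) (h : eps i m ≠ 0) :
    m + rootMonomial n i (pGrade i m - 1) ∈ monomialSet n s := by
  refine monomialSet_add hm (rootMonomial_mem hs ?_)
  have := modEq_of_apply_ne_zero hm (apply_pGrade_ne_zero h).ne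
  unfold Int.ModEq at *
  omega

theorem monomial_f_eq_some {m' : Monomial n} : (monomialOps n).f i m = some m' ↔
    phi i m ≠ 0 ∧ m' = m - rootMonomial n i (qGrade i m + 1) := by
  unfold monomialOps
  dsimp only
  split_ifs with h
  · simp [h]
  · simp [h, eq_comm]

theorem monomial_e_eq_some {m' : Monomial n} : (monomialOps n).e i m = some m' ↔
    eps i m ≠ 0 ∧ m' = m + rootMonomial n i (pGrade i m - 1) := by
  unfold monomialOps
  dsimp only
  split_ifs with h
  · simp [h]
  · simp [h, eq_comm]

/-- `𝓜` is a crystal. -/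
theorem isCrystalOn_monomialSet (hs : IsColoring n s) :
    IsCrystalOn (monomialOps n) (monomialSet n s) := by
  have hf : ∀ i, ∀ m ∈ monomialSet n s, ∀ m', (monomialOps n).f i m = some m' →
      eps i m' = eps i m + 1 := by
    intro i m hm m' h
    obtain ⟨h0, rfl⟩ := monomial_f_eq_some.1 h
    rw [eps_eq, eps_eq, (sub_rootMonomial_phi hm h0).1, Pi.sub_apply, totalSum_sub,
      totalSum_rootMonomial, cartan_self]
    ring
  have he : ∀ i, ∀ m ∈ monomialSet n s, ∀ m', (monomialOps n).e i m = some m' →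
      phi i m' = phi i m + 1 := by
    intro i m hm m' h
    obtain ⟨h0, rfl⟩ := monomial_e_eq_some.1 h
    rw [(add_rootMonomial_phi hm h0).1]
  constructor
  · intro i m hm m' h
    obtain ⟨h0, rfl⟩ := monomial_e_eq_some.1 h
    exact e_mem hs hm h0
  · intro i m hm m' h
    obtain ⟨h0, rfl⟩ := monomial_f_eq_some.1 h
    exact f_mem hs hm h0
  · intro i m hm
    have := eps_eq i m
    show phi i m = eps i m + totalSum (m i)
    omega
  · intro i m hm m' h j
    obtain ⟨h0, rfl⟩ := monomial_e_eq_some.1 h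
    rw [wt_eq, wt_eq, Pi.add_apply, totalSum_add, totalSum_rootMonomial]
  · intro i m hm m' h
    obtain ⟨h0, rfl⟩ := monomial_e_eq_some.1 h
    show eps i _ = eps i m - 1
    rw [eps_eq, eps_eq, (add_rootMonomial_phi hm h0).1, Pi.add_apply, totalSum_add,
      totalSum_rootMonomial, cartan_self]
    ring
  · exact he
  · intro i m hm m' h j
    obtain ⟨h0, rfl⟩ := monomial_f_eq_some.1 h
    rw [wt_eq, wt_eq, Pi.sub_apply, totalSum_sub, totalSum_rootMonomial]
  · exact hf
  · intro i m hm m' h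
    obtain ⟨h0, rfl⟩ := monomial_f_eq_some.1 h
    exact (sub_rootMonomial_phi hm h0).1
  -- The grade `p` after `f̃_i` is `q + 2` and the grade `q` after `ẽ_i` is `p - 2`, so both
  -- operators use the same factor `A_{i,q+1} = A_{i,p-1}`.
  · intro i m hm m' hm'
    constructor
    · intro h
      have h1 := he i m hm m' h
      obtain ⟨h0, rfl⟩ := monomial_e_eq_some.1 h
      refine monomial_f_eq_some.2 ⟨by have := phi_nonneg i m; omega, ?_⟩
      rw [(add_rootMonomial_phi hm h0).2, show pGrade i m - 2 + 1 = pGrade i m - 1 by ring,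
        add_sub_cancel_right]
    · intro h
      have h1 := hf i m' hm' m h
      obtain ⟨h0, rfl⟩ := monomial_f_eq_some.1 h
      refine monomial_e_eq_some.2 ⟨by have := eps_nonneg i m'; omega, ?_⟩
      rw [(sub_rootMonomial_phi hm' h0).2, show qGrade i m' + 2 - 1 = qGrade i m' + 1 by ring,
        sub_add_cancel]

theorem component_subset (hs : IsColoring n s) (hm : m ∈ monomialSet n s) :
    component m ⊆ monomialSet n s := by
  intro m' h
  induction h with
  | base => exact hm
  | e_step i b b' _ h ih => exact (isCrystalOn_monomialSet hs).e_mem i b ih b' h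
  | f_step i b b' _ h ih => exact (isCrystalOn_monomialSet hs).f_mem i b ih b' h

end CrystalTypeC

namespace CrystalTypeC

/-! ### Local analysis of admissible profiles -/

/-- For a tableau and `0 ≤ j ≤ n`: the number of letters of the first column beyond `j` (`x`) and
beyond the barred `j + 1` (`y`), and the number of letters of the second column up to `j` (`v`) and
up to the barred `j + 1` (`w`). -/
@[ext] structure Quad where
  x : ℤ
  y : ℤ
  v : ℤ
  w : ℤ

/-- The conditions that membership in `C_{ℓ,h,r}` imposes on the quadruples `p` at `j - 1` and `q`
at `j`, where `m = n - j` and `r ≥ 1`. -/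
structure Loc (r m : ℤ) (p q : Quad) : Prop where
  hx : p.x = q.x ∨ p.x = q.x + 1
  hy : q.y = p.y ∨ q.y = p.y + 1
  hv : q.v = p.v ∨ q.v = p.v + 1
  hw : p.w = q.w ∨ p.w = q.w + 1
  x_nonneg : 0 ≤ q.x
  y_nonneg : 0 ≤ p.y
  v_nonneg : 0 ≤ p.v
  w_nonneg : 0 ≤ q.w
  y_le_x : q.y ≤ q.x
  v_le_w : q.v ≤ q.w
  vy : q.v = 0 ∨ q.y = 0
  c2 : ¬ (p.x = q.x + 1 ∧ q.y = p.y + 1 ∧ m + q.y - q.x = 1)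
  c3 : ¬ (q.v = p.v + 1 ∧ p.w = q.w + 1 ∧ m - q.w + q.v = 1)
  c4 : ¬ (p.x = q.x + 1 ∧ p.w = q.w + 1 ∧ m - r - q.w - q.x = 0)
  c5 : 0 < q.v → 0 < p.x → p.w = q.w + 1 ∧ q.w + 1 ≤ m ∧ m + 1 ≤ q.w + r
  c6 : 0 < p.w → 0 < q.y → p.x = q.x + 1 ∧ q.x + 1 ≤ m ∧ m + 1 ≤ q.x + r

/-- `e` if `a ≤ L` and `0` otherwise. -/
def ramp (e a L : ℤ) : ℤ := if a ≤ L then e else 0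

/-- The four paths that make up the two columns. -/
inductive Vertex
  | x
  | y
  | v
  | w

namespace Quad

/-- The normalized levels of the variables contributed by the four paths. -/
def level (r m : ℤ) (q : Quad) : Vertex → ℤ
  | .x => q.x
  | .y => m + q.y
  | .v => -r - q.v
  | .w => m - r - q.w

/-- The exponents of these variables. -/
def expo (p q s : Quad) : Vertex → ℤ
  | .x => p.x - q.x - (q.x - s.x)
  | .y => s.y - q.y - (q.y - p.y)
  | .v => q.v - p.v - (s.v - q.v)
  | .w => q.w - s.w - (p.w - q.w)

/-- There is a box that contributes the variable of the given path with exponent `1`. -/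
def Plus (p q s : Quad) : Vertex → Prop
  | .x => p.x = q.x + 1
  | .y => s.y = q.y + 1
  | .v => q.v = p.v + 1
  | .w => q.w = s.w + 1

/-- There is a box that contributes the variable of the given path with exponent `-1`. -/
def Minus (p q s : Quad) : Vertex → Prop
  | .x => q.x = s.x + 1
  | .y => q.y = p.y + 1
  | .v => s.v = q.v + 1
  | .w => p.w = q.w + 1

/-- The effect of `f̃` on one of the four paths. -/
def raise (q : Quad) : Vertex → Quad
  | .x => ⟨q.x + 1, q.y, q.v, q.w⟩
  | .y => ⟨q.x, q.y + 1, q.v, q.w⟩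
  | .v => ⟨q.x, q.y, q.v - 1, q.w⟩
  | .w => ⟨q.x, q.y, q.v, q.w - 1⟩

/-- The effect of `ẽ` on one of the four paths. -/
def lower (q : Quad) : Vertex → Quad
  | .x => ⟨q.x - 1, q.y, q.v, q.w⟩
  | .y => ⟨q.x, q.y - 1, q.v, q.w⟩
  | .v => ⟨q.x, q.y, q.v + 1, q.w⟩
  | .w => ⟨q.x, q.y, q.v, q.w + 1⟩

/-- The duality that interchanges the two columns and `ẽ`, `f̃`. -/
def dual (q : Quad) : Quad := ⟨q.w, q.v, q.y, q.x⟩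

end Quad

/-- The duality on paths. -/
def Vertex.dual : Vertex → Vertex
  | .x => .w
  | .y => .v
  | .v => .y
  | .w => .x

open Quad

/-- The sum of the exponents at levels `≤ L`. -/
def psum (r m : ℤ) (p q s : Quad) (L : ℤ) : ℤ :=
  ramp (expo p q s .x) (level r m q .x) L + ramp (expo p q s .y) (level r m q .y) L
  + ramp (expo p q s .v) (level r m q .v) L + ramp (expo p q s .w) (level r m q .w) L

/-- `P` attains its maximum, which is positive, first at `a`. -/
structure Peak (P : ℤ → ℤ) (a : ℤ) : Prop where
  pos : 0 < P a
  lt : ∀ L < a, P L < P a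
  le : ∀ L, P L ≤ P a

/-- The rule by which `f̃` selects one of the entries that contribute at the same level. -/
def PlusPick (r m : ℤ) (p q s : Quad) : Vertex → Prop
  | .x => ¬ (Plus p q s .w ∧ level r m q .w = level r m q .x)
  | .y => ¬ (Plus p q s .x ∧ level r m q .x = level r m q .y)
  | .v => True
  | .w => (Plus p q s .x ∧ level r m q .x = level r m q .w) ∨
      (Plus p q s .y ∧ level r m q .y = level r m q .w) ∨
      ¬ (Plus p q s .v ∧ level r m q .v = level r m q .w)

/-- The rule by which `ẽ` selects one of the entries that contribute at the same level. -/
def MinusPick (r m : ℤ) (p q s : Quad) : Vertex → Prop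
  | .w => ¬ (Minus p q s .x ∧ level r m q .x = level r m q .w)
  | .v => ¬ (Minus p q s .w ∧ level r m q .w = level r m q .v)
  | .y => True
  | .x => (Minus p q s .w ∧ level r m q .w = level r m q .x) ∨
      (Minus p q s .v ∧ level r m q .v = level r m q .x) ∨
      ¬ (Minus p q s .y ∧ level r m q .y = level r m q .x)

variable {r m : ℤ} {p q s : Quad}

/-- The peak enters only through a few inequalities: the partial sums increase strictly at the
chosen level and compare in the right way with their values at the levels of the other paths. With
these, every condition for the raised quadruple is linear arithmetic. -/
theorem loc_raise_x (hr : 1 ≤ r) (h0 : Loc r m p q) (h1 : Loc r (m - 1) q s)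
    (hp : Peak (psum r m p q s) (level r m q .x)) (hx : Plus p q s .x)
    (hw : PlusPick r m p q s .x) :
    Loc r m p (raise q .x) ∧ Loc r (m - 1) (raise q .x) s := by
  obtain ⟨a1,a2,a3,a4,a5,a6,a7,a8,a9,a10,a11,a12,a13,a14,a15,a16⟩ := h0
  obtain ⟨b1,b2,b3,b4,b5,b6,b7,b8,b9,b10,b11,b12,b13,b14,b15,b16⟩ := h1
  obtain ⟨-, hp2, hp3⟩ := hp
  have l0 := hp2 (level r m q .x - 1) (by omega)
  have l1 := hp3 (level r m q .y)
  have l2 := fun h => hp2 (level r m q .v - 1) h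
  have l3 := fun h => hp2 (level r m q .w - 1) h
  clear hp2 hp3
  simp only [psum, ramp, expo, level, Plus, PlusPick] at l0 l1 l2 l3 hx hw
  -- Otherwise the path `x` contributes exponent 0, and the increase at this level must come from
  -- another path. The path `y` is excluded by `c2` for `q`, `s`, the path `v` because its level is
  -- negative, and `w` by the picking rule.
  have h : s.x = q.x := by
    clear l1 l2 l3
    grind (splits := 40)
  simp only [raise]
  refine ⟨⟨?_, ?_, ?_, ?_, ?_, ?_, ?_, ?_, ?_, ?_, ?_, ?_, ?_, ?_, ?_, ?_⟩,
    ⟨?_, ?_, ?_, ?_, ?_, ?_, ?_, ?_, ?_, ?_, ?_, ?_, ?_, ?_, ?_, ?_⟩⟩ <;> (try dsimp only)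
  -- The raised path no longer drops between `p` and `q`, so the conclusion of `c6` fails and its
  -- premises have to be refuted by means of the peak.
  case refine_16 =>
    intro u1 u2
    exfalso
    have := a16 u1 u2
    grind (splits := 40)
  all_goals try (clear l0 l1 l2 l3 hw a12 a13 a14 a15 b12 b13 b14 b15 b16; omega)
  all_goals grind (splits := 40)

theorem loc_raise_y (hr : 1 ≤ r) (h0 : Loc r m p q) (h1 : Loc r (m - 1) q s)
    (hp : Peak (psum r m p q s) (level r m q .y)) (hx : Plus p q s .y)
    (hw : PlusPick r m p q s .y) :
    Loc r m p (raise q .y) ∧ Loc r (m - 1) (raise q .y) s := by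
  obtain ⟨a1,a2,a3,a4,a5,a6,a7,a8,a9,a10,a11,a12,a13,a14,a15,a16⟩ := h0
  obtain ⟨b1,b2,b3,b4,b5,b6,b7,b8,b9,b10,b11,b12,b13,b14,b15,b16⟩ := h1
  obtain ⟨-, hp2, hp3⟩ := hp
  have l0 := hp2 (level r m q .y - 1) (by omega)
  have l1 := hp3 (level r m q .x)
  have l2 := fun h => hp2 (level r m q .x - 1) h
  have l3 := fun h => hp2 (level r m q .w - 1) h
  clear hp2 hp3
  simp only [psum, ramp, expo, level, Plus, PlusPick] at l0 l1 l2 l3 hx hw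
  have h : q.y = p.y := by
    clear l1 l2 l3
    grind (splits := 40)
  simp only [raise]
  refine ⟨⟨?_, ?_, ?_, ?_, ?_, ?_, ?_, ?_, ?_, ?_, ?_, ?_, ?_, ?_, ?_, ?_⟩,
    ⟨?_, ?_, ?_, ?_, ?_, ?_, ?_, ?_, ?_, ?_, ?_, ?_, ?_, ?_, ?_, ?_⟩⟩ <;> (try dsimp only)
  all_goals try (clear l0 l1 l2 l3 hw a12 a13 a14 a15 b12 b13 b14 b15 b16; omega)
  all_goals grind (splits := 40)

theorem loc_raise_v (hr : 1 ≤ r) (h0 : Loc r m p q) (h1 : Loc r (m - 1) q s)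
    (hp : Peak (psum r m p q s) (level r m q .v)) (hx : Plus p q s .v) :
    Loc r m p (raise q .v) ∧ Loc r (m - 1) (raise q .v) s := by
  obtain ⟨a1,a2,a3,a4,a5,a6,a7,a8,a9,a10,a11,a12,a13,a14,a15,a16⟩ := h0
  obtain ⟨b1,b2,b3,b4,b5,b6,b7,b8,b9,b10,b11,b12,b13,b14,b15,b16⟩ := h1
  obtain ⟨-, hp2, hp3⟩ := hp
  have l0 := hp2 (level r m q .v - 1) (by omega)
  have l1 := hp3 (level r m q .w)
  clear hp2 hp3
  simp only [psum, ramp, expo, level, Plus] at l0 l1 hx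
  have h : s.v = q.v := by
    clear l1
    grind (splits := 40)
  simp only [raise]
  refine ⟨⟨?_, ?_, ?_, ?_, ?_, ?_, ?_, ?_, ?_, ?_, ?_, ?_, ?_, ?_, ?_, ?_⟩,
    ⟨?_, ?_, ?_, ?_, ?_, ?_, ?_, ?_, ?_, ?_, ?_, ?_, ?_, ?_, ?_, ?_⟩⟩ <;> (try dsimp only)
  all_goals try (clear l0 l1 a12 a13 a14 a15 b12 b13 b14 b15 b16; omega)
  all_goals grind (splits := 40)

theorem loc_raise_w (hr : 1 ≤ r) (h0 : Loc r m p q) (h1 : Loc r (m - 1) q s)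
    (hp : Peak (psum r m p q s) (level r m q .w)) (hx : Plus p q s .w)
    (hw : PlusPick r m p q s .w) :
    Loc r m p (raise q .w) ∧ Loc r (m - 1) (raise q .w) s := by
  obtain ⟨a1,a2,a3,a4,a5,a6,a7,a8,a9,a10,a11,a12,a13,a14,a15,a16⟩ := h0
  obtain ⟨b1,b2,b3,b4,b5,b6,b7,b8,b9,b10,b11,b12,b13,b14,b15,b16⟩ := h1
  obtain ⟨-, hp2, hp3⟩ := hp
  have l0 := hp2 (level r m q .w - 1) (by omega)
  have l1 := hp3 (level r m q .x)
  have l2 := hp3 (level r m q .y)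
  have l3 := fun h => hp2 (level r m q .v - 1) h
  clear hp2 hp3
  simp only [psum, ramp, expo, level, Plus, PlusPick] at l0 l1 l2 l3 hx hw
  have h : p.w = q.w := by
    clear l1 l2 l3
    grind (splits := 40)
  simp only [raise]
  refine ⟨⟨?_, ?_, ?_, ?_, ?_, ?_, ?_, ?_, ?_, ?_, ?_, ?_, ?_, ?_, ?_, ?_⟩,
    ⟨?_, ?_, ?_, ?_, ?_, ?_, ?_, ?_, ?_, ?_, ?_, ?_, ?_, ?_, ?_, ?_⟩⟩ <;> (try dsimp only)
  all_goals try (clear l0 l1 l2 l3 hw a12 a13 a14 a15 b12 b13 b14 b15 b16; omega)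
  all_goals grind (splits := 40)

/-- The local conditions persist under `f̃_k`, `k < n`. -/
theorem loc_raise (hr : 1 ≤ r) (h0 : Loc r m p q) (h1 : Loc r (m - 1) q s) {i : Vertex}
    (hp : Peak (psum r m p q s) (level r m q i)) (hx : Plus p q s i)
    (hw : PlusPick r m p q s i) :
    Loc r m p (raise q i) ∧ Loc r (m - 1) (raise q i) s := by
  cases i
  · exact loc_raise_x hr h0 h1 hp hx hw
  · exact loc_raise_y hr h0 h1 hp hx hw
  · exact loc_raise_v hr h0 h1 hp hx
  · exact loc_raise_w hr h0 h1 hp hx hw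

/-- The conditions on the quadruple at `n`. -/
structure End (q : Quad) : Prop where
  xy : q.x = q.y
  vw : q.v = q.w
  mid : q.v = 0 ∨ q.x = 0

/-- Replacing `n` by the barred `n` moves `x` and `y` together, as the two counts agree at `n`. The
third quadruple is `q` again because profiles are continued by a constant beyond `n`. -/
theorem loc_raise_end_x (hr : 1 ≤ r) (h0 : Loc r 0 p q) (he : End q)
    (hp : Peak (psum r 0 p q q) (level r 0 q .x)) (hx : Plus p q q .x) :
    Loc r 0 p ((raise q .x).raise .y) ∧ End ((raise q .x).raise .y) := by
  obtain ⟨a1,a2,a3,a4,a5,a6,a7,a8,a9,a10,a11,a12,a13,a14,a15,a16⟩ := h0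
  obtain ⟨hp1, hp2, hp3⟩ := hp
  obtain ⟨hxy, hvw, hmid⟩ := he
  have l0 := hp2 (level r 0 q .x - 1) (by omega)
  have l3 := fun h => hp2 (level r 0 q .v - 1) h
  clear hp1 hp2 hp3
  simp only [psum, ramp, expo, level, Plus] at l0 l3 hx
  simp only [raise]
  refine ⟨⟨?_, ?_, ?_, ?_, ?_, ?_, ?_, ?_, ?_, ?_, ?_, ?_, ?_, ?_, ?_, ?_⟩, ⟨?_, ?_, ?_⟩⟩ <;>
    (try dsimp only)
  all_goals grind (splits := 40)

theorem loc_raise_end_v (h0 : Loc r 0 p q) (he : End q)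
    (hp : Peak (psum r 0 p q q) (level r 0 q .v)) (hx : Plus p q q .v) :
    Loc r 0 p ((raise q .v).raise .w) ∧ End ((raise q .v).raise .w) := by
  obtain ⟨a1,a2,a3,a4,a5,a6,a7,a8,a9,a10,a11,a12,a13,a14,a15,a16⟩ := h0
  obtain ⟨hp1, hp2, hp3⟩ := hp
  obtain ⟨hxy, hvw, hmid⟩ := he
  have l0 := hp2 (level r 0 q .v - 1) (by omega)
  clear hp1 hp2 hp3
  simp only [psum, ramp, expo, level, Plus] at l0 hx
  simp only [raise]
  refine ⟨⟨?_, ?_, ?_, ?_, ?_, ?_, ?_, ?_, ?_, ?_, ?_, ?_, ?_, ?_, ?_, ?_⟩, ⟨?_, ?_, ?_⟩⟩ <;>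
    (try dsimp only)
  all_goals grind (splits := 40)

/-- The duality interchanges `c2` with `c3` and `c5` with `c6`, and fixes `c4` and `vy`. This
symmetry between the columns saves a separate analysis of `ẽ`. -/
theorem Loc.dual (h : Loc r m p q) : Loc r m p.dual q.dual := by
  obtain ⟨a1,a2,a3,a4,a5,a6,a7,a8,a9,a10,a11,a12,a13,a14,a15,a16⟩ := h
  unfold Quad.dual
  refine ⟨?_, ?_, ?_, ?_, ?_, ?_, ?_, ?_, ?_, ?_, ?_, ?_, ?_, ?_, ?_, ?_⟩ <;>
    dsimp only <;> omega

theorem End.dual (h : End q) : End q.dual := ⟨h.vw.symm, h.xy.symm, by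
  have := h.mid; have := h.xy; have := h.vw
  simp only [Quad.dual]; omega⟩

theorem Loc.of_dual (h : Loc r m p.dual q.dual) : Loc r m p q := h.dual

/-- The local conditions persist under `ẽ_k`, `k < n`. -/
theorem loc_lower (hr : 1 ≤ r) (h0 : Loc r m p q) (h1 : Loc r (m - 1) q s) {i : Vertex}
    (hp : Peak (psum r m p.dual q.dual s.dual) (m - r - level r m q i)) (hx : Minus p q s i)
    (hw : MinusPick r m p q s i) :
    Loc r m p (lower q i) ∧ Loc r (m - 1) (lower q i) s := by
  have hl : ∀ j : Vertex, level r m q.dual j.dual = m - r - level r m q j := by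
    intro j
    cases j <;> simp only [level, Quad.dual, Vertex.dual] <;> ring
  have hpl : ∀ j : Vertex, Plus p.dual q.dual s.dual j.dual ↔ Minus p q s j := by
    intro j
    cases j <;> rfl
  have key : Loc r m p.dual (raise q.dual i.dual) ∧ Loc r (m - 1) (raise q.dual i.dual) s.dual := by
    refine loc_raise hr h0.dual h1.dual (by rwa [hl]) ((hpl i).2 hx) ?_
    have h2 := hl .x
    have h3 := hl .y
    have h4 := hl .v
    have h5 := hl .w
    have h6 := hpl .x
    have h7 := hpl .y
    have h8 := hpl .v
    have h9 := hpl .w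
    simp only [Vertex.dual] at h2 h3 h4 h5 h6 h7 h8 h9
    cases i <;> simp only [MinusPick, PlusPick, Vertex.dual, h2, h3, h4, h5, h6, h7, h8, h9,
      sub_right_inj] at hw ⊢ <;> exact hw
  have e : raise q.dual i.dual = (lower q i).dual := by cases i <;> rfl
  rw [e] at key
  exact ⟨key.1.of_dual, key.2.of_dual⟩

theorem loc_lower_end_w (hr : 1 ≤ r) (h0 : Loc r 0 p q) (he : End q)
    (hp : Peak (psum r 0 p.dual q.dual q.dual) (0 - r - level r 0 q .w)) (hx : Minus p q q .w) :
    Loc r 0 p ((lower q .w).lower .v) ∧ End ((lower q .w).lower .v) := by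
  have := loc_raise_end_x hr h0.dual he.dual
    (by simpa only [level, Quad.dual, zero_sub, sub_sub_cancel, sub_neg_eq_add, neg_add_cancel_comm,
      sub_sub_cancel_left, sub_sub_self, neg_sub_neg, add_sub_cancel_left, neg_sub,
      sub_neg, sub_add_cancel] using hp) hx
  exact ⟨this.1.of_dual, this.2.dual⟩

theorem loc_lower_end_y (h0 : Loc r 0 p q) (he : End q)
    (hp : Peak (psum r 0 p.dual q.dual q.dual) (0 - r - level r 0 q .y)) (hx : Minus p q q .y) :
    Loc r 0 p ((lower q .y).lower .x) ∧ End ((lower q .y).lower .x) := by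
  have := loc_raise_end_v h0.dual he.dual
    (by simpa only [level, Quad.dual, zero_sub, zero_add] using hp) hx
  exact ⟨this.1.of_dual, this.2.dual⟩

/-- The duality negates the exponents and reflects the levels at `(m - r) / 2`. An initial sum of
the dual is thus the negative of the tail sum from `L`, which is the quantity that `ε` maximizes. -/
theorem psum_dual (L : ℤ) : psum r m p.dual q.dual s.dual (m - r - L) =
    psum r m p q s (L - 1) -
      (expo p q s .x + expo p q s .y + expo p q s .v + expo p q s .w) := by
  simp only [psum, ramp, expo, level, Quad.dual]
  split_ifs <;> omega

end CrystalTypeC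

namespace CrystalTypeC

/-! ### Columns and their profiles -/

open Quad

variable {n ℓ h r : ℤ} {T : Tableau ℓ}

/-- The entries lie in the alphabet, and both columns increase strictly. -/
structure IsColumns (n h : ℤ) (T : Tableau ℓ) : Prop where
  mem : ∀ a, (T a).InB n
  col₁ : ∀ a b : Idx ℓ, a < b → (b : ℤ) ≤ h → (T a).rank n < (T b).rank n
  col₂ : ∀ a b : Idx ℓ, a < b → h < (a : ℤ) → (T a).rank n < (T b).rank n

theorem Letter.one_le_rank {x : Letter} (hx : x.InB n) : 1 ≤ x.rank n := by
  cases x <;> simp only [Letter.InB, Letter.rank] at * <;> omega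

theorem Letter.rank_le {x : Letter} (hx : x.InB n) : x.rank n ≤ 2 * n := by
  cases x <;> simp only [Letter.InB, Letter.rank] at * <;> omega

theorem Letter.rank_eq_plain {x : Letter} (hx : x.InB n) {k : ℤ} (hk : k ≤ n) :
    x.rank n = k ↔ x = .plain k := by
  cases x <;> simp only [Letter.InB, Letter.rank, Letter.plain.injEq, reduceCtorEq, iff_false] at *
  omega

theorem Letter.rank_eq_bar {x : Letter} (hx : x.InB n) {k : ℤ} (hk : k ≤ n) :
    x.rank n = 2 * n + 1 - k ↔ x = .bar k := by
  cases x <;> simp only [Letter.InB, Letter.rank, Letter.bar.injEq, reduceCtorEq, iff_false] at * <;>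
    omega

/-- The number of letters of the first column of rank greater than `s`. -/
noncomputable def colOne (n h : ℤ) (T : Tableau ℓ) (s : ℤ) : ℤ :=
  ∑ a : Idx ℓ, if (a : ℤ) ≤ h ∧ s < (T a).rank n then 1 else 0

/-- The number of letters of the second column of rank at most `s`. -/
noncomputable def colTwo (n h : ℤ) (T : Tableau ℓ) (s : ℤ) : ℤ :=
  ∑ a : Idx ℓ, if h < (a : ℤ) ∧ (T a).rank n ≤ s then 1 else 0

/-- The profile of a tableau, extended by a constant beyond `n`. -/
noncomputable def prof (n h : ℤ) (T : Tableau ℓ) (j : ℤ) : Quad :=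
  ⟨colOne n h T (min j n), colOne n h T (2 * n - min j n),
    colTwo n h T (min j n), colTwo n h T (2 * n - min j n)⟩

theorem sum_idx_interval {p q : ℤ} (hp : 1 ≤ p) (hq : q ≤ ℓ) (hpq : p ≤ q + 1) :
    (∑ a : Idx ℓ, if p ≤ (a : ℤ) ∧ (a : ℤ) ≤ q then (1 : ℤ) else 0) = q - p + 1 := by
  rw [← Finset.sum_subtype (Finset.Icc 1 ℓ) (by simp)
    (fun a : ℤ => if p ≤ a ∧ a ≤ q then (1 : ℤ) else 0), Finset.sum_boole]
  have : (Finset.Icc 1 ℓ).filter (fun a => p ≤ a ∧ a ≤ q) = Finset.Icc p q := by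
    ext a; simp only [Finset.mem_filter, Finset.mem_Icc]; omega
  rw [this, Int.card_Icc]
  omega

theorem IsColumns.lt_iff_one (hT : IsColumns n h T) {a b : Idx ℓ} (ha : (a : ℤ) ≤ h)
    (hb : (b : ℤ) ≤ h) : (T a).rank n < (T b).rank n ↔ (a : ℤ) < b := by
  constructor
  · intro hab
    by_contra hc
    rcases (not_lt.1 hc).eq_or_lt with h1 | h1
    · rw [Subtype.ext h1] at hab; exact lt_irrefl _ hab
    · exact absurd (hT.col₁ b a h1 ha) (by omega)
  · exact fun hab => hT.col₁ a b hab hb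

theorem IsColumns.lt_iff_two (hT : IsColumns n h T) {a b : Idx ℓ} (ha : h < (a : ℤ))
    (hb : h < (b : ℤ)) : (T a).rank n < (T b).rank n ↔ (a : ℤ) < b := by
  constructor
  · intro hab
    by_contra hc
    rcases (not_lt.1 hc).eq_or_lt with h1 | h1
    · rw [Subtype.ext h1] at hab; exact lt_irrefl _ hab
    · exact absurd (hT.col₂ b a h1 hb) (by omega)
  · exact fun hab => hT.col₂ a b hab ha

theorem IsColumns.colOne_rank (hT : IsColumns n h T) (hℓ : h ≤ ℓ) {a : Idx ℓ} (ha : (a : ℤ) ≤ h) :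
    colOne n h T ((T a).rank n) = h - a := by
  have ha1 := a.2.1
  have : h - a = h - ((a : ℤ) + 1) + 1 := by ring
  rw [this, ← sum_idx_interval (ℓ := ℓ) (by omega) hℓ (by omega)]
  refine Finset.sum_congr rfl fun b _ => if_congr ?_ rfl rfl
  by_cases hb : (b : ℤ) ≤ h
  · rw [hT.lt_iff_one ha hb]; omega
  · omega

theorem IsColumns.colOne_rank_sub_one (hT : IsColumns n h T) (hℓ : h ≤ ℓ) {a : Idx ℓ}
    (ha : (a : ℤ) ≤ h) : colOne n h T ((T a).rank n - 1) = h - a + 1 := by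
  have ha1 := a.2.1
  rw [← sum_idx_interval (ℓ := ℓ) (by omega) hℓ (by omega)]
  refine Finset.sum_congr rfl fun b _ => if_congr ?_ rfl rfl
  by_cases hb : (b : ℤ) ≤ h
  · have := hT.lt_iff_one hb ha; omega
  · omega

theorem IsColumns.colTwo_rank (hT : IsColumns n h T) (h0 : 0 ≤ h) {a : Idx ℓ} (ha : h < (a : ℤ)) :
    colTwo n h T ((T a).rank n) = a - h := by
  have ha1 := a.2.2
  have : (a : ℤ) - h = a - (h + 1) + 1 := by ring
  rw [this, ← sum_idx_interval (ℓ := ℓ) (by omega) ha1 (by omega)]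
  refine Finset.sum_congr rfl fun b _ => if_congr ?_ rfl rfl
  by_cases hb : h < (b : ℤ)
  · have := hT.lt_iff_two ha hb; omega
  · omega

theorem IsColumns.colTwo_rank_sub_one (hT : IsColumns n h T) (h0 : 0 ≤ h) {a : Idx ℓ}
    (ha : h < (a : ℤ)) : colTwo n h T ((T a).rank n - 1) = a - h - 1 := by
  have ha1 := a.2.2
  have : (a : ℤ) - h - 1 = (a - 1) - (h + 1) + 1 := by ring
  rw [this, ← sum_idx_interval (ℓ := ℓ) (by omega) (by omega) (by omega)]
  refine Finset.sum_congr rfl fun b _ => if_congr ?_ rfl rfl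
  by_cases hb : h < (b : ℤ)
  · have := hT.lt_iff_two hb ha; omega
  · omega

theorem colOne_eq_of_forall_ne {s : ℤ} (hs : ∀ a : Idx ℓ, (a : ℤ) ≤ h → (T a).rank n ≠ s) :
    colOne n h T (s - 1) = colOne n h T s := by
  refine Finset.sum_congr rfl fun b _ => if_congr ?_ rfl rfl
  by_cases hb : (b : ℤ) ≤ h
  · have := hs b hb; omega
  · omega

theorem colTwo_eq_of_forall_ne {s : ℤ} (hs : ∀ a : Idx ℓ, h < (a : ℤ) → (T a).rank n ≠ s) :
    colTwo n h T (s - 1) = colTwo n h T s := by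
  refine Finset.sum_congr rfl fun b _ => if_congr ?_ rfl rfl
  by_cases hb : h < (b : ℤ)
  · have := hs b hb; omega
  · omega

/-- `T` is a filling by columns of lengths `h`, `ℓ - h`. -/
structure IsFilling (n h : ℤ) (T : Tableau ℓ) : Prop extends IsColumns n h T where
  h_nonneg : 0 ≤ h
  h_le : h ≤ ℓ

namespace IsFilling

variable (hT : IsFilling n h T)
include hT

/-- A count drops at `s` exactly if the letter of rank `s` is in the column, and then its value is
the distance of that letter from the bottom. Letters and positions can therefore be recovered from
the profile. -/
theorem colOne_step (s : ℤ) :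
    (∃ a : Idx ℓ, (a : ℤ) ≤ h ∧ (T a).rank n = s ∧ colOne n h T s = h - a ∧
      colOne n h T (s - 1) = h - a + 1) ∨
    ((∀ a : Idx ℓ, (a : ℤ) ≤ h → (T a).rank n ≠ s) ∧ colOne n h T (s - 1) = colOne n h T s) := by
  by_cases hs : ∃ a : Idx ℓ, (a : ℤ) ≤ h ∧ (T a).rank n = s
  · obtain ⟨a, ha, rfl⟩ := hs
    exact Or.inl ⟨a, ha, rfl, hT.colOne_rank hT.h_le ha, hT.colOne_rank_sub_one hT.h_le ha⟩
  · push Not at hs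
    exact Or.inr ⟨hs, colOne_eq_of_forall_ne hs⟩

theorem colTwo_step (s : ℤ) :
    (∃ a : Idx ℓ, h < (a : ℤ) ∧ (T a).rank n = s ∧ colTwo n h T s = a - h ∧
      colTwo n h T (s - 1) = a - h - 1) ∨
    ((∀ a : Idx ℓ, h < (a : ℤ) → (T a).rank n ≠ s) ∧ colTwo n h T (s - 1) = colTwo n h T s) := by
  by_cases hs : ∃ a : Idx ℓ, h < (a : ℤ) ∧ (T a).rank n = s
  · obtain ⟨a, ha, rfl⟩ := hs
    exact Or.inl ⟨a, ha, rfl, hT.colTwo_rank hT.h_nonneg ha,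
      hT.colTwo_rank_sub_one hT.h_nonneg ha⟩
  · push Not at hs
    exact Or.inr ⟨hs, colTwo_eq_of_forall_ne hs⟩

end IsFilling

/-! ### The monomial of a tableau in terms of its profile -/

/-- Four ranks contribute to `Y_{k,l}`. For `k = n` the ranks `k + 1` and `2n + 1 - k` coincide, as
do `k` and `2n - k`; the guards `k < n` prevent counting them twice. -/
theorem box_apply {x : Letter} (hx : x.InB n) (p : ℤ) (k : Idx n) (l : ℤ) :
    box n x p k l = ((if x.rank n = k ∧ l = p + (k - 1) then 1 else 0) -
      (if x.rank n = k + 1 ∧ (k : ℤ) < n ∧ l = p + (k + 1) then 1 else 0)) +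
      ((if x.rank n = 2 * n - k ∧ (k : ℤ) < n ∧ l = p + (2 * n - k - 1) then 1 else 0) -
      (if x.rank n = 2 * n + 1 - k ∧ l = p + (2 * n + 1 - k) then 1 else 0)) := by
  have hk := k.2
  simp only [Set.mem_Icc] at hk
  have hy : ∀ i l' : ℤ, Y n i l' k l = if (k : ℤ) = i ∧ l = l' then 1 else 0 := by
    intro i l'
    rw [Y_apply]
    by_cases h1 : (k : ℤ) = i
    · rw [if_pos h1, Finsupp.single_apply]
      exact if_congr (by simp [h1, eq_comm]) rfl rfl
    · simp [h1]
  generalize hρ : x.rank n = ρ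
  cases x with
  | plain i =>
    simp only [Letter.InB, Letter.rank] at hx hρ
    subst hρ
    simp only [box, Pi.sub_apply, Finsupp.sub_apply, hy]
    rw [if_neg (c := i = 2 * n - k ∧ _) (by omega), if_neg (c := i = 2 * n + 1 - k ∧ _) (by omega),
      sub_zero, add_zero]
    congr 1 <;> exact if_congr (by omega) rfl rfl
  | bar i =>
    simp only [Letter.InB, Letter.rank] at hx hρ
    simp only [box, Pi.sub_apply, Finsupp.sub_apply, hy]
    rw [if_neg (c := ρ = k ∧ _) (by omega), if_neg (c := ρ = k + 1 ∧ _) (by omega), sub_zero,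
      zero_add]
    congr 1 <;> exact if_congr (by omega) rfl rfl

/-- Each column contains at most one letter of rank `s`, and the count at `s` tells its position and
hence its suffix. -/
theorem IsFilling.sum_rank_suffix (hT : IsFilling n h T) (r s l c : ℤ) :
    (∑ a : Idx ℓ, if (T a).rank n = s ∧ l = suffix ℓ h r a + c then (1 : ℤ) else 0) =
      (if colOne n h T (s - 1) = colOne n h T s + 1 ∧ l = ℓ + 1 - 2 * (h - colOne n h T s) + c
        then 1 else 0) +
      (if colTwo n h T s = colTwo n h T (s - 1) + 1 ∧
        l = ℓ + 1 - 2 * (h + colTwo n h T s) - 2 * r + c then 1 else 0) := by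
  have key : ∀ a : Idx ℓ, (if (T a).rank n = s ∧ l = suffix ℓ h r a + c then (1 : ℤ) else 0) =
      (if ((a : ℤ) ≤ h ∧ (T a).rank n = s) ∧ l = ℓ + 1 - 2 * (h - colOne n h T s) + c
        then 1 else 0) +
      (if (h < (a : ℤ) ∧ (T a).rank n = s) ∧ l = ℓ + 1 - 2 * (h + colTwo n h T s) - 2 * r + c
        then 1 else 0) := by
    intro a
    unfold suffix
    by_cases hs : (T a).rank n = s
    · subst hs
      by_cases ha : (a : ℤ) ≤ h
      · rw [if_pos ha, hT.colOne_rank hT.h_le ha]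
        split_ifs <;> omega
      · rw [if_neg ha, hT.colTwo_rank hT.h_nonneg (not_le.1 ha)]
        split_ifs <;> omega
    · simp [hs]
  rw [Finset.sum_congr rfl fun a _ => key a, Finset.sum_add_distrib]
  congr 1
  · rcases hT.colOne_step s with ⟨a, ha, hs, h1, h2⟩ | ⟨h1, h2⟩
    · rw [Finset.sum_eq_single a, h1, h2]
      · simp [ha, hs]
      · intro b _ hb
        rw [if_neg]
        rintro ⟨⟨hbh, hbs⟩, -⟩
        have h3 := hT.colOne_rank hT.h_le hbh
        rw [hbs, h1] at h3
        exact hb (Subtype.ext (by omega))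
      · simp
    · rw [Finset.sum_eq_zero, if_neg (by omega)]
      intro a _
      rw [if_neg]
      rintro ⟨⟨ha, hs⟩, -⟩
      exact h1 a ha hs
  · rcases hT.colTwo_step s with ⟨a, ha, hs, h1, h2⟩ | ⟨h1, h2⟩
    · rw [Finset.sum_eq_single a, h1, h2]
      · simp [ha, hs]
      · intro b _ hb
        rw [if_neg]
        rintro ⟨⟨hbh, hbs⟩, -⟩
        have h3 := hT.colTwo_rank hT.h_nonneg hbh
        rw [hbs, h1] at h3
        exact hb (Subtype.ext (by omega))
      · simp
    · rw [Finset.sum_eq_zero, if_neg (by omega)]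
      intro a _
      rw [if_neg]
      rintro ⟨⟨ha, hs⟩, -⟩
      exact h1 a ha hs

theorem prof_of_le {j : ℤ} (hj : j ≤ n) (h : ℤ) (T : Tableau ℓ) : prof n h T j =
    ⟨colOne n h T j, colOne n h T (2 * n - j), colTwo n h T j, colTwo n h T (2 * n - j)⟩ := by
  unfold prof
  rw [min_eq_left hj]

theorem prof_succ_self (n h : ℤ) (T : Tableau ℓ) : prof n h T (n + 1) = prof n h T n := by
  unfold prof
  rw [min_eq_right (by omega), min_self]

/-- The exponents of the variables `Y_{k,l}` in terms of the profile at `k - 1`, `k`, `k + 1`, where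
`m = n - k` and `b` is the level that corresponds to the normalized level `0`. -/
noncomputable def exponents (b r m : ℤ) (p q s : Quad) : ℤ →₀ ℤ :=
  Finsupp.single (b + 2 * level r m q .x) (expo p q s .x) +
  Finsupp.single (b + 2 * level r m q .y) (expo p q s .y) +
  (Finsupp.single (b + 2 * level r m q .v) (expo p q s .v) +
  Finsupp.single (b + 2 * level r m q .w) (expo p q s .w))

/-- Letters of consecutive ranks in one column are adjacent, so the factor of one with exponent `1`
and the factor of the other with exponent `-1` sit at the same level. The two first differences
therefore merge into a second difference. -/
theorem exponents_aux {a b c u v w l : ℤ} (h1 : a = b ∨ a = b + 1) (h2 : b = c ∨ b = c + 1)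
    (hu : u = w) (hv : b = c + 1 → v = w) :
    (if a = b + 1 ∧ l = u then (1 : ℤ) else 0) - (if b = c + 1 ∧ l = v then 1 else 0) =
      Finsupp.single w (a - b - (b - c)) l := by
  rw [Finsupp.single_apply]
  split_ifs <;> omega

theorem exponents_aux_two {a b c u v w l : ℤ} (h1 : b = a ∨ b = a + 1) (h2 : c = b ∨ c = b + 1)
    (hu : u = w) (hv : c = b + 1 → v = w) :
    (if b = a + 1 ∧ l = u then (1 : ℤ) else 0) - (if c = b + 1 ∧ l = v then 1 else 0) =
      Finsupp.single w (b - a - (c - b)) l := by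
  rw [Finsupp.single_apply]
  split_ifs <;> omega

theorem exponents_aux_end {a b u w l : ℤ} (h1 : a = b ∨ a = b + 1) (hu : a = b + 1 → u = w) :
    (if a = b + 1 ∧ l = u then (1 : ℤ) else 0) = Finsupp.single w (a - b) l := by
  rw [Finsupp.single_apply]
  split_ifs <;> omega

namespace IsFilling
variable (hT : IsFilling n h T)
include hT

theorem colOne_sub_one (s : ℤ) :
    colOne n h T (s - 1) = colOne n h T s ∨ colOne n h T (s - 1) = colOne n h T s + 1 := by
  rcases hT.colOne_step s with ⟨a, _, _, h1, h2⟩ | ⟨_, h2⟩ <;> omega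

theorem colTwo_sub_one (s : ℤ) :
    colTwo n h T s = colTwo n h T (s - 1) ∨ colTwo n h T s = colTwo n h T (s - 1) + 1 := by
  rcases hT.colTwo_step s with ⟨a, _, _, h1, h2⟩ | ⟨_, h2⟩ <;> omega

theorem tabMonomial_apply (r : ℤ) (k : Idx n) : tabMonomial n ℓ h r T k =
    exponents (ℓ - 2 * h + k) r (n - k) (prof n h T (k - 1)) (prof n h T k)
      (prof n h T (k + 1)) := by
  have hk := k.2
  simp only [Set.mem_Icc] at hk
  ext l
  unfold tabMonomial
  rw [Finset.sum_apply, Finsupp.finsetSum_apply,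
    Finset.sum_congr rfl fun a _ => box_apply (hT.mem a) _ k l]
  rw [Finset.sum_add_distrib, Finset.sum_sub_distrib, Finset.sum_sub_distrib,
    hT.sum_rank_suffix, hT.sum_rank_suffix]
  rcases hk.2.lt_or_eq with hkn | hkn
  · simp only [hkn, true_and]
    rw [hT.sum_rank_suffix, hT.sum_rank_suffix]
    unfold exponents
    simp only [Finsupp.add_apply]
    rw [prof_of_le (by omega), prof_of_le (by omega), prof_of_le (by omega)]
    simp only [level, expo]
    rw [show 2 * n - ((k : ℤ) + 1) = 2 * n - k - 1 by ring, add_sub_cancel_right,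
      show 2 * n + 1 - (k : ℤ) - 1 = 2 * n - k by ring,
      show 2 * n - ((k : ℤ) - 1) = 2 * n + 1 - k by ring]
    have o1 := hT.colOne_sub_one k
    have o2 := hT.colOne_sub_one (k + 1)
    have o3 := hT.colOne_sub_one (2 * n - k)
    have o4 := hT.colOne_sub_one (2 * n + 1 - k)
    have t1 := hT.colTwo_sub_one k
    have t2 := hT.colTwo_sub_one (k + 1)
    have t3 := hT.colTwo_sub_one (2 * n - k)
    have t4 := hT.colTwo_sub_one (2 * n + 1 - k)
    rw [add_sub_cancel_right] at o2 t2
    rw [show 2 * n + 1 - (k : ℤ) - 1 = 2 * n - k by ring] at o4 t4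
    rw [← exponents_aux (u := ℓ + 1 - 2 * (h - colOne n h T k) + (k - 1))
        (v := ℓ + 1 - 2 * (h - colOne n h T (k + 1)) + (k + 1)) o1 o2 (by ring) (by omega),
      ← exponents_aux (u := ℓ + 1 - 2 * (h - colOne n h T (2 * n - k)) + (2 * n - k - 1))
        (v := ℓ + 1 - 2 * (h - colOne n h T (2 * n + 1 - k)) + (2 * n + 1 - k)) o3 o4 (by ring)
        (by omega),
      ← exponents_aux_two (u := ℓ + 1 - 2 * (h + colTwo n h T k) - 2 * r + (k - 1))
        (v := ℓ + 1 - 2 * (h + colTwo n h T (k + 1)) - 2 * r + (k + 1)) t1 t2 (by ring) (by omega),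
      ← exponents_aux_two (u := ℓ + 1 - 2 * (h + colTwo n h T (2 * n - k)) - 2 * r + (2 * n - k - 1))
        (v := ℓ + 1 - 2 * (h + colTwo n h T (2 * n + 1 - k)) - 2 * r + (2 * n + 1 - k)) t3 t4
        (by ring) (by omega)]
    ring
  -- For `k = n` the guarded terms disappear. On the other side the profile is constant from `n` to
  -- `n + 1`, so each second difference reduces to a first difference.
  · simp only [hkn, lt_irrefl, false_and, and_false, if_false, Finset.sum_const_zero, sub_zero,
      zero_sub]
    rw [prof_succ_self]
    unfold exponents
    simp only [Finsupp.add_apply]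
    rw [prof_of_le (j := n) le_rfl, prof_of_le (j := n - 1) (by omega)]
    simp only [level, expo, sub_self, sub_zero, zero_sub, zero_add]
    rw [show 2 * n + 1 - n - 1 = n by ring, show 2 * n - (n - 1) = n + 1 by ring,
      show 2 * n - n = n by ring, show 2 * n + 1 - n = n + 1 by ring]
    have o1 := hT.colOne_sub_one n
    have o2 := hT.colOne_sub_one (n + 1)
    have t1 := hT.colTwo_sub_one n
    have t2 := hT.colTwo_sub_one (n + 1)
    rw [add_sub_cancel_right] at o2 t2
    simp only [Finsupp.single_neg, Finsupp.neg_apply]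
    rw [← exponents_aux_end (u := ℓ + 1 - 2 * (h - colOne n h T n) + (n - 1)) o1 (by omega),
      ← exponents_aux_end (u := ℓ + 1 - 2 * (h - colOne n h T (n + 1)) + (n + 1)) o2 (by omega),
      ← exponents_aux_end (u := ℓ + 1 - 2 * (h + colTwo n h T n) - 2 * r + (n - 1)) t1 (by omega),
      ← exponents_aux_end (u := ℓ + 1 - 2 * (h + colTwo n h T (n + 1)) - 2 * r + (n + 1)) t2
        (by omega)]
    ring

end IsFilling

end CrystalTypeC

namespace CrystalTypeC

/-! ### Membership in `C_{ℓ,h,r}` in terms of the profile -/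

open Quad

theorem Letter.rank_plain (n k : ℤ) : (Letter.plain k).rank n = k := rfl

theorem Letter.rank_bar (n k : ℤ) : (Letter.bar k).rank n = 2 * n + 1 - k := rfl

variable {n ℓ h r : ℤ} {T : Tableau ℓ}

/-- The conditions on the profile of a tableau that characterize `C_{ℓ,h,r}` for `r ≥ 1`. -/
structure Adm (n r : ℤ) (Q : ℤ → Quad) : Prop where
  loc : ∀ j, 1 ≤ j → j ≤ n → Loc r (n - j) (Q (j - 1)) (Q j)
  fin : End (Q n)

theorem colOne_nonneg (n h : ℤ) (T : Tableau ℓ) (s : ℤ) : 0 ≤ colOne n h T s :=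
  Finset.sum_nonneg fun a _ => by split_ifs <;> omega

theorem colTwo_nonneg (n h : ℤ) (T : Tableau ℓ) (s : ℤ) : 0 ≤ colTwo n h T s :=
  Finset.sum_nonneg fun a _ => by split_ifs <;> omega

theorem colOne_antitone (n h : ℤ) (T : Tableau ℓ) {s s' : ℤ} (hs : s ≤ s') :
    colOne n h T s' ≤ colOne n h T s :=
  Finset.sum_le_sum fun a _ => by split_ifs <;> omega

theorem colTwo_mono (n h : ℤ) (T : Tableau ℓ) {s s' : ℤ} (hs : s ≤ s') :
    colTwo n h T s ≤ colTwo n h T s' :=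
  Finset.sum_le_sum fun a _ => by split_ifs <;> omega

theorem colOne_pos {a : Idx ℓ} (ha : (a : ℤ) ≤ h) {s : ℤ} (hs : s < (T a).rank n) :
    0 < colOne n h T s := by
  refine Finset.sum_pos' (fun b _ => by split_ifs <;> omega) ⟨a, Finset.mem_univ _, ?_⟩
  rw [if_pos ⟨ha, hs⟩]; exact one_pos

theorem colTwo_pos {a : Idx ℓ} (ha : h < (a : ℤ)) {s : ℤ} (hs : (T a).rank n ≤ s) :
    0 < colTwo n h T s := by
  refine Finset.sum_pos' (fun b _ => by split_ifs <;> omega) ⟨a, Finset.mem_univ _, ?_⟩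
  rw [if_pos ⟨ha, hs⟩]; exact one_pos

namespace IsFilling
variable (hT : IsFilling n h T)
include hT

theorem exists_last_of_colOne_pos {s : ℤ} (hs : 0 < colOne n h T s) :
    ∃ u : Idx ℓ, (u : ℤ) = h ∧ s < (T u).rank n := by
  by_contra hc
  push Not at hc
  refine hs.ne' (Finset.sum_eq_zero fun a _ => if_neg ?_)
  rintro ⟨ha, has⟩
  have := a.2.1
  have hu := hc ⟨h, by omega, hT.h_le⟩ rfl
  rcases ha.eq_or_lt with h1 | h1
  · rw [show a = ⟨h, by omega, hT.h_le⟩ from Subtype.ext h1] at has; omega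
  · have := hT.col₁ a ⟨h, by omega, hT.h_le⟩ h1 le_rfl
    omega

theorem exists_first_of_colTwo_pos {s : ℤ} (hs : 0 < colTwo n h T s) :
    ∃ v : Idx ℓ, (v : ℤ) = h + 1 ∧ (T v).rank n ≤ s := by
  by_contra hc
  push Not at hc
  have h0 := hT.h_nonneg
  refine hs.ne' (Finset.sum_eq_zero fun a _ => if_neg ?_)
  rintro ⟨ha, has⟩
  have := a.2.2
  have hu := hc ⟨h + 1, by omega, by omega⟩ rfl
  rcases (show h + 1 ≤ (a : ℤ) by omega).eq_or_lt with h1 | h1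
  · rw [show a = ⟨h + 1, by omega, by omega⟩ from Subtype.ext h1.symm] at has; omega
  · have := hT.col₂ ⟨h + 1, by omega, by omega⟩ a h1 (by simp)
    omega

theorem x_step {j : ℤ} (hj : j ≤ n) :
    (∃ a : Idx ℓ, (a : ℤ) ≤ h ∧ T a = .plain j ∧ (prof n h T j).x = h - a ∧
      (prof n h T (j - 1)).x = h - a + 1) ∨
    ((∀ a : Idx ℓ, (a : ℤ) ≤ h → T a ≠ .plain j) ∧
      (prof n h T (j - 1)).x = (prof n h T j).x) := by
  rw [prof_of_le hj, prof_of_le (by omega)]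
  rcases hT.colOne_step j with ⟨a, ha, h1, h2⟩ | ⟨h1, h2⟩
  · exact Or.inl ⟨a, ha, (Letter.rank_eq_plain (hT.mem a) hj).1 h1, h2⟩
  · exact Or.inr ⟨fun a ha h3 => h1 a ha ((Letter.rank_eq_plain (hT.mem a) hj).2 h3), h2⟩

theorem v_step {j : ℤ} (hj : j ≤ n) :
    (∃ a : Idx ℓ, h < (a : ℤ) ∧ T a = .plain j ∧ (prof n h T j).v = a - h ∧
      (prof n h T (j - 1)).v = a - h - 1) ∨
    ((∀ a : Idx ℓ, h < (a : ℤ) → T a ≠ .plain j) ∧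
      (prof n h T (j - 1)).v = (prof n h T j).v) := by
  rw [prof_of_le hj, prof_of_le (by omega)]
  rcases hT.colTwo_step j with ⟨a, ha, h1, h2⟩ | ⟨h1, h2⟩
  · exact Or.inl ⟨a, ha, (Letter.rank_eq_plain (hT.mem a) hj).1 h1, h2⟩
  · exact Or.inr ⟨fun a ha h3 => h1 a ha ((Letter.rank_eq_plain (hT.mem a) hj).2 h3), h2⟩

theorem y_step {j : ℤ} (hj : j ≤ n) :
    (∃ a : Idx ℓ, (a : ℤ) ≤ h ∧ T a = .bar j ∧ (prof n h T (j - 1)).y = h - a ∧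
      (prof n h T j).y = h - a + 1) ∨
    ((∀ a : Idx ℓ, (a : ℤ) ≤ h → T a ≠ .bar j) ∧
      (prof n h T j).y = (prof n h T (j - 1)).y) := by
  rw [prof_of_le hj, prof_of_le (by omega), show 2 * n - (j - 1) = 2 * n + 1 - j by ring]
  have e : 2 * n + 1 - j - 1 = 2 * n - j := by ring
  rcases hT.colOne_step (2 * n + 1 - j) with ⟨a, ha, h1, h2⟩ | ⟨h1, h2⟩
  · rw [e] at h2
    exact Or.inl ⟨a, ha, (Letter.rank_eq_bar (hT.mem a) hj).1 h1, h2⟩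
  · rw [e] at h2
    exact Or.inr ⟨fun a ha h3 => h1 a ha ((Letter.rank_eq_bar (hT.mem a) hj).2 h3), h2⟩

theorem w_step {j : ℤ} (hj : j ≤ n) :
    (∃ a : Idx ℓ, h < (a : ℤ) ∧ T a = .bar j ∧ (prof n h T (j - 1)).w = a - h ∧
      (prof n h T j).w = a - h - 1) ∨
    ((∀ a : Idx ℓ, h < (a : ℤ) → T a ≠ .bar j) ∧
      (prof n h T j).w = (prof n h T (j - 1)).w) := by
  rw [prof_of_le hj, prof_of_le (by omega), show 2 * n - (j - 1) = 2 * n + 1 - j by ring]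
  have e : 2 * n + 1 - j - 1 = 2 * n - j := by ring
  rcases hT.colTwo_step (2 * n + 1 - j) with ⟨a, ha, h1, h2⟩ | ⟨h1, h2⟩
  · rw [e] at h2
    exact Or.inl ⟨a, ha, (Letter.rank_eq_bar (hT.mem a) hj).1 h1, h2⟩
  · rw [e] at h2
    exact Or.inr ⟨fun a ha h3 => h1 a ha ((Letter.rank_eq_bar (hT.mem a) hj).2 h3), h2⟩

end IsFilling

theorem idx_eq {a b : Idx ℓ} (h : (a : ℤ) = b) : a = b := Subtype.ext h

theorem idx_lt {a b : Idx ℓ} (h : (a : ℤ) < b) : a < b := h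

theorem IsTableauC.isFilling (hT : IsTableauC n ℓ h r T) (h0 : 0 ≤ h) (h1 : h ≤ ℓ) :
    IsFilling n h T :=
  ⟨⟨hT.mem, hT.col₁, fun a b hab ha => hT.col₂ a b hab ha⟩, h0, h1⟩

theorem Letter.eq_plain_of_rank_le {x : Letter} (hx : x.InB n) (h : x.rank n ≤ n) :
    x = .plain (x.rank n) := by
  cases x <;> simp only [Letter.InB, Letter.rank] at *
  omega

theorem Letter.eq_bar_of_lt_rank {x : Letter} (hx : x.InB n) (h : n < x.rank n) :
    ∃ k, x = .bar k ∧ x.rank n = 2 * n + 1 - k := by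
  cases x <;> simp only [Letter.InB, Letter.rank] at *
  · omega
  · exact ⟨_, rfl, rfl⟩

theorem IsTableauC.not_plain_bar (hT : IsTableauC n ℓ h r T) {u v : Idx ℓ} (hu : (u : ℤ) = h)
    (hv : (v : ℤ) = h + 1) (h1 : (T v).rank n ≤ n) (h2 : n < (T u).rank n) : False := by
  obtain ⟨k', hk', -⟩ := hT.c5 u v _ hu hv (Letter.eq_plain_of_rank_le (hT.mem v) h1)
    (show _ ≤ _ by omega)
  obtain ⟨k, hk, -⟩ := Letter.eq_bar_of_lt_rank (hT.mem u) h2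
  rw [hk] at hk'
  cases hk'

/-- The two premises say that `k ≤ j ≤ k'`, where `k` heads the second column and `k'` ends the
first. So the barred `j` belongs to the run that is demanded by `c5`. Along the run the position and
`n - j` change by the same amount, so the bounds stated at `k` hold at every `j`. -/
theorem IsTableauC.loc_c5 (hT : IsTableauC n ℓ h r T) (hF : IsFilling n h T) {j : ℤ}
    (hjn : j ≤ n) (hv : 0 < (prof n h T j).v) (hx : 0 < (prof n h T (j - 1)).x) :
    (prof n h T (j - 1)).w = (prof n h T j).w + 1 ∧ (prof n h T j).w + 1 ≤ n - j ∧
      n - j + 1 ≤ (prof n h T j).w + r := by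
  rw [prof_of_le hjn] at hv
  rw [prof_of_le (by omega)] at hx
  obtain ⟨v, hv, hvs⟩ := hF.exists_first_of_colTwo_pos hv
  obtain ⟨u, hu, hus⟩ := hF.exists_last_of_colOne_pos hx
  have hTv := Letter.eq_plain_of_rank_le (hT.mem v) (by omega)
  obtain ⟨k', hTu, b', b, hbb, hrun, hlow, hup⟩ := hT.c5 u v _ hu hv hTv (show _ ≤ _ by omega)
  generalize (T v).rank n = k at *
  rw [hTu] at hus
  simp only [Letter.rank_plain] at hus
  have hb := b.2
  have hb' := b'.2
  simp only [Set.mem_Icc] at hb hb'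
  let c : Idx ℓ := ⟨b' + (k' - j), by omega, by omega⟩
  have hc : T c = .bar j := by
    rw [hrun c (show (b' : ℤ) ≤ b' + (k' - j) by omega) (show (b' : ℤ) + (k' - j) ≤ b by omega)]
    simp [c]
  have hch : h < (c : ℤ) := by
    by_contra hc'
    have hru := hT.mem u
    rw [hTu] at hru
    simp only [Letter.InB] at hru
    rcases (show (c : ℤ) ≤ u by omega).eq_or_lt with h1 | h1
    · rw [idx_eq h1, hTu] at hc
      cases hc
    · have := hF.col₁ c u h1 hu.le
      rw [hc, hTu] at this
      simp only [Letter.rank_plain, Letter.rank_bar] at this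
      omega
  have hcv : (c : ℤ) = b' + (k' - j) := rfl
  rcases hF.w_step hjn with ⟨a, ha, h1, h2, h3⟩ | ⟨h1, -⟩
  · have : (a : ℤ) = c := by
      have h4 := hF.colTwo_rank hF.h_nonneg hch
      have h5 := hF.colTwo_rank hF.h_nonneg ha
      rw [h1, ← hc, h4] at h5
      omega
    rw [h2, h3]
    omega
  · exact absurd hc (h1 c hch)

theorem IsTableauC.loc_c6 (hT : IsTableauC n ℓ h r T) (hF : IsFilling n h T) {j : ℤ}
    (hjn : j ≤ n) (hw : 0 < (prof n h T (j - 1)).w) (hy : 0 < (prof n h T j).y) :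
    (prof n h T (j - 1)).x = (prof n h T j).x + 1 ∧ (prof n h T j).x + 1 ≤ n - j ∧
      n - j + 1 ≤ (prof n h T j).x + r := by
  rw [prof_of_le hjn] at hy
  rw [prof_of_le (by omega)] at hw
  obtain ⟨v, hv, hvs⟩ := hF.exists_first_of_colTwo_pos hw
  obtain ⟨u, hu, hus⟩ := hF.exists_last_of_colOne_pos hy
  -- Here `w` is positive, which does not yet make the head of the second column barred; an unbarred
  -- head below a barred end of the first column contradicts `c5`.
  have hvn : n < (T v).rank n := by
    by_contra hc
    exact hT.not_plain_bar hu hv (not_lt.1 hc) (by omega)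
  obtain ⟨k, hTv, hkv⟩ := Letter.eq_bar_of_lt_rank (hT.mem v) hvn
  obtain ⟨k', hTu, a', a, hbb, hrun, hlow, hup⟩ := hT.c6 u v k hu hv hTv (show _ ≤ _ by omega)
  rw [hTu] at hus
  simp only [Letter.rank_bar] at hus
  have hb := a.2
  have hb' := a'.2
  simp only [Set.mem_Icc] at hb hb'
  let c : Idx ℓ := ⟨a' + (j - k'), by omega, by omega⟩
  have hc : T c = .plain j := by
    rw [hrun c (show (a' : ℤ) ≤ a' + (j - k') by omega) (show (a' : ℤ) + (j - k') ≤ a by omega)]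
    simp [c]
  have hch : (c : ℤ) ≤ h := by
    by_contra hc'
    rcases (show (v : ℤ) ≤ c by omega).eq_or_lt with h1 | h1
    · rw [← idx_eq h1, hTv] at hc
      cases hc
    · have := hF.col₂ v c h1 (by omega)
      rw [hc] at this
      simp only [Letter.rank_plain] at this
      omega
  have hcv : (c : ℤ) = a' + (j - k') := rfl
  rcases hF.x_step hjn with ⟨d, hd, h1, h2, h3⟩ | ⟨h1, -⟩
  · have : (d : ℤ) = c := by
      have h4 := hF.colOne_rank hF.h_le hch
      have h5 := hF.colOne_rank hF.h_le hd
      rw [h1, ← hc, h4] at h5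
      omega
    rw [h2, h3]
    omega
  · exact absurd hc (h1 c hch)

theorem IsTableauC.adm (hT : IsTableauC n ℓ h r T) (h0 : 0 ≤ h) (h1 : h ≤ ℓ) (hr : 1 ≤ r) :
    Adm n r (prof n h T) := by
  have hF := hT.isFilling h0 h1
  refine ⟨fun j hj1 hjn => ?_, ?_⟩
  · have hpb : (prof n h T j).v = 0 ∨ (prof n h T j).y = 0 := by
      rw [prof_of_le hjn]
      by_contra hc
      push Not at hc
      have h2 := colOne_nonneg n h T (2 * n - j)
      have h3 := colTwo_nonneg n h T j
      obtain ⟨v, hv, hvs⟩ := hF.exists_first_of_colTwo_pos (lt_of_le_of_ne h3 hc.1.symm)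
      obtain ⟨u, hu, hus⟩ := hF.exists_last_of_colOne_pos (lt_of_le_of_ne h2 hc.2.symm)
      exact hT.not_plain_bar hu hv (by omega) (by omega)
    refine ⟨?_, ?_, ?_, ?_, ?_, ?_, ?_, ?_, ?_, ?_, hpb, ?_, ?_, ?_, hT.loc_c5 hF hjn,
      hT.loc_c6 hF hjn⟩
    · rcases hF.x_step hjn with ⟨a, -, -, h2, h3⟩ | ⟨-, h2⟩ <;> omega
    · rcases hF.y_step hjn with ⟨a, -, -, h2, h3⟩ | ⟨-, h2⟩ <;> omega
    · rcases hF.v_step hjn with ⟨a, -, -, h2, h3⟩ | ⟨-, h2⟩ <;> omega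
    · rcases hF.w_step hjn with ⟨a, -, -, h2, h3⟩ | ⟨-, h2⟩ <;> omega
    · dsimp only [prof]; exact colOne_nonneg _ _ _ _
    · dsimp only [prof]; exact colOne_nonneg _ _ _ _
    · dsimp only [prof]; exact colTwo_nonneg _ _ _ _
    · dsimp only [prof]; exact colTwo_nonneg _ _ _ _
    · rw [prof_of_le hjn]; dsimp only; exact colOne_antitone _ _ _ (by omega)
    · rw [prof_of_le hjn]; dsimp only; exact colTwo_mono _ _ _ (by omega)
    · rintro ⟨h2, h3, h4⟩
      rcases hF.x_step hjn with ⟨a, ha, ha1, ha2, ha3⟩ | ⟨-, ha2⟩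
      · rcases hF.y_step hjn with ⟨b, hb, hb1, hb2, hb3⟩ | ⟨-, hb2⟩
        · exact hT.c2 ⟨a, b, j, idx_lt ((hF.lt_iff_one ha hb).1 (by rw [ha1, hb1, Letter.rank_plain, Letter.rank_bar]; omega)), hb, ha1, hb1, by omega⟩
        · omega
      · omega
    · rintro ⟨h2, h3, h4⟩
      rcases hF.v_step hjn with ⟨a, ha, ha1, ha2, ha3⟩ | ⟨-, ha2⟩
      · rcases hF.w_step hjn with ⟨b, hb, hb1, hb2, hb3⟩ | ⟨-, hb2⟩
        · exact hT.c3 ⟨a, b, j, ha, idx_lt ((hF.lt_iff_two ha hb).1 (by rw [ha1, hb1, Letter.rank_plain, Letter.rank_bar]; omega)), ha1, hb1, by omega⟩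
        · omega
      · omega
    · rintro ⟨h2, h3, h4⟩
      rcases hF.x_step hjn with ⟨a, ha, ha1, ha2, ha3⟩ | ⟨-, ha2⟩
      · rcases hF.w_step hjn with ⟨b, hb, hb1, hb2, hb3⟩ | ⟨-, hb2⟩
        · exact hT.c4 ⟨a, b, j, ha, hb, ha1, hb1, by rw [max_eq_left hr]; omega⟩
        · omega
      · omega
  · rw [prof_of_le le_rfl, show 2 * n - n = n by ring]
    refine ⟨rfl, rfl, ?_⟩
    by_contra hc
    push Not at hc
    have h2 := colOne_nonneg n h T n
    have h3 := colTwo_nonneg n h T n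
    obtain ⟨v, hv, hvs⟩ := hF.exists_first_of_colTwo_pos (lt_of_le_of_ne h3 hc.1.symm)
    obtain ⟨u, hu, hus⟩ := hF.exists_last_of_colOne_pos (lt_of_le_of_ne h2 hc.2.symm)
    exact hT.not_plain_bar hu hv hvs hus

/-! ### From the conditions on profiles back to tableaux -/

section converse

variable (hF : IsFilling n h T) (hA : Adm n r (prof n h T))
include hF hA

/-- For each `j` from `k` to `k'` the local condition yields the barred `j` in the second column.
Since `w` then drops at every step, these letters occupy consecutive positions and form the run. -/
theorem Adm.c5 (u v : Idx ℓ) (k : ℤ) (hu : (u : ℤ) = h) (hv : (v : ℤ) = h + 1)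
    (hTv : T v = .plain k) (huv : succEq n (T u) (T v)) :
    ∃ k' : ℤ, T u = .plain k' ∧ ∃ b' b : Idx ℓ, (b : ℤ) - b' = k' - k ∧
      (∀ c : Idx ℓ, b' ≤ c → c ≤ b → T c = .bar (k' - ((c : ℤ) - b'))) ∧
      n - r - k + 1 < (b : ℤ) - h ∧ (b : ℤ) - h ≤ n - k := by
  have hk := hF.mem v
  rw [hTv] at hk
  simp only [Letter.InB] at hk
  unfold succEq at huv
  rw [hTv] at huv
  simp only [Letter.rank_plain] at huv
  have hvpos : ∀ j, k ≤ j → j ≤ n → 0 < (prof n h T j).v := fun j hj hjn => by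
    rw [prof_of_le hjn]
    exact colTwo_pos (a := v) (by omega) (by rw [hTv]; exact hj)
  have hun : (T u).rank n ≤ n := by
    by_contra hc
    have h1 := hvpos n hk.2 le_rfl
    have h2 : 0 < (prof n h T n).x := by
      rw [prof_of_le le_rfl]
      exact colOne_pos hu.le (not_le.1 hc)
    have := hA.fin.mid
    omega
  have hTu := Letter.eq_plain_of_rank_le (hF.mem u) hun
  have hxpos : ∀ j, j ≤ (T u).rank n → 0 < (prof n h T (j - 1)).x := fun j hj => by
    rw [prof_of_le (by omega)]
    exact colOne_pos hu.le (by omega)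
  generalize (T u).rank n = k' at *
  have hloc : ∀ j, k ≤ j → j ≤ k' → (prof n h T (j - 1)).w = (prof n h T j).w + 1 ∧
      (prof n h T j).w + 1 ≤ n - j ∧ n - j + 1 ≤ (prof n h T j).w + r := fun j hj hj' =>
    (hA.loc j (by omega) (by omega)).c5 (hvpos j hj (by omega)) (hxpos j hj')
  have hw : ∀ j, k ≤ j → j ≤ k' → (prof n h T j).w = (prof n h T k).w - (j - k) := by
    intro j hj
    induction j, hj using Int.leInduction with
    | base => intro _; ring
    | succ j hj ih =>
      intro hj'
      have h1 := (hloc (j + 1) (by omega) hj').1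
      rw [add_sub_cancel_right] at h1
      have := ih (by omega)
      omega
  have hex : ∀ j, k ≤ j → j ≤ k' → ∃ c : Idx ℓ, T c = .bar j ∧
      (c : ℤ) = h + 1 + (prof n h T k).w - (j - k) := by
    intro j hj hj'
    rcases hF.w_step (show j ≤ n by omega) with ⟨c, -, hc, -, hc'⟩ | ⟨-, hc⟩
    · have := hw j hj hj'
      exact ⟨c, hc, by omega⟩
    · have := (hloc j hj hj').1
      omega
  obtain ⟨b, hb, hbp⟩ := hex k le_rfl huv
  obtain ⟨b', hb', hbp'⟩ := hex k' huv le_rfl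
  have h3 := hloc k le_rfl huv
  refine ⟨k', hTu, b', b, by omega, fun c hc hc' => ?_, by omega, by omega⟩
  have hc1 : (b' : ℤ) ≤ c := hc
  have hc2 : (c : ℤ) ≤ b := hc'
  obtain ⟨d, hd, hdp⟩ := hex (k' - ((c : ℤ) - b')) (by omega) (by omega)
  rw [← hd, idx_eq (show (c : ℤ) = d by omega)]

theorem Adm.c6 (u v : Idx ℓ) (k : ℤ) (hu : (u : ℤ) = h) (hv : (v : ℤ) = h + 1)
    (hTv : T v = .bar k) (huv : succEq n (T u) (T v)) :
    ∃ k' : ℤ, T u = .bar k' ∧ ∃ a' a : Idx ℓ, (a : ℤ) - a' = k - k' ∧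
      (∀ c : Idx ℓ, a' ≤ c → c ≤ a → T c = .plain (k' + ((c : ℤ) - a'))) ∧
      n - r - k + 1 ≤ h - (a : ℤ) ∧ h - (a : ℤ) < n - k := by
  have hk := hF.mem v
  rw [hTv] at hk
  simp only [Letter.InB] at hk
  unfold succEq at huv
  rw [hTv] at huv
  simp only [Letter.rank_bar] at huv
  obtain ⟨k', hTu, hk'⟩ := Letter.eq_bar_of_lt_rank (hF.mem u) (by omega)
  have hk2 := hF.mem u
  rw [hTu] at hk2
  simp only [Letter.InB] at hk2
  have hloc : ∀ j, k' ≤ j → j ≤ k → (prof n h T (j - 1)).x = (prof n h T j).x + 1 ∧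
      (prof n h T j).x + 1 ≤ n - j ∧ n - j + 1 ≤ (prof n h T j).x + r := fun j hj hj' => by
    refine (hA.loc j (by omega) (by omega)).c6 ?_ ?_
    · rw [prof_of_le (by omega)]
      exact colTwo_pos (a := v) (by omega) (by rw [hTv]; rw [Letter.rank_bar]; omega)
    · rw [prof_of_le (by omega)]
      exact colOne_pos hu.le (by omega)
  have hx : ∀ j, j ≤ k → k' ≤ j → (prof n h T j).x = (prof n h T k).x + (k - j) := by
    intro j hj
    induction j, hj using Int.leInductionDown with
    | base => intro _; ring
    | pred j hj ih =>
      intro hj'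
      have h1 := (hloc j (by omega) hj).1
      have := ih (by omega)
      omega
  have hex : ∀ j, k' ≤ j → j ≤ k → ∃ c : Idx ℓ, T c = .plain j ∧
      (c : ℤ) = h - (prof n h T k).x - (k - j) := by
    intro j hj hj'
    rcases hF.x_step (show j ≤ n by omega) with ⟨c, -, hc, hc', -⟩ | ⟨-, hc⟩
    · have := hx j hj' hj
      exact ⟨c, hc, by omega⟩
    · have := (hloc j hj hj').1
      omega
  obtain ⟨a, ha, hap⟩ := hex k (by omega) le_rfl
  obtain ⟨a', ha', hap'⟩ := hex k' le_rfl (by omega)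
  have h3 := hloc k (by omega) le_rfl
  refine ⟨k', hTu, a', a, by omega, fun c hc hc' => ?_, by omega, by omega⟩
  have hc1 : (a' : ℤ) ≤ c := hc
  have hc2 : (c : ℤ) ≤ a := hc'
  obtain ⟨d, hd, hdp⟩ := hex (k' + ((c : ℤ) - a')) (by omega) (by omega)
  rw [← hd, idx_eq (show (c : ℤ) = d by omega)]

theorem Adm.isTableauC (hr : 1 ≤ r) : IsTableauC n ℓ h r T := by
  have hk : ∀ {a : Idx ℓ} {k : ℤ}, T a = .plain k → 1 ≤ k ∧ k ≤ n := fun {a k} ha => by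
    have := hF.mem a
    rwa [ha] at this
  have h1 : ∀ {a : Idx ℓ} {k : ℤ}, (a : ℤ) ≤ h → T a = .plain k →
      (prof n h T k).x = h - a ∧ (prof n h T (k - 1)).x = h - a + 1 := fun {a k} ha hTa => by
    rw [prof_of_le (hk hTa).2, prof_of_le (by have := hk hTa; omega)]
    have h1 := hF.colOne_rank hF.h_le ha
    have h2 := hF.colOne_rank_sub_one hF.h_le ha
    rw [hTa] at h1 h2
    exact ⟨h1, h2⟩
  have h2 : ∀ {a : Idx ℓ} {k : ℤ}, h < (a : ℤ) → T a = .plain k →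
      (prof n h T k).v = a - h ∧ (prof n h T (k - 1)).v = a - h - 1 := fun {a k} ha hTa => by
    rw [prof_of_le (hk hTa).2, prof_of_le (by have := hk hTa; omega)]
    have h1 := hF.colTwo_rank hF.h_nonneg ha
    have h2 := hF.colTwo_rank_sub_one hF.h_nonneg ha
    rw [hTa] at h1 h2
    exact ⟨h1, h2⟩
  have h3 : ∀ {a : Idx ℓ} {k : ℤ}, k ≤ n → (a : ℤ) ≤ h → T a = .bar k →
      (prof n h T (k - 1)).y = h - a ∧ (prof n h T k).y = h - a + 1 := fun {a k} hk ha hTa => by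
    rw [prof_of_le hk, prof_of_le (by omega)]
    have h1 := hF.colOne_rank hF.h_le ha
    have h2 := hF.colOne_rank_sub_one hF.h_le ha
    rw [hTa] at h1 h2
    simp only [Letter.rank_bar] at h1 h2
    rw [show 2 * n + 1 - k - 1 = 2 * n - k by ring] at h2
    rw [show 2 * n - (k - 1) = 2 * n + 1 - k by ring]
    exact ⟨h1, h2⟩
  have h4 : ∀ {a : Idx ℓ} {k : ℤ}, k ≤ n → h < (a : ℤ) → T a = .bar k →
      (prof n h T (k - 1)).w = a - h ∧ (prof n h T k).w = a - h - 1 := fun {a k} hk ha hTa => by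
    rw [prof_of_le hk, prof_of_le (by omega)]
    have h1 := hF.colTwo_rank hF.h_nonneg ha
    have h2 := hF.colTwo_rank_sub_one hF.h_nonneg ha
    rw [hTa] at h1 h2
    simp only [Letter.rank_bar] at h1 h2
    rw [show 2 * n + 1 - k - 1 = 2 * n - k by ring] at h2
    rw [show 2 * n - (k - 1) = 2 * n + 1 - k by ring]
    exact ⟨h1, h2⟩
  refine ⟨hF.mem, hF.col₁, fun a b hab ha => hF.col₂ a b hab ha, ?_, ?_, ?_, hA.c5 hF, hA.c6 hF⟩
  · rintro ⟨a, b, k, hab, hb, hTa, hTb, he⟩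
    have hab' : (a : ℤ) < b := hab
    obtain ⟨i1, i2⟩ := hk hTa
    obtain ⟨o1, o2⟩ := h1 (by omega) hTa
    obtain ⟨o3, o4⟩ := h3 i2 hb hTb
    exact (hA.loc k i1 i2).c2 ⟨by omega, by omega, by omega⟩
  · rintro ⟨a, b, k, ha, hab, hTa, hTb, he⟩
    have hab' : (a : ℤ) < b := hab
    obtain ⟨i1, i2⟩ := hk hTa
    obtain ⟨o1, o2⟩ := h2 (by omega) hTa
    obtain ⟨o3, o4⟩ := h4 i2 (by omega) hTb
    exact (hA.loc k i1 i2).c3 ⟨by omega, by omega, by omega⟩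
  · rintro ⟨a, b, k, ha, hb, hTa, hTb, he⟩
    obtain ⟨i1, i2⟩ := hk hTa
    obtain ⟨o1, o2⟩ := h1 ha hTa
    obtain ⟨o3, o4⟩ := h4 i2 (by omega) hTb
    rw [max_eq_left hr] at he
    exact (hA.loc k i1 i2).c4 ⟨by omega, by omega, by omega⟩

end converse

end CrystalTypeC

namespace CrystalTypeC

/-! ### Peaks of the partial sums and the two gradings -/

open Quad

variable {n ℓ h r : ℤ} {T : Tableau ℓ}

/-- The normalized partial sums of the exponents of the variables `Y_{k,l}` in `m_T`. -/
noncomputable def height (n h r : ℤ) (T : Tableau ℓ) (k : ℤ) : ℤ → ℤ :=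
  psum r (n - k) (prof n h T (k - 1)) (prof n h T k) (prof n h T (k + 1))

/-- The level that corresponds to the normalized level `0`. -/
def baseLevel (ℓ h k : ℤ) : ℤ := ℓ - 2 * h + k

theorem partialSum_exponents (b r m : ℤ) (p q s : Quad) (L : ℤ) :
    partialSum (exponents b r m p q s) L = psum r m p q s ((L - b) / 2) := by
  unfold exponents psum ramp
  simp only [partialSum_add, partialSum_single]
  rw [← add_assoc]
  congr 1; congr 1; congr 1
  all_goals exact if_congr (by omega) rfl rfl

theorem totalSum_exponents (b r m : ℤ) (p q s : Quad) :
    totalSum (exponents b r m p q s) = expo p q s .x + expo p q s .y + expo p q s .v +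
      expo p q s .w := by
  unfold exponents
  simp only [totalSum_add, totalSum_single]
  ring

namespace IsFilling
variable (hT : IsFilling n h T)
include hT

theorem partialSum_tabMonomial (r : ℤ) (k : Idx n) (L : ℤ) :
    partialSum (tabMonomial n ℓ h r T k) L = height n h r T k ((L - baseLevel ℓ h k) / 2) := by
  rw [hT.tabMonomial_apply, partialSum_exponents]
  rfl

theorem height_le_phi (r : ℤ) (k : Idx n) (a : ℤ) :
    height n h r T k a ≤ phi k (tabMonomial n ℓ h r T) := by
  have := partialSum_le_phi k (tabMonomial n ℓ h r T) (baseLevel ℓ h k + 2 * a)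
  rwa [hT.partialSum_tabMonomial, add_sub_cancel_left, Int.mul_ediv_cancel_left _ two_ne_zero]
    at this

theorem exists_peak {k : Idx n} (hφ : phi k (tabMonomial n ℓ h r T) ≠ 0) :
    ∃ a, qGrade k (tabMonomial n ℓ h r T) = baseLevel ℓ h k + 2 * a ∧
      Peak (height n h r T k) a := by
  obtain ⟨h1, h2⟩ := qGrade_spec hφ
  generalize qGrade k (tabMonomial n ℓ h r T) = q at *
  obtain ⟨a, ha⟩ : ∃ a, a = (q - baseLevel ℓ h k) / 2 := ⟨_, rfl⟩
  rw [hT.partialSum_tabMonomial, ← ha] at h1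
  -- All variables sit at levels of the parity of `baseLevel`; at a level of the other parity the
  -- partial sums do not change, so none of these can be the first place of the maximum.
  have hq : q = baseLevel ℓ h k + 2 * a := by
    by_contra hc
    have := h2 (q - 1) (by omega)
    rw [hT.partialSum_tabMonomial, show (q - 1 - baseLevel ℓ h k) / 2 = a by omega, h1] at this
    exact lt_irrefl _ this
  have h0 := phi_nonneg k (tabMonomial n ℓ h r T)
  refine ⟨a, hq, by omega, fun b hb => ?_, fun b => h1 ▸ hT.height_le_phi r k b⟩
  have := h2 (baseLevel ℓ h k + 2 * b) (by omega)
  rwa [hT.partialSum_tabMonomial, add_sub_cancel_left, Int.mul_ediv_cancel_left _ two_ne_zero,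
    ← h1] at this

theorem exists_peak_dual {k : Idx n} (hε : eps k (tabMonomial n ℓ h r T) ≠ 0) :
    ∃ a, pGrade k (tabMonomial n ℓ h r T) = baseLevel ℓ h k + 2 * a ∧
      Peak (psum r (n - k) (prof n h T (k - 1)).dual (prof n h T k).dual
        (prof n h T (k + 1)).dual) (n - k - r - a) := by
  obtain ⟨h1, h2⟩ := pGrade_spec hε
  have h0 := eps_nonneg k (tabMonomial n ℓ h r T)
  rw [eps_eq, hT.tabMonomial_apply, totalSum_exponents] at hε h0
  generalize pGrade k (tabMonomial n ℓ h r T) = p at *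
  obtain ⟨a, ha⟩ : ∃ a, a = (p - baseLevel ℓ h k) / 2 := ⟨_, rfl⟩
  -- With the wrong parity the partial sums at `p - 1` and `p` agree, and `p - 1` would not be the
  -- last place of the maximum.
  have hq : p = baseLevel ℓ h k + 2 * a := by
    by_contra hc
    have := h2 p le_rfl
    rw [← h1, hT.partialSum_tabMonomial, hT.partialSum_tabMonomial, ← ha,
      show (p - 1 - baseLevel ℓ h k) / 2 = a by omega] at this
    exact lt_irrefl _ this
  rw [hT.partialSum_tabMonomial, show (p - 1 - baseLevel ℓ h k) / 2 = a - 1 by omega] at h1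
  have h3 := fun b => hT.height_le_phi r k b
  unfold height at h1 h3
  refine ⟨a, hq, ?_, fun b hb => ?_, fun b => ?_⟩
  · rw [psum_dual]; omega
  · obtain ⟨b', rfl⟩ : ∃ b', b = n - k - r - b' := ⟨n - k - r - b, by ring⟩
    have := h2 (baseLevel ℓ h k + 2 * (b' - 1)) (by omega)
    rw [hT.partialSum_tabMonomial, add_sub_cancel_left, Int.mul_ediv_cancel_left _ two_ne_zero]
      at this
    unfold height at this
    rw [psum_dual, psum_dual]
    omega
  · obtain ⟨b', rfl⟩ : ∃ b', b = n - k - r - b' := ⟨n - k - r - b, by ring⟩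
    have := h3 (b' - 1)
    rw [psum_dual, psum_dual]
    omega

end IsFilling

/-! ### The entries that contribute to a given variable -/

/-- The entry at `c` contributes a variable `Y_{k,l}` with exponent `1`. -/
def AtPlus (n h : ℤ) (T : Tableau ℓ) (k : ℤ) (c : Idx ℓ) : Vertex → Prop
  | .x => (c : ℤ) ≤ h ∧ (T c).rank n = k
  | .y => (c : ℤ) ≤ h ∧ (T c).rank n = 2 * n - k ∧ k < n
  | .v => h < (c : ℤ) ∧ (T c).rank n = k
  | .w => h < (c : ℤ) ∧ (T c).rank n = 2 * n - k ∧ k < n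

/-- The entry at `c` contributes a variable `Y_{k,l}` with exponent `-1`. -/
def AtMinus (n h : ℤ) (T : Tableau ℓ) (k : ℤ) (c : Idx ℓ) : Vertex → Prop
  | .x => (c : ℤ) ≤ h ∧ (T c).rank n = k + 1 ∧ k < n
  | .y => (c : ℤ) ≤ h ∧ (T c).rank n = 2 * n + 1 - k
  | .v => h < (c : ℤ) ∧ (T c).rank n = k + 1 ∧ k < n
  | .w => h < (c : ℤ) ∧ (T c).rank n = 2 * n + 1 - k

section entries
variable (hT : IsFilling n h T) {k : ℤ} {c c' : Idx ℓ} {i : Vertex}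
include hT

theorem AtPlus.plus (hk : k ≤ n) (hc : AtPlus n h T k c i) :
    Plus (prof n h T (k - 1)) (prof n h T k) (prof n h T (k + 1)) i ∧
      baseLevel ℓ h k + 2 * level r (n - k) (prof n h T k) i =
        suffix ℓ h r c + ((T c).rank n - 1) := by
  unfold suffix baseLevel
  rw [prof_of_le hk, prof_of_le (by omega)]
  cases i
  · obtain ⟨h1, h2⟩ := hc
    have h3 := hT.colOne_rank hT.h_le h1
    have h4 := hT.colOne_rank_sub_one hT.h_le h1
    rw [if_pos h1]
    simp only [Plus, level]
    rw [h2] at h3 h4 ⊢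
    omega
  · obtain ⟨h1, h2, h5⟩ := hc
    have h3 := hT.colOne_rank hT.h_le h1
    have h4 := hT.colOne_rank_sub_one hT.h_le h1
    rw [if_pos h1, prof_of_le (by omega)]
    simp only [Plus, level]
    rw [h2] at h3 h4 ⊢
    rw [show 2 * n - (k + 1) = 2 * n - k - 1 by ring]
    omega
  · obtain ⟨h1, h2⟩ := hc
    have h3 := hT.colTwo_rank hT.h_nonneg h1
    have h4 := hT.colTwo_rank_sub_one hT.h_nonneg h1
    rw [if_neg h1.not_ge]
    simp only [Plus, level]
    rw [h2] at h3 h4 ⊢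
    omega
  · obtain ⟨h1, h2, h5⟩ := hc
    have h3 := hT.colTwo_rank hT.h_nonneg h1
    have h4 := hT.colTwo_rank_sub_one hT.h_nonneg h1
    rw [if_neg h1.not_ge, prof_of_le (by omega)]
    simp only [Plus, level]
    rw [h2] at h3 h4 ⊢
    rw [show 2 * n - (k + 1) = 2 * n - k - 1 by ring]
    omega

theorem AtMinus.minus (hk : k ≤ n) (hc : AtMinus n h T k c i) :
    Minus (prof n h T (k - 1)) (prof n h T k) (prof n h T (k + 1)) i ∧
      baseLevel ℓ h k + 2 * level r (n - k) (prof n h T k) i =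
        suffix ℓ h r c + (T c).rank n := by
  unfold suffix baseLevel
  rw [prof_of_le hk, prof_of_le (by omega)]
  cases i
  · obtain ⟨h1, h2, h5⟩ := hc
    have h3 := hT.colOne_rank hT.h_le h1
    have h4 := hT.colOne_rank_sub_one hT.h_le h1
    rw [if_pos h1, prof_of_le (by omega)]
    simp only [Minus, level]
    rw [h2] at h3 h4 ⊢
    rw [add_sub_cancel_right] at h4
    omega
  · obtain ⟨h1, h2⟩ := hc
    have h3 := hT.colOne_rank hT.h_le h1
    have h4 := hT.colOne_rank_sub_one hT.h_le h1
    rw [if_pos h1]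
    simp only [Minus, level]
    rw [h2] at h3 h4 ⊢
    rw [show 2 * n + 1 - k - 1 = 2 * n - k by ring] at h4
    rw [show 2 * n - (k - 1) = 2 * n + 1 - k by ring]
    omega
  · obtain ⟨h1, h2, h5⟩ := hc
    have h3 := hT.colTwo_rank hT.h_nonneg h1
    have h4 := hT.colTwo_rank_sub_one hT.h_nonneg h1
    rw [if_neg h1.not_ge, prof_of_le (by omega)]
    simp only [Minus, level]
    rw [h2] at h3 h4 ⊢
    rw [add_sub_cancel_right] at h4
    omega
  · obtain ⟨h1, h2⟩ := hc
    have h3 := hT.colTwo_rank hT.h_nonneg h1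
    have h4 := hT.colTwo_rank_sub_one hT.h_nonneg h1
    rw [if_neg h1.not_ge]
    simp only [Minus, level]
    rw [h2] at h3 h4 ⊢
    rw [show 2 * n + 1 - k - 1 = 2 * n - k by ring] at h4
    rw [show 2 * n - (k - 1) = 2 * n + 1 - k by ring]
    omega

theorem eq_of_rank_one (hc : (c : ℤ) ≤ h) (hc' : (c' : ℤ) ≤ h)
    (hr : (T c).rank n = (T c').rank n) : c = c' := by
  have h1 := hT.lt_iff_one hc hc'
  have h2 := hT.lt_iff_one hc' hc
  exact idx_eq (by omega)

theorem eq_of_rank_two (hc : h < (c : ℤ)) (hc' : h < (c' : ℤ))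
    (hr : (T c).rank n = (T c').rank n) : c = c' := by
  have h1 := hT.lt_iff_two hc hc'
  have h2 := hT.lt_iff_two hc' hc
  exact idx_eq (by omega)

theorem AtPlus.unique (hc : AtPlus n h T k c i) (hc' : AtPlus n h T k c' i) : c = c' := by
  cases i
  · exact eq_of_rank_one hT hc.1 hc'.1 (hc.2.trans hc'.2.symm)
  · exact eq_of_rank_one hT hc.1 hc'.1 (hc.2.1.trans hc'.2.1.symm)
  · exact eq_of_rank_two hT hc.1 hc'.1 (hc.2.trans hc'.2.symm)
  · exact eq_of_rank_two hT hc.1 hc'.1 (hc.2.1.trans hc'.2.1.symm)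

theorem AtMinus.unique (hc : AtMinus n h T k c i) (hc' : AtMinus n h T k c' i) : c = c' := by
  cases i
  · exact eq_of_rank_one hT hc.1 hc'.1 (hc.2.1.trans hc'.2.1.symm)
  · exact eq_of_rank_one hT hc.1 hc'.1 (hc.2.trans hc'.2.symm)
  · exact eq_of_rank_two hT hc.1 hc'.1 (hc.2.1.trans hc'.2.1.symm)
  · exact eq_of_rank_two hT hc.1 hc'.1 (hc.2.trans hc'.2.symm)

theorem exists_atPlus (hk : k ≤ n)
    (hi : Plus (prof n h T (k - 1)) (prof n h T k) (prof n h T (k + 1)) i) :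
    ∃ c, AtPlus n h T k c i := by
  rw [prof_of_le hk, prof_of_le (by omega)] at hi
  cases i <;> simp only [Plus] at hi
  · rcases hT.colOne_step k with ⟨a, h1, h2, -⟩ | ⟨-, h2⟩
    · exact ⟨a, h1, h2⟩
    · omega
  · rcases hk.lt_or_eq with hk' | rfl
    · rw [prof_of_le (by omega)] at hi
      dsimp only at hi
      rw [show 2 * n - (k + 1) = 2 * n - k - 1 by ring] at hi
      rcases hT.colOne_step (2 * n - k) with ⟨a, h1, h2, -⟩ | ⟨-, h2⟩
      · exact ⟨a, h1, h2, hk'⟩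
      · omega
    · rw [prof_succ_self, prof_of_le le_rfl] at hi
      dsimp only at hi
      omega
  · rcases hT.colTwo_step k with ⟨a, h1, h2, -⟩ | ⟨-, h2⟩
    · exact ⟨a, h1, h2⟩
    · omega
  · rcases hk.lt_or_eq with hk' | rfl
    · rw [prof_of_le (by omega)] at hi
      dsimp only at hi
      rw [show 2 * n - (k + 1) = 2 * n - k - 1 by ring] at hi
      rcases hT.colTwo_step (2 * n - k) with ⟨a, h1, h2, -⟩ | ⟨-, h2⟩
      · exact ⟨a, h1, h2, hk'⟩
      · omega
    · rw [prof_succ_self, prof_of_le le_rfl] at hi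
      dsimp only at hi
      omega

theorem exists_atMinus (hk : k ≤ n)
    (hi : Minus (prof n h T (k - 1)) (prof n h T k) (prof n h T (k + 1)) i) :
    ∃ c, AtMinus n h T k c i := by
  rw [prof_of_le hk, prof_of_le (by omega)] at hi
  have e : 2 * n + 1 - k - 1 = 2 * n - k := by ring
  cases i <;> simp only [Minus, show 2 * n - (k - 1) = 2 * n + 1 - k by ring] at hi
  · rcases hk.lt_or_eq with hk' | rfl
    · rw [prof_of_le (by omega)] at hi
      dsimp only at hi
      rcases hT.colOne_step (k + 1) with ⟨a, h1, h2, -⟩ | ⟨-, h2⟩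
      · exact ⟨a, h1, h2, hk'⟩
      · rw [add_sub_cancel_right] at h2; omega
    · rw [prof_succ_self, prof_of_le le_rfl] at hi
      dsimp only at hi
      omega
  · rcases hT.colOne_step (2 * n + 1 - k) with ⟨a, h1, h2, -⟩ | ⟨-, h2⟩
    · exact ⟨a, h1, h2⟩
    · rw [e] at h2; omega
  · rcases hk.lt_or_eq with hk' | rfl
    · rw [prof_of_le (by omega)] at hi
      dsimp only at hi
      rcases hT.colTwo_step (k + 1) with ⟨a, h1, h2, -⟩ | ⟨-, h2⟩
      · exact ⟨a, h1, h2, hk'⟩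
      · rw [add_sub_cancel_right] at h2; omega
    · rw [prof_succ_self, prof_of_le le_rfl] at hi
      dsimp only at hi
      omega
  · rcases hT.colTwo_step (2 * n + 1 - k) with ⟨a, h1, h2, -⟩ | ⟨-, h2⟩
    · exact ⟨a, h1, h2⟩
    · rw [e] at h2; omega

theorem mem_boxesAt_one {k : Idx n} {a : ℤ} :
    c ∈ boxesAt n ℓ h r k T (baseLevel ℓ h k + 2 * a) 1 ↔
      ∃ i, AtPlus n h T k c i ∧ level r (n - k) (prof n h T k) i = a := by
  have hk := k.2
  simp only [Set.mem_Icc] at hk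
  unfold boxesAt
  rw [Finset.mem_filter, box_apply (hT.mem c)]
  simp only [Finset.mem_univ, true_and]
  constructor
  · intro hc
    have h1 : ((T c).rank n = k ∨ (T c).rank n = 2 * n - k ∧ (k : ℤ) < n) ∧
        baseLevel ℓ h k + 2 * a = suffix ℓ h r c + ((T c).rank n - 1) := by
      split_ifs at hc <;> omega
    obtain ⟨i, hi⟩ : ∃ i, AtPlus n h T k c i := by
      rcases h1.1 with h2 | h2 <;> by_cases hch : (c : ℤ) ≤ h
      · exact ⟨.x, hch, h2⟩
      · exact ⟨.v, not_le.1 hch, h2⟩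
      · exact ⟨.y, hch, h2⟩
      · exact ⟨.w, not_le.1 hch, h2⟩
    have := (hi.plus (r := r) hT hk.2).2
    exact ⟨i, hi, by omega⟩
  · rintro ⟨i, hi, rfl⟩
    rw [(hi.plus (r := r) hT hk.2).2]
    have h1 : (T c).rank n = k ∨ (T c).rank n = 2 * n - k ∧ (k : ℤ) < n := by
      cases i
      · exact Or.inl hi.2
      · exact Or.inr hi.2
      · exact Or.inl hi.2
      · exact Or.inr hi.2
    split_ifs <;> omega

theorem mem_boxesAt_neg_one {k : Idx n} {a : ℤ} :
    c ∈ boxesAt n ℓ h r k T (baseLevel ℓ h k + 2 * a) (-1) ↔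
      ∃ i, AtMinus n h T k c i ∧ level r (n - k) (prof n h T k) i = a := by
  have hk := k.2
  simp only [Set.mem_Icc] at hk
  unfold boxesAt
  rw [Finset.mem_filter, box_apply (hT.mem c)]
  simp only [Finset.mem_univ, true_and]
  constructor
  · intro hc
    have h1 : ((T c).rank n = k + 1 ∧ (k : ℤ) < n ∨ (T c).rank n = 2 * n + 1 - k) ∧
        baseLevel ℓ h k + 2 * a = suffix ℓ h r c + (T c).rank n := by
      split_ifs at hc <;> omega
    obtain ⟨i, hi⟩ : ∃ i, AtMinus n h T k c i := by
      rcases h1.1 with h2 | h2 <;> by_cases hch : (c : ℤ) ≤ h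
      · exact ⟨.x, hch, h2⟩
      · exact ⟨.v, not_le.1 hch, h2⟩
      · exact ⟨.y, hch, h2⟩
      · exact ⟨.w, not_le.1 hch, h2⟩
    have := (hi.minus (r := r) hT hk.2).2
    exact ⟨i, hi, by omega⟩
  · rintro ⟨i, hi, rfl⟩
    rw [(hi.minus (r := r) hT hk.2).2]
    have h1 : (T c).rank n = k + 1 ∧ (k : ℤ) < n ∨ (T c).rank n = 2 * n + 1 - k := by
      cases i
      · exact Or.inl hi.2
      · exact Or.inr hi.2
      · exact Or.inl hi.2
      · exact Or.inr hi.2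
    split_ifs <;> omega

end entries

/-! ### The entry that is changed by `f̃` or `ẽ` -/

/-- The four paths make steps of size at most one. -/
structure Step (p q : Quad) : Prop where
  hx : p.x = q.x ∨ p.x = q.x + 1
  hy : q.y = p.y ∨ q.y = p.y + 1
  hv : q.v = p.v ∨ q.v = p.v + 1
  hw : p.w = q.w ∨ p.w = q.w + 1

theorem Step.dual {p q : Quad} (h : Step p q) : Step p.dual q.dual := ⟨h.hw, h.hv, h.hy, h.hx⟩

theorem IsFilling.step (hT : IsFilling n h T) {j : ℤ} (hj : j ≤ n) :
    Step (prof n h T (j - 1)) (prof n h T j) := by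
  refine ⟨?_, ?_, ?_, ?_⟩
  · rcases hT.x_step hj with ⟨a, -, -, h2, h3⟩ | ⟨-, h2⟩ <;> omega
  · rcases hT.y_step hj with ⟨a, -, -, h2, h3⟩ | ⟨-, h2⟩ <;> omega
  · rcases hT.v_step hj with ⟨a, -, -, h2, h3⟩ | ⟨-, h2⟩ <;> omega
  · rcases hT.w_step hj with ⟨a, -, -, h2, h3⟩ | ⟨-, h2⟩ <;> omega

theorem IsFilling.step_succ (hT : IsFilling n h T) {j : ℤ} (hj : j ≤ n) :
    Step (prof n h T j) (prof n h T (j + 1)) := by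
  rcases hj.lt_or_eq with hj' | rfl
  · have := hT.step (show j + 1 ≤ n by omega)
    rwa [add_sub_cancel_right] at this
  · rw [prof_succ_self]
    exact ⟨Or.inl rfl, Or.inl rfl, Or.inl rfl, Or.inl rfl⟩

/-- The sum increases at its first maximum, and a path at that level without a box of exponent `1`
has a second difference that is at most 0. -/
theorem exists_plus_of_peak {m a : ℤ} {p q s : Quad} (h0 : Step p q) (h1 : Step q s)
    (ha : Peak (psum r m p q s) a) : ∃ i, Plus p q s i ∧ level r m q i = a := by
  have h2 := ha.lt (a - 1) (by omega)
  by_contra hc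
  push Not at hc
  have hx := hc .x
  have hy := hc .y
  have hv := hc .v
  have hw := hc .w
  refine h2.not_ge ?_
  obtain ⟨o1, o2, o3, o4⟩ := h0
  obtain ⟨t1, t2, t3, t4⟩ := h1
  unfold psum
  simp only [Plus, ramp, expo] at *
  refine add_le_add (add_le_add (add_le_add ?_ ?_) ?_) ?_ <;> split_ifs <;> omega

theorem exists_minus_of_peak {m a : ℤ} {p q s : Quad} (h0 : Step p q) (h1 : Step q s)
    (ha : Peak (psum r m p.dual q.dual s.dual) (m - r - a)) :
    ∃ i, Minus p q s i ∧ level r m q i = a := by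
  obtain ⟨i, hi, hl⟩ := exists_plus_of_peak h0.dual h1.dual ha
  refine ⟨i.dual, ?_, ?_⟩
  · cases i <;> exact hi
  · cases i <;> simp only [level, Quad.dual, Vertex.dual] at hl ⊢ <;> omega

section pick

variable (hT : IsFilling n h T) {k : Idx n} {a : ℤ}
include hT

/-- This translates the rule for tableaux, with its choice between first and last candidate, into
the rule `PlusPick` on paths, where the local analysis applies. -/
theorem IsFilling.f_eq (hr : 1 ≤ r) (hφ : phi k (tabMonomial n ℓ h r T) ≠ 0) :
    ∃ (i : Vertex) (c : Idx ℓ), AtPlus n h T k c i ∧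
      qGrade k (tabMonomial n ℓ h r T) =
        baseLevel ℓ h k + 2 * level r (n - k) (prof n h T k) i ∧
      Peak (height n h r T k) (level r (n - k) (prof n h T k) i) ∧
      PlusPick r (n - k) (prof n h T (k - 1)) (prof n h T k) (prof n h T (k + 1)) i ∧
      (tableauOps n ℓ h r).f k T = some (Function.update T c ((T c).next n)) := by
  classical
  have hk := k.2
  simp only [Set.mem_Icc] at hk
  obtain ⟨a, hq, ha⟩ := hT.exists_peak hφ
  obtain ⟨s, hs⟩ : ∃ s, s = boxesAt n ℓ h r k T (qGrade k (tabMonomial n ℓ h r T)) 1 := ⟨_, rfl⟩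
  have hmem : ∀ c, c ∈ s ↔ ∃ i, AtPlus n h T k c i ∧ level r (n - k) (prof n h T k) i = a := by
    intro c
    rw [hs, hq, mem_boxesAt_one hT]
  have hplus : ∀ i, Plus (prof n h T (k - 1)) (prof n h T k) (prof n h T (k + 1)) i →
      level r (n - k) (prof n h T k) i = a → ∃ c, AtPlus n h T k c i ∧ c ∈ s := by
    intro i hi hl
    obtain ⟨c, hc⟩ := exists_atPlus hT hk.2 hi
    exact ⟨c, hc, (hmem c).2 ⟨i, hc, hl⟩⟩
  have hne : s.Nonempty := by
    obtain ⟨i, hi, hl⟩ := exists_plus_of_peak (hT.step hk.2) (hT.step_succ hk.2) ha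
    obtain ⟨c, -, hc⟩ := hplus i hi hl
    exact ⟨c, hc⟩
  have hf : (tableauOps n ℓ h r).f k T = some (Function.update T
      (if Crossing ℓ h r s then s.max' hne else s.min' hne)
      ((T (if Crossing ℓ h r s then s.max' hne else s.min' hne)).next n)) := by
    subst hs
    simp only [tableauOps]
    rw [dif_pos ⟨hφ, hne⟩]
  rw [hf]
  obtain ⟨c, hc⟩ : ∃ c, c = if Crossing ℓ h r s then s.max' hne else s.min' hne := ⟨_, rfl⟩
  rw [← hc]
  have hcs : c ∈ s := by
    rw [hc]; split_ifs
    · exact s.max'_mem hne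
    · exact s.min'_mem hne
  obtain ⟨i, hi, hl⟩ := (hmem c).1 hcs
  refine ⟨i, c, hi, by rw [hq, hl], hl ▸ ha, ?_, rfl⟩
  have hr0 : r ≠ 0 := by omega
  by_cases hX : Crossing ℓ h r s
  · rw [if_pos hX] at hc
    have hle : ∀ b ∈ s, b ≤ c := fun b hb => hc ▸ s.le_max' b hb
    obtain ⟨-, ⟨u, hu, huh⟩, v, hv, hvh⟩ := hX
    have hch : h < (c : ℤ) := by
      have : (v : ℤ) ≤ c := hle v hv
      omega
    cases i
    · exact absurd hi.1 (by omega)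
    · exact absurd hi.1 (by omega)
    · trivial
    · obtain ⟨i', hi', hl'⟩ := (hmem u).1 hu
      have := (hi'.plus (r := r) hT hk.2).1
      cases i'
      · exact Or.inl ⟨this, hl'.trans hl.symm⟩
      · exact Or.inr (Or.inl ⟨this, hl'.trans hl.symm⟩)
      · exact absurd hi'.1 (by omega)
      · exact absurd hi'.1 (by omega)
  · rw [if_neg hX] at hc
    have hle : ∀ b ∈ s, (c : ℤ) ≤ b := fun b hb => hc ▸ s.min'_le b hb
    cases i
    · rintro ⟨h1, h2⟩
      obtain ⟨b, hb, hbs⟩ := hplus .w h1 (h2.trans hl)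
      have := hb.1
      exact hX ⟨hr0, ⟨c, hcs, hi.1⟩, ⟨b, hbs, by omega⟩⟩
    · rintro ⟨h1, h2⟩
      obtain ⟨b, hb, hbs⟩ := hplus .x h1 (h2.trans hl)
      -- Within a column the entry `k` precedes the barred `k + 1`, so the latter cannot be the
      -- first candidate.
      have h3 := (hT.lt_iff_one hb.1 hi.1).1 (by rw [hb.2, hi.2.1]; have := hi.2.2; omega)
      have := hle b hbs
      omega
    · trivial
    · refine Or.inr (Or.inr ?_)
      rintro ⟨h1, h2⟩
      obtain ⟨b, hb, hbs⟩ := hplus .v h1 (h2.trans hl)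
      have h3 := (hT.lt_iff_two hb.1 hi.1).1 (by rw [hb.2, hi.2.1]; have := hi.2.2; omega)
      have := hle b hbs
      omega

theorem IsFilling.e_eq (hr : 1 ≤ r) (hε : eps k (tabMonomial n ℓ h r T) ≠ 0) :
    ∃ (i : Vertex) (c : Idx ℓ), AtMinus n h T k c i ∧
      pGrade k (tabMonomial n ℓ h r T) =
        baseLevel ℓ h k + 2 * level r (n - k) (prof n h T k) i ∧
      Peak (psum r (n - k) (prof n h T (k - 1)).dual (prof n h T k).dual (prof n h T (k + 1)).dual)
        (n - k - r - level r (n - k) (prof n h T k) i) ∧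
      MinusPick r (n - k) (prof n h T (k - 1)) (prof n h T k) (prof n h T (k + 1)) i ∧
      (tableauOps n ℓ h r).e k T = some (Function.update T c ((T c).prev n)) := by
  classical
  have hk := k.2
  simp only [Set.mem_Icc] at hk
  obtain ⟨a, hq, ha⟩ := hT.exists_peak_dual hε
  obtain ⟨s, hs⟩ : ∃ s, s = boxesAt n ℓ h r k T (pGrade k (tabMonomial n ℓ h r T)) (-1) :=
    ⟨_, rfl⟩
  have hmem : ∀ c, c ∈ s ↔ ∃ i, AtMinus n h T k c i ∧ level r (n - k) (prof n h T k) i = a := by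
    intro c
    rw [hs, hq, mem_boxesAt_neg_one hT]
  have hminus : ∀ i, Minus (prof n h T (k - 1)) (prof n h T k) (prof n h T (k + 1)) i →
      level r (n - k) (prof n h T k) i = a → ∃ c, AtMinus n h T k c i ∧ c ∈ s := by
    intro i hi hl
    obtain ⟨c, hc⟩ := exists_atMinus hT hk.2 hi
    exact ⟨c, hc, (hmem c).2 ⟨i, hc, hl⟩⟩
  have hne : s.Nonempty := by
    obtain ⟨i, hi, hl⟩ := exists_minus_of_peak (hT.step hk.2) (hT.step_succ hk.2) ha
    obtain ⟨c, -, hc⟩ := hminus i hi hl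
    exact ⟨c, hc⟩
  have hf : (tableauOps n ℓ h r).e k T = some (Function.update T
      (if Crossing ℓ h r s then s.min' hne else s.max' hne)
      ((T (if Crossing ℓ h r s then s.min' hne else s.max' hne)).prev n)) := by
    subst hs
    simp only [tableauOps]
    rw [dif_pos ⟨hε, hne⟩]
  rw [hf]
  obtain ⟨c, hc⟩ : ∃ c, c = if Crossing ℓ h r s then s.min' hne else s.max' hne := ⟨_, rfl⟩
  rw [← hc]
  have hcs : c ∈ s := by
    rw [hc]; split_ifs
    · exact s.min'_mem hne
    · exact s.max'_mem hne
  obtain ⟨i, hi, hl⟩ := (hmem c).1 hcs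
  refine ⟨i, c, hi, by rw [hq, hl], hl ▸ ha, ?_, rfl⟩
  have hr0 : r ≠ 0 := by omega
  by_cases hX : Crossing ℓ h r s
  · rw [if_pos hX] at hc
    have hle : ∀ b ∈ s, c ≤ b := fun b hb => hc ▸ s.min'_le b hb
    obtain ⟨-, ⟨u, hu, huh⟩, v, hv, hvh⟩ := hX
    have hch : (c : ℤ) ≤ h := by
      have : (c : ℤ) ≤ u := hle u hu
      omega
    cases i
    · obtain ⟨i', hi', hl'⟩ := (hmem v).1 hv
      have := (hi'.minus (r := r) hT hk.2).1
      cases i'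
      · exact absurd hi'.1 (by omega)
      · exact absurd hi'.1 (by omega)
      · exact Or.inr (Or.inl ⟨this, hl'.trans hl.symm⟩)
      · exact Or.inl ⟨this, hl'.trans hl.symm⟩
    · trivial
    · exact absurd hi.1 (by omega)
    · exact absurd hi.1 (by omega)
  · rw [if_neg hX] at hc
    have hle : ∀ b ∈ s, (b : ℤ) ≤ c := fun b hb => hc ▸ s.le_max' b hb
    cases i
    · refine Or.inr (Or.inr ?_)
      rintro ⟨h1, h2⟩
      obtain ⟨b, hb, hbs⟩ := hminus .y h1 (h2.trans hl)
      have h3 := (hT.lt_iff_one hi.1 hb.1).1 (by rw [hb.2, hi.2.1]; have := hi.2.2; omega)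
      have := hle b hbs
      omega
    · trivial
    · rintro ⟨h1, h2⟩
      obtain ⟨b, hb, hbs⟩ := hminus .w h1 (h2.trans hl)
      have h3 := (hT.lt_iff_two hi.1 hb.1).1 (by rw [hb.2, hi.2.1]; have := hi.2.2; omega)
      have := hle b hbs
      omega
    · rintro ⟨h1, h2⟩
      obtain ⟨b, hb, hbs⟩ := hminus .x h1 (h2.trans hl)
      have := hi.1
      exact hX ⟨hr0, ⟨b, hbs, hb.1⟩, ⟨c, hcs, by omega⟩⟩

end pick

theorem tableau_f_eq_none {k : Idx n} (hφ : phi k (tabMonomial n ℓ h r T) = 0) :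
    (tableauOps n ℓ h r).f k T = none := by
  simp only [tableauOps]
  rw [dif_neg fun hc => hc.1 hφ]

theorem tableau_e_eq_none {k : Idx n} (hε : eps k (tabMonomial n ℓ h r T) = 0) :
    (tableauOps n ℓ h r).e k T = none := by
  simp only [tableauOps]
  rw [dif_neg fun hc => hc.1 hε]

end CrystalTypeC

namespace CrystalTypeC

/-! ### Replacing an entry by the next or the preceding letter -/

open Quad

/-! ### Local uniqueness of the entry that reverses a move -/

section local_uniqueness

variable {r m : ℤ} {p q s : Quad}

/-- A raised path sits one level higher and contributes there with exponent `-1`. The local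
conditions before and after the move, together with the picking rule, leave no other path for `ẽ` to
choose at that level. -/
theorem minusPick_unique (hr : 1 ≤ r) (hm : 0 ≤ m) (h0 : Loc r m p q) (h1 : Loc r (m - 1) q s)
    {i j : Vertex} (h0' : Loc r m p (raise q i)) (h1' : Loc r (m - 1) (raise q i) s)
    (hi : Plus p q s i) (hj : Minus p (raise q i) s j)
    (hj' : MinusPick r m p (raise q i) s j)
    (hl : level r m (raise q i) j = level r m q i + 1) : j = i := by
  obtain ⟨a1,a2,a3,a4,a5,a6,a7,a8,a9,a10,a11,a12,a13,a14,a15,a16⟩ := h0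
  obtain ⟨b1,b2,b3,b4,b5,b6,b7,b8,b9,b10,b11,b12,b13,b14,b15,b16⟩ := h1
  obtain ⟨c1,c2,c3,c4,c5,c6,c7,c8,c9,c10,c11,c12,c13,c14,c15,c16⟩ := h0'
  obtain ⟨d1,d2,d3,d4,d5,d6,d7,d8,d9,d10,d11,d12,d13,d14,d15,d16⟩ := h1'
  clear a15 a16 b5 b6 b7 b8 b15 b16 c5 c6 c7 c8 c15 c16 d5 d6 d7 d8 d15 d16 a9 a10 b9 b10 c9 c10
    d9 d10 c12 c13 c14 d12 d13 d14
  cases i <;> cases j <;> first | rfl | exfalso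
  all_goals simp only [Plus, Minus, raise, level, MinusPick] at *
  all_goals first
    | (clear a14 a13 b12 b13 b14; grind (splits := 40))
    | grind (splits := 40)

theorem plusPick_unique (hr : 1 ≤ r) (hm : 0 ≤ m) (h0 : Loc r m p q) (h1 : Loc r (m - 1) q s)
    {i j : Vertex} (h0' : Loc r m p (lower q i)) (h1' : Loc r (m - 1) (lower q i) s)
    (hi : Minus p q s i) (hj : Plus p (lower q i) s j)
    (hj' : PlusPick r m p (lower q i) s j)
    (hl : level r m (lower q i) j = level r m q i - 1) : j = i := by
  have e : raise q.dual i.dual = (lower q i).dual := by cases i <;> rfl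
  have hlev : ∀ (q : Quad) (j : Vertex), level r m q.dual j.dual = m - r - level r m q j := by
    intro q j
    cases j <;> simp only [level, Quad.dual, Vertex.dual] <;> ring
  have hmn : ∀ (q : Quad) (j : Vertex), Minus p.dual q.dual s.dual j.dual ↔ Plus p q s j := by
    intro q j
    cases j <;> rfl
  have key : j.dual = i.dual := by
    refine minusPick_unique (p := p.dual) (q := q.dual) (s := s.dual) hr hm h0.dual h1.dual
      (e ▸ h0'.dual) (e ▸ h1'.dual) (by cases i <;> exact hi) ?_ ?_ ?_
    · rw [e, hmn]; exact hj
    · rw [e]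
      have h2 := hlev (lower q i) .x
      have h3 := hlev (lower q i) .y
      have h4 := hlev (lower q i) .v
      have h5 := hlev (lower q i) .w
      have h6 := hmn (lower q i) .x
      have h7 := hmn (lower q i) .y
      have h8 := hmn (lower q i) .v
      have h9 := hmn (lower q i) .w
      simp only [Vertex.dual] at h2 h3 h4 h5 h6 h7 h8 h9
      cases j <;> simp only [MinusPick, PlusPick, Vertex.dual, h2, h3, h4, h5, h6, h7, h8, h9,
        sub_right_inj] at hj' ⊢ <;> exact hj'
    · rw [e, hlev, hlev, hl]; ring
  cases i <;> cases j <;> first | rfl | cases key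

end local_uniqueness

variable {n ℓ h r : ℤ} {T T' : Tableau ℓ}

theorem Letter.ext_rank {x y : Letter} (hx : x.InB n) (hy : y.InB n) (h : x.rank n = y.rank n) :
    x = y := by
  cases x <;> cases y <;>
    simp only [Letter.InB, Letter.rank_plain, Letter.rank_bar, Letter.plain.injEq,
      Letter.bar.injEq, reduceCtorEq] at * <;> omega

theorem Letter.rank_next {x : Letter} (hx : x.InB n) (h : x.rank n < 2 * n) :
    (x.next n).InB n ∧ (x.next n).rank n = x.rank n + 1 := by
  cases x with
  | plain k =>
    simp only [Letter.InB, Letter.rank_plain] at hx h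
    simp only [Letter.next, Letter.rank_plain]
    split_ifs with hk
    · simp only [Letter.InB, Letter.rank_bar]; omega
    · simp only [Letter.InB, Letter.rank_plain, and_true]; omega
  | bar k =>
    simp only [Letter.InB, Letter.rank_bar] at hx h
    simp only [Letter.next, Letter.InB, Letter.rank_bar]
    omega

theorem Letter.rank_prev {x : Letter} (hx : x.InB n) (h : 1 < x.rank n) :
    (x.prev n).InB n ∧ (x.prev n).rank n = x.rank n - 1 := by
  cases x with
  | bar k =>
    simp only [Letter.InB, Letter.rank_bar] at hx h
    simp only [Letter.prev, Letter.rank_bar]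
    split_ifs with hk
    · simp only [Letter.InB, Letter.rank_plain]; omega
    · simp only [Letter.InB, Letter.rank_bar]; omega
  | plain k =>
    simp only [Letter.InB, Letter.rank_plain] at hx h
    simp only [Letter.prev, Letter.InB, Letter.rank_plain, and_true]
    omega

/-- `T'` arises from `T` by replacing the entry at `c` by the next letter. -/
structure RaisedAt (n : ℤ) (c : Idx ℓ) (T T' : Tableau ℓ) : Prop where
  mem : (T c).InB n
  mem' : (T' c).InB n
  rank : (T' c).rank n = (T c).rank n + 1
  eq : ∀ a, a ≠ c → T' a = T a

theorem raisedAt_next {c : Idx ℓ} (hm : (T c).InB n) (hc : (T c).rank n < 2 * n) :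
    RaisedAt n c T (Function.update T c ((T c).next n)) := by
  have := Letter.rank_next hm hc
  refine ⟨hm, ?_, ?_, fun a ha => Function.update_of_ne ha _ _⟩
  · rw [Function.update_self]; exact this.1
  · rw [Function.update_self]; exact this.2

theorem raisedAt_prev {c : Idx ℓ} (hm : (T c).InB n) (hc : 1 < (T c).rank n) :
    RaisedAt n c (Function.update T c ((T c).prev n)) T := by
  have := Letter.rank_prev hm hc
  refine ⟨?_, hm, ?_, fun a ha => (Function.update_of_ne ha _ _).symm⟩
  · rw [Function.update_self]; exact this.1
  · rw [Function.update_self]; omega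

theorem RaisedAt.right_unique {c : Idx ℓ} {T'' : Tableau ℓ} (h1 : RaisedAt n c T T')
    (h2 : RaisedAt n c T T'') : T' = T'' := by
  funext a
  by_cases ha : a = c
  · subst ha
    exact Letter.ext_rank h1.mem' h2.mem' (h1.rank.trans h2.rank.symm)
  · rw [h1.eq a ha, h2.eq a ha]

theorem RaisedAt.left_unique {c : Idx ℓ} {T'' : Tableau ℓ} (h1 : RaisedAt n c T T')
    (h2 : RaisedAt n c T'' T') : T = T'' := by
  funext a
  by_cases ha : a = c
  · subst ha
    have := h1.rank
    have := h2.rank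
    exact Letter.ext_rank h1.mem h2.mem (by omega)
  · rw [← h1.eq a ha, ← h2.eq a ha]

namespace RaisedAt

variable {c : Idx ℓ} (hR : RaisedAt n c T T')
include hR

theorem filling (hT : IsFilling n h T)
    (hc : ∀ b : Idx ℓ, ((b : ℤ) ≤ h ↔ (c : ℤ) ≤ h) → (T b).rank n ≠ (T c).rank n + 1) :
    IsFilling n h T' := by
  have hr := hR.rank
  refine ⟨⟨fun a => ?_, fun a b hab hb => ?_, fun a b hab ha => ?_⟩, hT.h_nonneg, hT.h_le⟩
  · by_cases ha : a = c
    · subst ha; exact hR.mem'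
    · rw [hR.eq a ha]; exact hT.mem a
  · have hab' : (a : ℤ) < b := hab
    have h1 := hT.col₁ a b hab hb
    by_cases ha : a = c
    · subst ha
      rw [hR.eq b hab.ne']
      have := hc b (by omega)
      omega
    · by_cases hb' : b = c
      · subst hb'; rw [hR.eq a ha]; omega
      · rw [hR.eq a ha, hR.eq b hb']; exact h1
  · have hab' : (a : ℤ) < b := hab
    have h1 := hT.col₂ a b hab ha
    by_cases ha : a = c
    · subst ha
      rw [hR.eq b hab.ne']
      have := hc b (by omega)
      omega
    · by_cases hb' : b = c
      · subst hb'; rw [hR.eq a ha]; omega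
      · rw [hR.eq a ha, hR.eq b hb']; exact h1

theorem filling' (hT : IsFilling n h T')
    (hc : ∀ b : Idx ℓ, ((b : ℤ) ≤ h ↔ (c : ℤ) ≤ h) → (T' b).rank n ≠ (T' c).rank n - 1) :
    IsFilling n h T := by
  have hr := hR.rank
  refine ⟨⟨fun a => ?_, fun a b hab hb => ?_, fun a b hab ha => ?_⟩, hT.h_nonneg, hT.h_le⟩
  · by_cases ha : a = c
    · subst ha; exact hR.mem
    · rw [← hR.eq a ha]; exact hT.mem a
  · have hab' : (a : ℤ) < b := hab
    have h1 := hT.col₁ a b hab hb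
    by_cases ha : a = c
    · subst ha
      rw [← hR.eq b hab.ne']
      omega
    · by_cases hb' : b = c
      · subst hb'; rw [← hR.eq a ha]
        have := hc a (by omega)
        omega
      · rw [← hR.eq a ha, ← hR.eq b hb']; exact h1
  · have hab' : (a : ℤ) < b := hab
    have h1 := hT.col₂ a b hab ha
    by_cases ha : a = c
    · subst ha
      rw [← hR.eq b hab.ne']
      omega
    · by_cases hb' : b = c
      · subst hb'; rw [← hR.eq a ha]
        have := hc a (by omega)
        omega
      · rw [← hR.eq a ha, ← hR.eq b hb']; exact h1

theorem colOne_eq (h s : ℤ) : colOne n h T' s =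
    colOne n h T s + if (c : ℤ) ≤ h ∧ s = (T c).rank n then 1 else 0 := by
  have hr := hR.rank
  rw [← sub_eq_iff_eq_add', colOne, colOne, ← Finset.sum_sub_distrib, Finset.sum_eq_single c]
  · split_ifs <;> omega
  · intro b _ hb
    rw [hR.eq b hb, sub_self]
  · simp

theorem colTwo_eq (h s : ℤ) : colTwo n h T' s =
    colTwo n h T s - if h < (c : ℤ) ∧ s = (T c).rank n then 1 else 0 := by
  have hr := hR.rank
  rw [eq_sub_iff_add_eq', ← eq_sub_iff_add_eq, colTwo, colTwo, ← Finset.sum_sub_distrib,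
    Finset.sum_eq_single c]
  · split_ifs <;> omega
  · intro b _ hb
    rw [hR.eq b hb, sub_self]
  · simp

/-- Raising a rank from `ρ` to `ρ + 1` changes the count at `ρ` only, and for `k < n` the values `k`
and `2n - k` of `ρ` each belong to one path at `j = k`. -/
theorem prof_eq {k : ℤ} {i : Vertex} (hk : k < n) (hi : AtPlus n h T k c i) (j : ℤ) :
    prof n h T' j = if j = k then raise (prof n h T k) i else prof n h T j := by
  unfold prof
  simp only [hR.colOne_eq, hR.colTwo_eq]
  cases i <;> simp only [AtPlus] at hi <;> simp only [raise] <;> split_ifs <;>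
    (first | (exfalso; omega) | (subst_vars; ext <;> simp))

/-- The rank `n` is read at `j = n` both as `j` and as `2n - j`, so `x` and `y` move together. -/
theorem prof_eq_end_x (hi : AtPlus n h T n c .x) {j : ℤ} (hj : j ≤ n) :
    prof n h T' j = if j = n then raise (raise (prof n h T n) .x) .y else prof n h T j := by
  unfold prof
  simp only [hR.colOne_eq, hR.colTwo_eq]
  simp only [AtPlus] at hi
  simp only [raise]
  split_ifs <;>
    (first | (exfalso; omega) | (subst_vars; ext <;> simp))

theorem prof_eq_end_v (hi : AtPlus n h T n c .v) {j : ℤ} (hj : j ≤ n) :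
    prof n h T' j = if j = n then raise (raise (prof n h T n) .v) .w else prof n h T j := by
  unfold prof
  simp only [hR.colOne_eq, hR.colTwo_eq]
  simp only [AtPlus] at hi
  simp only [raise]
  split_ifs <;>
    (first | (exfalso; omega) | (subst_vars; ext <;> simp))

end RaisedAt

/-! ### The effect on the monomial -/

theorem rootMonomial_eq_of_lt {k : Idx n} (hk : (k : ℤ) < n) (l : ℤ) :
    rootMonomial n k l = Y n k (l - 1) + Y n k (l + 1) - Y n (k - 1) l - Y n (k + 1) l := by
  funext j
  simp only [Pi.sub_apply, Pi.add_apply, Y_apply]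
  by_cases hj : j = k
  · subst hj
    have h1 : ¬ (j : ℤ) = j - 1 := by omega
    simp [rootMonomial_self, h1]
  · have hj' : (j : ℤ) ≠ k := fun h => hj (Subtype.ext h)
    rw [rootMonomial_of_ne hj, if_neg hj', if_neg hj', cartan, if_neg hj]
    by_cases h1 : (j : ℤ) = k - 1
    · have h2 : ¬ (j : ℤ) = k + 1 := by omega
      have h3 : ¬ ((j : ℤ) = n - 1 ∧ (k : ℤ) = n) := by omega
      rw [if_pos h1, if_neg h2, if_pos (by rw [h1]; simp), if_neg h3]
      simp
    · by_cases h2 : (j : ℤ) = k + 1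
      · rw [if_neg h1, if_pos h2, if_pos (by rw [h2]; simp), if_neg (by omega)]
        simp
      · rw [if_neg h1, if_neg h2, if_neg]
        · simp
        · intro habs
          rcases abs_eq (zero_le_one' ℤ) |>.1 habs with h | h <;> omega

theorem rootMonomial_eq_of_eq {k : Idx n} (hk : (k : ℤ) = n) (l : ℤ) :
    rootMonomial n k l = Y n k (l - 1) + Y n k (l + 1) - Y n (k - 1) l - Y n (k - 1) l := by
  funext j
  have hj0 := j.2.2
  simp only [Pi.sub_apply, Pi.add_apply, Y_apply]
  by_cases hj : j = k
  · subst hj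
    have h1 : ¬ (j : ℤ) = j - 1 := by omega
    simp [rootMonomial_self, h1]
  · have hj' : (j : ℤ) ≠ k := fun h => hj (Subtype.ext h)
    rw [rootMonomial_of_ne hj, if_neg hj', if_neg hj', cartan, if_neg hj]
    by_cases h1 : (j : ℤ) = k - 1
    · rw [if_pos h1, if_pos (by rw [h1]; simp), if_pos (by omega), zero_add, zero_sub,
        ← Finsupp.single_neg, ← Finsupp.single_sub]
      rfl
    · rw [if_neg h1, if_neg]
      · simp
      · intro habs
        rcases abs_eq (zero_le_one' ℤ) |>.1 habs with h | h <;> omega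

/-- Neighboring boxes in the vector representation differ by `A_{k,l}^{-1}`. The step from `n` to
the barred `n` uses `A_{n,l}`, in which `Y_{n-1,l}` occurs with exponent `-2`. -/
theorem box_rank_succ {x y : Letter} (hx : x.InB n) (hy : y.InB n)
    (hxy : y.rank n = x.rank n + 1) {k : Idx n} (hk : x.rank n = k ∨ x.rank n = 2 * n - k)
    (p : ℤ) : box n y p = box n x p - rootMonomial n k (p + x.rank n) := by
  have hk0 := k.2
  simp only [Set.mem_Icc] at hk0
  cases x with
  | plain i =>
    simp only [Letter.InB, Letter.rank_plain] at hx hxy hk ⊢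
    have hki : (k : ℤ) = i := by omega
    rcases hx.2.lt_or_eq with hin | hin
    · have hy' := Letter.eq_plain_of_rank_le hy (by omega)
      rw [hy', hxy, rootMonomial_eq_of_lt (by omega)]
      simp only [box, hki]
      rw [show p + (i + 1) - 1 = p + i by ring, show p + (i + 1) = p + i + 1 by ring,
        add_sub_cancel_right]
      abel
    · rw [(Letter.rank_eq_bar hy le_rfl).1 (by omega), rootMonomial_eq_of_eq (by omega)]
      simp only [box, hki]
      rw [hin, show p + 2 * n - n = p + n by ring, show p + 2 * n + 1 - n = p + n + 1 by ring]
      abel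
  | bar i =>
    simp only [Letter.InB, Letter.rank_bar] at hx hxy hk ⊢
    have hki : (k : ℤ) = i - 1 := by omega
    rw [(Letter.rank_eq_bar (k := i - 1) hy (by omega)).1 (by omega),
      rootMonomial_eq_of_lt (by omega)]
    simp only [box, hki]
    rw [show p + 2 * n - (i - 1) = p + 2 * n + 1 - i by ring,
      show p + 2 * n + 1 - (i - 1) = p + 2 * n + 1 - i + 1 by ring,
      show p + (2 * n + 1 - i) = p + 2 * n + 1 - i by ring,
      show p + 2 * n - i = p + 2 * n + 1 - i - 1 by ring, sub_add_cancel]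
    abel

theorem RaisedAt.tabMonomial_eq {c : Idx ℓ} (hR : RaisedAt n c T T') {k : Idx n}
    (hk : (T c).rank n = k ∨ (T c).rank n = 2 * n - k) (h r : ℤ) : tabMonomial n ℓ h r T' =
      tabMonomial n ℓ h r T - rootMonomial n k (suffix ℓ h r c + (T c).rank n) := by
  unfold tabMonomial
  rw [eq_sub_iff_add_eq', ← eq_sub_iff_add_eq, ← Finset.sum_sub_distrib, Finset.sum_eq_single c]
  · rw [box_rank_succ hR.mem hR.mem' hR.rank hk, sub_sub_cancel]
  · intro b _ hb
    rw [hR.eq b hb, sub_self]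
  · simp

end CrystalTypeC

namespace CrystalTypeC

/-! ### The tableaux form a crystal if `r ≥ 1` -/

open Quad

variable {n ℓ h r : ℤ} {T T' : Tableau ℓ}

/-- The quadruple at `k < n` enters only the conditions at `j = k` and `j = k + 1`. -/
theorem Adm.replace {Q Q' : ℤ → Quad} {q : Quad} {k : ℤ} (hA : Adm n r Q) (hkn : k < n)
    (hQ : ∀ j, j ≤ n → Q' j = if j = k then q else Q j) (h0 : Loc r (n - k) (Q (k - 1)) q)
    (h1 : Loc r (n - k - 1) q (Q (k + 1))) : Adm n r Q' := by
  refine ⟨fun j hj hjn => ?_, ?_⟩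
  · rw [hQ j hjn, hQ (j - 1) (by omega)]
    by_cases hjk : j = k
    · subst hjk
      rwa [if_pos rfl, if_neg (by omega)]
    · rw [if_neg hjk]
      by_cases hjk' : j = k + 1
      · subst hjk'
        rw [if_pos (by ring)]
        rwa [show n - (k + 1) = n - k - 1 by ring]
      · rw [if_neg (by omega)]
        exact hA.loc j hj hjn
  · rw [hQ n le_rfl, if_neg (by omega)]
    exact hA.fin

theorem Adm.replace_end {Q Q' : ℤ → Quad} {q : Quad} (hA : Adm n r Q)
    (hQ : ∀ j, j ≤ n → Q' j = if j = n then q else Q j) (h0 : Loc r 0 (Q (n - 1)) q)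
    (h1 : End q) : Adm n r Q' := by
  refine ⟨fun j hj hjn => ?_, ?_⟩
  · rw [hQ j hjn, hQ (j - 1) (by omega), if_neg (c := j - 1 = n) (by omega)]
    by_cases hjk : j = n
    · subst hjk
      rwa [if_pos rfl, sub_self]
    · rw [if_neg hjk]
      exact hA.loc j hj hjn
  · rwa [hQ n le_rfl, if_pos rfl]

theorem Loc.step {r m : ℤ} {p q : Quad} (h : Loc r m p q) : Step p q := ⟨h.hx, h.hy, h.hv, h.hw⟩

/-- If the next letter already stood in the same column, the raised path would make a step of size
two. This is how strictness of the columns after `f̃_k` is read off from the local conditions. -/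
theorem not_minus_of_step_raise {p q s : Quad} {i : Vertex} (h0 : Step p (raise q i))
    (h1 : Step (raise q i) s) : ¬ Minus p q s i := by
  obtain ⟨a1, a2, a3, a4⟩ := h0
  obtain ⟨b1, b2, b3, b4⟩ := h1
  cases i <;> simp only [Minus, raise] at * <;> omega

theorem not_plus_of_step_lower {p q s : Quad} {i : Vertex} (h0 : Step p (lower q i))
    (h1 : Step (lower q i) s) : ¬ Plus p q s i := by
  obtain ⟨a1, a2, a3, a4⟩ := h0
  obtain ⟨b1, b2, b3, b4⟩ := h1
  cases i <;> simp only [Plus, lower] at * <;> omega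

theorem lower_raise (q : Quad) (i : Vertex) : lower (raise q i) i = q := by
  cases i <;> ext <;> simp [lower, raise]

theorem AtPlus.rank {k : ℤ} {c : Idx ℓ} {i : Vertex} (hi : AtPlus n h T k c i) :
    (T c).rank n = k ∨ (T c).rank n = 2 * n - k := by
  cases i
  · exact Or.inl hi.2
  · exact Or.inr hi.2.1
  · exact Or.inl hi.2
  · exact Or.inr hi.2.1

theorem AtMinus.rank {k : ℤ} {c : Idx ℓ} {i : Vertex} (hi : AtMinus n h T k c i) :
    (T c).rank n = k + 1 ∨ (T c).rank n = 2 * n + 1 - k := by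
  cases i
  · exact Or.inl hi.2.1
  · exact Or.inr hi.2
  · exact Or.inl hi.2.1
  · exact Or.inr hi.2

theorem RaisedAt.atMinus_iff {k : ℤ} {c : Idx ℓ} {i : Vertex} (hR : RaisedAt n c T T')
    (hk : k < n) : AtMinus n h T' k c i ↔ AtPlus n h T k c i := by
  have := hR.rank
  cases i <;> simp only [AtMinus, AtPlus] <;> omega

theorem RaisedAt.atMinus_end_y {c : Idx ℓ} (hR : RaisedAt n c T T') :
    AtMinus n h T' n c .y ↔ AtPlus n h T n c .x := by
  have := hR.rank
  simp only [AtMinus, AtPlus]; omega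

theorem RaisedAt.atMinus_end_w {c : Idx ℓ} (hR : RaisedAt n c T T') :
    AtMinus n h T' n c .w ↔ AtPlus n h T n c .v := by
  have := hR.rank
  simp only [AtMinus, AtPlus]; omega

theorem rank_ne_of_not_minus (hT : IsFilling n h T) {k : ℤ} {c : Idx ℓ} {i : Vertex} (hk : k < n)
    (hc : AtPlus n h T k c i)
    (hi : ¬ Minus (prof n h T (k - 1)) (prof n h T k) (prof n h T (k + 1)) i) (b : Idx ℓ)
    (hb : (b : ℤ) ≤ h ↔ (c : ℤ) ≤ h) : (T b).rank n ≠ (T c).rank n + 1 := by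
  refine fun hbc => hi (AtMinus.minus (r := 1) (c := b) hT hk.le ?_).1
  cases i <;> simp only [AtMinus, AtPlus] at * <;> omega

theorem rank_ne_of_not_plus (hT : IsFilling n h T) {k : ℤ} {c : Idx ℓ} {i : Vertex} (hk : k < n)
    (hc : AtMinus n h T k c i)
    (hi : ¬ Plus (prof n h T (k - 1)) (prof n h T k) (prof n h T (k + 1)) i) (b : Idx ℓ)
    (hb : (b : ℤ) ≤ h ↔ (c : ℤ) ≤ h) : (T b).rank n ≠ (T c).rank n - 1 := by
  refine fun hbc => hi (AtPlus.plus (r := 1) (c := b) hT hk.le ?_).1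
  cases i <;> simp only [AtMinus, AtPlus] at * <;> omega

theorem RaisedAt.isTableauC {k : ℤ} {c : Idx ℓ} {i : Vertex} (hr : 1 ≤ r) (hk1 : 1 ≤ k)
    (hkn : k ≤ n) (hR : RaisedAt n c T T') (hF : IsFilling n h T) (hA : Adm n r (prof n h T))
    (hi : AtPlus n h T k c i) (hpeak : Peak (height n h r T k) (level r (n - k) (prof n h T k) i))
    (hpick : PlusPick r (n - k) (prof n h T (k - 1)) (prof n h T k) (prof n h T (k + 1)) i) :
    IsTableauC n ℓ h r T' := by
  have hplus := (hi.plus (r := r) hF hkn).1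
  have hl0 := hA.loc k hk1 hkn
  rcases hkn.lt_or_eq with hk | rfl
  · have hl1 := hA.loc (k + 1) (by omega) (by omega)
    rw [add_sub_cancel_right, show n - (k + 1) = n - k - 1 by ring] at hl1
    obtain ⟨h2, h3⟩ := loc_raise hr hl0 hl1 hpeak hplus hpick
    have hF' := hR.filling hF
      (rank_ne_of_not_minus hF hk hi (not_minus_of_step_raise h2.step h3.step))
    exact (hA.replace hk (fun j _ => hR.prof_eq hk hi j) h2 h3).isTableauC hF' hr
  · unfold height at hpeak
    rw [sub_self] at hl0 hpeak
    rw [prof_succ_self] at hpeak hplus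
    cases i
    · obtain ⟨h2, h3⟩ := loc_raise_end_x hr hl0 hA.fin hpeak hplus
      have hF' := hR.filling hF fun b hb hbc => by
        have hm : AtMinus k h T k b .y := by
          simp only [AtMinus, AtPlus] at *; omega
        have h4 := (hm.minus (r := r) hF le_rfl).1
        have h5 := h2.hy
        simp only [Minus, raise] at h4 h5
        omega
      exact (hA.replace_end (fun j hj => hR.prof_eq_end_x hi hj) h2 h3).isTableauC hF' hr
    · exact absurd hi.2.2 (lt_irrefl _)
    · obtain ⟨h2, h3⟩ := loc_raise_end_v hl0 hA.fin hpeak hplus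
      have hF' := hR.filling hF fun b hb hbc => by
        have hm : AtMinus k h T k b .w := by
          simp only [AtMinus, AtPlus] at *; omega
        have h4 := (hm.minus (r := r) hF le_rfl).1
        have h5 := h2.hw
        simp only [Minus, raise] at h4 h5
        omega
      exact (hA.replace_end (fun j hj => hR.prof_eq_end_v hi hj) h2 h3).isTableauC hF' hr
    · exact absurd hi.2.2 (lt_irrefl _)

theorem RaisedAt.isTableauC' {k : ℤ} {c : Idx ℓ} {i : Vertex} (hr : 1 ≤ r) (hk1 : 1 ≤ k)
    (hkn : k ≤ n) (hR : RaisedAt n c T' T) (hF : IsFilling n h T) (hA : Adm n r (prof n h T))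
    (hi : AtMinus n h T k c i)
    (hpeak : Peak (psum r (n - k) (prof n h T (k - 1)).dual (prof n h T k).dual
      (prof n h T (k + 1)).dual) (n - k - r - level r (n - k) (prof n h T k) i))
    (hpick : MinusPick r (n - k) (prof n h T (k - 1)) (prof n h T k) (prof n h T (k + 1)) i) :
    IsTableauC n ℓ h r T' := by
  have hminus := (hi.minus (r := r) hF hkn).1
  have hl0 := hA.loc k hk1 hkn
  rcases hkn.lt_or_eq with hk | rfl
  · have hl1 := hA.loc (k + 1) (by omega) (by omega)
    rw [add_sub_cancel_right, show n - (k + 1) = n - k - 1 by ring] at hl1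
    obtain ⟨h2, h3⟩ := loc_lower hr hl0 hl1 hpeak hminus hpick
    have hF' := hR.filling' hF
      (rank_ne_of_not_plus hF hk hi (not_plus_of_step_lower h2.step h3.step))
    have hp := hR.prof_eq hk ((hR.atMinus_iff hk).1 hi)
    refine (hA.replace hk (fun j _ => ?_) h2 h3).isTableauC hF' hr
    rw [hp k, if_pos rfl, lower_raise, hp j]
    split_ifs with hj
    · rw [hj]
    · rfl
  · rw [sub_self] at hl0 hpeak
    rw [prof_succ_self] at hpeak hminus
    cases i
    · exact absurd hi.2.2 (lt_irrefl _)
    · obtain ⟨h2, h3⟩ := loc_lower_end_y hl0 hA.fin hpeak hminus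
      have hF' := hR.filling' hF fun b hb hbc => by
        have hm : AtPlus k h T k b .x := by
          simp only [AtMinus, AtPlus] at *; omega
        have h4 := (hm.plus (r := r) hF le_rfl).1
        have h5 := h2.hx
        simp only [Plus, lower] at h4 h5
        omega
      have hp := fun j => hR.prof_eq_end_x (hR.atMinus_end_y.1 hi) (j := j)
      refine (hA.replace_end (fun j hj => ?_) h2 h3).isTableauC hF' hr
      rw [hp k le_rfl, if_pos rfl, lower_raise, lower_raise, hp j hj]
      split_ifs with hj
      · rw [hj]
      · rfl
    · exact absurd hi.2.2 (lt_irrefl _)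
    · obtain ⟨h2, h3⟩ := loc_lower_end_w hr hl0 hA.fin hpeak hminus
      have hF' := hR.filling' hF fun b hb hbc => by
        have hm : AtPlus k h T k b .v := by
          simp only [AtMinus, AtPlus] at *; omega
        have h4 := (hm.plus (r := r) hF le_rfl).1
        have h5 := h2.hv
        simp only [Plus, lower] at h4 h5
        omega
      have hp := fun j => hR.prof_eq_end_v (hR.atMinus_end_w.1 hi) (j := j)
      refine (hA.replace_end (fun j hj => ?_) h2 h3).isTableauC hF' hr
      rw [hp k le_rfl, if_pos rfl, lower_raise, lower_raise, hp j hj]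
      split_ifs with hj
      · rw [hj]
      · rfl

namespace IsTableauC

variable (hT : IsTableauC n ℓ h r T) (h0 : 0 ≤ h) (h1 : h ≤ ℓ) (hr : 1 ≤ r)
include hT h0 h1 hr

theorem exists_f {k : Idx n} (hφ : phi k (tabMonomial n ℓ h r T) ≠ 0) :
    ∃ (i : Vertex) (c : Idx ℓ) (T' : Tableau ℓ), (tableauOps n ℓ h r).f k T = some T' ∧
      RaisedAt n c T T' ∧ AtPlus n h T k c i ∧
      qGrade k (tabMonomial n ℓ h r T) =
        baseLevel ℓ h k + 2 * level r (n - k) (prof n h T k) i ∧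
      PlusPick r (n - k) (prof n h T (k - 1)) (prof n h T k) (prof n h T (k + 1)) i ∧
      Peak (height n h r T k) (level r (n - k) (prof n h T k) i) ∧
      IsTableauC n ℓ h r T' ∧ tabMonomial n ℓ h r T' = tabMonomial n ℓ h r T -
        rootMonomial n k (qGrade k (tabMonomial n ℓ h r T) + 1) := by
  have hk := k.2
  simp only [Set.mem_Icc] at hk
  have hF := hT.isFilling h0 h1
  obtain ⟨i, c, hi, hq, hpeak, hpick, hf⟩ := hF.f_eq hr hφ
  have hR := raisedAt_next (hT.mem c) (by have := hi.rank; omega)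
  refine ⟨i, c, _, hf, hR, hi, hq, hpick, hpeak,
    hR.isTableauC hr hk.1 hk.2 hF (hT.adm h0 h1 hr) hi hpeak hpick, ?_⟩
  rw [hR.tabMonomial_eq hi.rank, hq, (hi.plus hF hk.2).2]
  congr 2; ring

theorem exists_e {k : Idx n} (hε : eps k (tabMonomial n ℓ h r T) ≠ 0) :
    ∃ (i : Vertex) (c : Idx ℓ) (T' : Tableau ℓ), (tableauOps n ℓ h r).e k T = some T' ∧
      RaisedAt n c T' T ∧ AtMinus n h T k c i ∧
      pGrade k (tabMonomial n ℓ h r T) =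
        baseLevel ℓ h k + 2 * level r (n - k) (prof n h T k) i ∧
      MinusPick r (n - k) (prof n h T (k - 1)) (prof n h T k) (prof n h T (k + 1)) i ∧
      IsTableauC n ℓ h r T' ∧ tabMonomial n ℓ h r T' = tabMonomial n ℓ h r T +
        rootMonomial n k (pGrade k (tabMonomial n ℓ h r T) - 1) := by
  have hk := k.2
  simp only [Set.mem_Icc] at hk
  have hF := hT.isFilling h0 h1
  obtain ⟨i, c, hi, hq, hpeak, hpick, hf⟩ := hF.e_eq hr hε
  have hR := raisedAt_prev (hT.mem c) (by have := hi.rank; omega)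
  refine ⟨i, c, _, hf, hR, hi, hq, hpick,
    hR.isTableauC' hr hk.1 hk.2 hF (hT.adm h0 h1 hr) hi hpeak hpick, ?_⟩
  have hrank := hR.rank
  have := hi.rank
  rw [hq, (hi.minus hF hk.2).2, ← sub_eq_iff_eq_add, eq_comm,
    hR.tabMonomial_eq (k := k) (by omega)]
  congr 2; omega

end IsTableauC

/-- The parity of the levels of the variables that occur in `m_T`. -/
def coloring (n ℓ : ℤ) (k : Idx n) : ℤ := (ℓ + k) % 2

theorem isColoring_coloring (n ℓ : ℤ) : IsColoring n (coloring n ℓ) := by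
  refine ⟨fun i => by unfold coloring; omega, fun i j hij => ?_⟩
  unfold coloring
  have habs : |(i : ℤ) - j| = 1 := by
    unfold cartan at hij
    by_contra hc
    rw [if_neg hc] at hij
    split_ifs at hij <;> omega
  rcases abs_eq (zero_le_one' ℤ) |>.1 habs with h | h <;> omega

theorem IsFilling.tabMonomial_mem (hF : IsFilling n h T) (r : ℤ) :
    tabMonomial n ℓ h r T ∈ monomialSet n (coloring n ℓ) := by
  intro k l hl
  unfold coloring Int.ModEq at hl
  rw [hF.tabMonomial_apply]
  unfold exponents
  simp only [Finsupp.add_apply, Finsupp.single_apply]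
  rw [if_neg (by omega), if_neg (by omega), if_neg (by omega), if_neg (by omega)]
  rfl

theorem Adm.nonneg {Q : ℤ → Quad} (hA : Adm n r Q) {j : ℤ} (h1 : 1 ≤ j) (hj : j ≤ n) :
    0 ≤ (Q j).x ∧ 0 ≤ (Q j).v ∧ 0 ≤ (Q j).y ∧ 0 ≤ (Q j).w := by
  have h := hA.loc j h1 hj
  have := h.hv
  have := h.hy
  have := h.v_nonneg
  have := h.y_nonneg
  exact ⟨h.x_nonneg, by omega, by omega, h.w_nonneg⟩

/-- On monomials the operators are inverse to each other, so the reverse operator is defined and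
acts at the level next to the one just used. It remains to see that it selects the same entry: for
`k < n` by local uniqueness, for `k = n` by comparing levels. -/
theorem isTableauC_e_iff_f (h0 : 0 ≤ h) (h1 : h ≤ ℓ) (hr : 1 ≤ r) (hT : IsTableauC n ℓ h r T)
    (hT' : IsTableauC n ℓ h r T') (k : Idx n) :
    (tableauOps n ℓ h r).e k T' = some T ↔ (tableauOps n ℓ h r).f k T = some T' := by
  have hk := k.2
  simp only [Set.mem_Icc] at hk
  have hF := hT.isFilling h0 h1
  have hF' := hT'.isFilling h0 h1
  have hA := hT.adm h0 h1 hr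
  have hA' := hT'.adm h0 h1 hr
  have hcol := isColoring_coloring n ℓ
  have hm := hF.tabMonomial_mem r
  have hm' := hF'.tabMonomial_mem r
  have hC := isCrystalOn_monomialSet hcol
  constructor
  · intro he
    have hε : eps k (tabMonomial n ℓ h r T') ≠ 0 := fun hc => by
      rw [tableau_e_eq_none hc] at he; cases he
    obtain ⟨i, c, S, he', hR, hi, hp, hpick, -, hmS⟩ := hT'.exists_e h0 h1 hr hε
    obtain rfl : S = T := Option.some_injective _ (he'.symm.trans he)
    have hme : (monomialOps n).e k (tabMonomial n ℓ h r T') = some (tabMonomial n ℓ h r S) :=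
      monomial_e_eq_some.2 ⟨hε, hmS⟩
    have hφ : phi k (tabMonomial n ℓ h r S) ≠ 0 :=
      (monomial_f_eq_some.1 ((hC.e_iff_f k _ hm' _ hm).1 hme)).1
    have hq := (add_rootMonomial_phi hm' hε).2
    rw [← hmS] at hq
    obtain ⟨i', c', S', hf, hR', hi', hq', hpick', -, -, -⟩ := hT.exists_f h0 h1 hr hφ
    rw [hf]
    have hcc : c' = c := by
      rcases hk.2.lt_or_eq with hkn | hkn
      · have hi2 := (hR.atMinus_iff hkn).1 hi
        have hprof := hR.prof_eq hkn hi2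
        have e0 := hprof (k - 1)
        have e1 := hprof k
        have e2 := hprof (k + 1)
        rw [if_neg (by omega)] at e0 e2
        rw [if_pos rfl] at e1
        have l0 := hA'.loc k hk.1 hk.2
        have l1 := hA'.loc (k + 1) (by omega) (by omega)
        have l0' := hA.loc k hk.1 hk.2
        have l1' := hA.loc (k + 1) (by omega) (by omega)
        rw [add_sub_cancel_right, show n - ((k : ℤ) + 1) = n - k - 1 by ring] at l1 l1'
        have e3 : prof n h S k = lower (prof n h T' k) i := by rw [e1, lower_raise]
        have hii : i' = i := by
          refine plusPick_unique hr (by omega) l0 l1 (i := i) (j := i') ?_ ?_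
            (hi.minus (r := r) hF' hk.2).1 ?_ ?_ ?_
          · rw [← e3, e0]; exact l0'
          · rw [← e3, e2]; exact l1'
          · rw [← e3, e0, e2]; exact (hi'.plus (r := r) hF hk.2).1
          · rw [← e3, e0, e2]; exact hpick'
          · rw [← e3]; omega
        subst hii
        exact hi'.unique hF hi2
      · have x0 := hA.nonneg (j := k) hk.1 hk.2
        have x1 := hA'.nonneg (j := k) hk.1 hk.2
        rw [hkn] at hi hi' hq' hp x0 x1
        rw [sub_self] at hq' hp
        have hE := hA.fin
        have hE' := hA'.fin
        obtain ⟨z1, z2, -⟩ := hE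
        obtain ⟨z3, z4, -⟩ := hE'
        cases i
        · exact absurd hi.2.2 (lt_irrefl _)
        · cases i'
          · exact hi'.unique hF (hR.atMinus_end_y.1 hi)
          · exact absurd hi'.2.2 (lt_irrefl _)
          -- A contribution with exponent `1` of `v` needs `v ≥ 1`, so its level is at most `-2`.
          -- The entry just lowered lies in the first column and now has level at least `-1`.
          · have h5 := (hi'.plus (r := r) hF le_rfl).1
            have h6 := (hA.loc n (by omega) le_rfl).v_nonneg
            simp only [level, Plus] at hq' hp h5
            omega
          · exact absurd hi'.2.2 (lt_irrefl _)
        · exact absurd hi.2.2 (lt_irrefl _)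
        · cases i'
          · simp only [level] at hq' hp
            omega
          · exact absurd hi'.2.2 (lt_irrefl _)
          · exact hi'.unique hF (hR.atMinus_end_w.1 hi)
          · exact absurd hi'.2.2 (lt_irrefl _)
    subst hcc
    rw [hR'.right_unique hR]
  · intro hf
    have hφ : phi k (tabMonomial n ℓ h r T) ≠ 0 := fun hc => by
      rw [tableau_f_eq_none hc] at hf; cases hf
    obtain ⟨i, c, S, hf', hR, hi, hp, hpick, -, -, hmS⟩ := hT.exists_f h0 h1 hr hφ
    obtain rfl : S = T' := Option.some_injective _ (hf'.symm.trans hf)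
    have hmf : (monomialOps n).f k (tabMonomial n ℓ h r T) = some (tabMonomial n ℓ h r S) :=
      monomial_f_eq_some.2 ⟨hφ, hmS⟩
    have hε : eps k (tabMonomial n ℓ h r S) ≠ 0 :=
      (monomial_e_eq_some.1 ((hC.e_iff_f k _ hm' _ hm).2 hmf)).1
    have hq := (sub_rootMonomial_phi hm hφ).2
    rw [← hmS] at hq
    obtain ⟨i', c', S', he, hR', hi', hq', hpick', -, -⟩ := hT'.exists_e h0 h1 hr hε
    rw [he]
    have hcc : c' = c := by
      rcases hk.2.lt_or_eq with hkn | hkn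
      · have hi2 := (hR.atMinus_iff hkn).2 hi
        have hprof := hR.prof_eq hkn hi
        have e0 := hprof (k - 1)
        have e1 := hprof k
        have e2 := hprof (k + 1)
        rw [if_neg (by omega)] at e0 e2
        rw [if_pos rfl] at e1
        have l0 := hA'.loc k hk.1 hk.2
        have l1 := hA'.loc (k + 1) (by omega) (by omega)
        have l0' := hA.loc k hk.1 hk.2
        have l1' := hA.loc (k + 1) (by omega) (by omega)
        rw [add_sub_cancel_right, show n - ((k : ℤ) + 1) = n - k - 1 by ring] at l1 l1'
        have hii : i' = i := by
          refine minusPick_unique hr (by omega) l0' l1' (i := i) (j := i') ?_ ?_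
            (hi.plus (r := r) hF hk.2).1 ?_ ?_ ?_
          · rw [← e1, ← e0]; exact l0
          · rw [← e1, ← e2]; exact l1
          · rw [← e1, ← e0, ← e2]; exact (hi'.minus (r := r) hF' hk.2).1
          · rw [← e1, ← e0, ← e2]; exact hpick'
          · rw [← e1]; omega
        subst hii
        exact hi'.unique hF' hi2
      · have x0 := hA.nonneg (j := k) hk.1 hk.2
        have x1 := hA'.nonneg (j := k) hk.1 hk.2
        rw [hkn] at hi hi' hq' hp x0 x1
        rw [sub_self] at hq' hp
        have hE := hA.fin
        have hE' := hA'.fin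
        obtain ⟨z1, z2, -⟩ := hE
        obtain ⟨z3, z4, -⟩ := hE'
        cases i
        · cases i'
          · exact absurd hi'.2.2 (lt_irrefl _)
          · exact hi'.unique hF' (hR.atMinus_end_y.2 hi)
          · exact absurd hi'.2.2 (lt_irrefl _)
          · simp only [level] at hq' hp
            omega
        · exact absurd hi.2.2 (lt_irrefl _)
        · cases i'
          · exact absurd hi'.2.2 (lt_irrefl _)
          · have h5 := (hi.plus (r := r) hF le_rfl).1
            have h6 := (hA.loc n (by omega) le_rfl).v_nonneg
            simp only [level, Plus] at hq' hp h5
            omega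
          · exact absurd hi'.2.2 (lt_irrefl _)
          · exact hi'.unique hF' (hR.atMinus_end_w.2 hi)
        · exact absurd hi.2.2 (lt_irrefl _)
    subst hcc
    rw [hR'.left_unique hR]

end CrystalTypeC

namespace CrystalTypeC

/-! ### Crystals generated by a unique source -/

section generic

variable {n : ℤ} {B B' B'' : Type} {D : CrystalOps n B} {D' : CrystalOps n B'}
  {D'' : CrystalOps n B''} {S : Set B} {S' : Set B'} {S'' : Set B''}

theorem IsCrystalOn.mono {S₁ : Set B} (hS : IsCrystalOn D S) (h : S₁ ⊆ S)
    (he : ∀ i, ∀ b ∈ S₁, ∀ b', D.e i b = some b' → b' ∈ S₁)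
    (hf : ∀ i, ∀ b ∈ S₁, ∀ b', D.f i b = some b' → b' ∈ S₁) : IsCrystalOn D S₁ where
  e_mem := he
  f_mem := hf
  phi_eq i b hb := hS.phi_eq i b (h hb)
  e_wt i b hb := hS.e_wt i b (h hb)
  e_eps i b hb := hS.e_eps i b (h hb)
  e_phi i b hb := hS.e_phi i b (h hb)
  f_wt i b hb := hS.f_wt i b (h hb)
  f_eps i b hb := hS.f_eps i b (h hb)
  f_phi i b hb := hS.f_phi i b (h hb)
  e_iff_f i b hb b' hb' := hS.e_iff_f i b (h hb) b' (h hb')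

/-- All elements are reached from `b₀` by inverting a descent along `ẽ`, which gives that the image
lies in the generated set. Two elements with the same image can be descended along the same path
until both are `b₀`, which gives injectivity. Surjectivity is closure of the image under the
operators. -/
theorem isCrystalIso_of_source {b₀ : B} {ψ : B → B'} (hS : IsCrystalOn D S)
    (hS' : IsCrystalOn D' {b | Generated D' (ψ b₀) b}) (h₀ : b₀ ∈ S)
    (source : ∀ b ∈ S, (∀ i, D.e i b = none) → b = b₀) (μ : B → ℕ)
    (hμ : ∀ i, ∀ b ∈ S, ∀ b', D.e i b = some b' → μ b' < μ b)
    (wt_eq : ∀ b ∈ S, D'.wt (ψ b) = D.wt b)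
    (eps_eq : ∀ i, ∀ b ∈ S, D'.eps i (ψ b) = D.eps i b)
    (phi_eq : ∀ i, ∀ b ∈ S, D'.phi i (ψ b) = D.phi i b)
    (e_eq : ∀ i, ∀ b ∈ S, D'.e i (ψ b) = (D.e i b).map ψ)
    (f_eq : ∀ i, ∀ b ∈ S, D'.f i (ψ b) = (D.f i b).map ψ) :
    IsCrystalIso D D' S {b | Generated D' (ψ b₀) b} ψ := by
  refine ⟨hS, hS', ⟨?_, ?_, ?_⟩, wt_eq, eps_eq, phi_eq, e_eq, f_eq⟩
  · intro b hb
    induction hm : μ b using Nat.strong_induction_on generalizing b with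
    | _ m ih =>
      subst hm
      by_cases h : ∀ i, D.e i b = none
      · rw [source b hb h]; exact Generated.base
      · push Not at h
        obtain ⟨i, hi⟩ := h
        obtain ⟨b', hb'⟩ := Option.ne_none_iff_exists'.1 hi
        have hS1 := hS.e_mem i b hb b' hb'
        refine Generated.f_step i (ψ b') (ψ b) (ih _ (hμ i b hb b' hb') hS1 rfl) ?_
        rw [f_eq i b' hS1, (hS.e_iff_f i b hb b' hS1).1 hb']; rfl
  · intro b hb c hc hbc
    induction hm : μ b using Nat.strong_induction_on generalizing b c with
    | _ m ih =>
      subst hm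
      have key : ∀ i, (D.e i b).map ψ = (D.e i c).map ψ := fun i => by
        rw [← e_eq i b hb, ← e_eq i c hc, hbc]
      by_cases h : ∀ i, D.e i b = none
      · rw [source b hb h, source c hc fun i => ?_]
        have := key i
        rw [h i, Option.map_none, eq_comm, Option.map_eq_none_iff] at this
        exact this
      · push Not at h
        obtain ⟨i, hi⟩ := h
        obtain ⟨b', hb'⟩ := Option.ne_none_iff_exists'.1 hi
        have h1 := key i
        rw [hb', Option.map_some, eq_comm, Option.map_eq_some_iff] at h1
        obtain ⟨c', hc', hcb⟩ := h1
        have hS1 := hS.e_mem i b hb b' hb'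
        have hS2 := hS.e_mem i c hc c' hc'
        obtain rfl := ih _ (hμ i b hb b' hb') hS1 hS2 hcb.symm rfl
        have h2 := (hS.e_iff_f i b hb _ hS1).1 hb'
        have h3 := (hS.e_iff_f i c hc _ hS1).1 hc'
        exact Option.some_injective _ (h2.symm.trans h3)
  · intro c hc
    induction hc with
    | base => exact ⟨b₀, h₀, rfl⟩
    | e_step i c c' _ h ih =>
      obtain ⟨b, hb, rfl⟩ := ih
      rw [e_eq i b hb, Option.map_eq_some_iff] at h
      obtain ⟨b', hb', rfl⟩ := h
      exact ⟨b', hS.e_mem i b hb b' hb', rfl⟩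
    | f_step i c c' _ h ih =>
      obtain ⟨b, hb, rfl⟩ := ih
      rw [f_eq i b hb, Option.map_eq_some_iff] at h
      obtain ⟨b', hb', rfl⟩ := h
      exact ⟨b', hS.f_mem i b hb b' hb', rfl⟩

/-- The map between monomials has to be a total function, and it is obtained from the
parametrization by tableaux: invert one isomorphism on its source and apply the other. -/
theorem IsCrystalIso.exists_factor [Nonempty B] {ψ : B → B'} {χ : B → B''}
    (h : IsCrystalIso D D' S S' ψ) (h' : IsCrystalIso D D'' S S'' χ) :
    ∃ θ : B' → B'', (∀ b ∈ S, θ (ψ b) = χ b) ∧ IsCrystalIso D' D'' S' S'' θ := by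
  classical
  have key : ∀ b ∈ S, (χ ∘ Function.invFunOn ψ S) (ψ b) = χ b := fun b hb => by
    rw [Function.comp_apply, h.bijOn.injOn.leftInvOn_invFunOn hb]
  have hsurj := h.bijOn.surjOn
  have hmap : ∀ {o : Option B}, (∀ b, o = some b → b ∈ S) →
      Option.map χ o = Option.map (χ ∘ Function.invFunOn ψ S) (Option.map ψ o) := by
    intro o ho
    cases o with
    | none => rfl
    | some b => rw [Option.map_some, Option.map_some, Option.map_some, key b (ho b rfl)]
  refine ⟨χ ∘ Function.invFunOn ψ S, key, h.target, h'.target, ⟨?_, ?_, ?_⟩, ?_, ?_, ?_, ?_, ?_⟩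
  · intro c hc
    obtain ⟨b, hb, rfl⟩ := hsurj hc
    rw [key b hb]; exact h'.bijOn.mapsTo hb
  · intro c hc c' hc' hcc
    obtain ⟨b, hb, rfl⟩ := hsurj hc
    obtain ⟨b', hb', rfl⟩ := hsurj hc'
    rw [key b hb, key b' hb'] at hcc
    rw [h'.bijOn.injOn hb hb' hcc]
  · intro d hd
    obtain ⟨b, hb, rfl⟩ := h'.bijOn.surjOn hd
    exact ⟨ψ b, h.bijOn.mapsTo hb, key b hb⟩
  · intro c hc
    obtain ⟨b, hb, rfl⟩ := hsurj hc
    rw [key b hb, h'.wt_eq b hb, h.wt_eq b hb]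
  · intro i c hc
    obtain ⟨b, hb, rfl⟩ := hsurj hc
    rw [key b hb, h'.eps_eq i b hb, h.eps_eq i b hb]
  · intro i c hc
    obtain ⟨b, hb, rfl⟩ := hsurj hc
    rw [key b hb, h'.phi_eq i b hb, h.phi_eq i b hb]
  · intro i c hc
    obtain ⟨b, hb, rfl⟩ := hsurj hc
    rw [key b hb, h'.e_eq i b hb, h.e_eq i b hb, hmap (h.source.e_mem i b hb)]
  · intro i c hc
    obtain ⟨b, hb, rfl⟩ := hsurj hc
    rw [key b hb, h'.f_eq i b hb, h.f_eq i b hb, hmap (h.source.f_mem i b hb)]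

end generic

/-! ### The crystal of tableaux for `r ≥ 1` -/

variable {n ℓ h r : ℤ} {T T' : Tableau ℓ}

theorem isCrystalOn_component {m : Monomial n} (hm : m ∈ monomialSet n (coloring n ℓ)) :
    IsCrystalOn (monomialOps n) (component m) :=
  (isCrystalOn_monomialSet (isColoring_coloring n ℓ)).mono
    (component_subset (isColoring_coloring n ℓ) hm)
    (fun i b hb b' h => Generated.e_step i b b' hb h)
    (fun i b hb b' h => Generated.f_step i b b' hb h)

section

variable (hT : IsTableauC n ℓ h r T) (h0 : 0 ≤ h) (h1 : h ≤ ℓ) (hr : 1 ≤ r)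
include hT h0 h1 hr

theorem IsTableauC.f_map (k : Idx n) : (monomialOps n).f k (tabMonomial n ℓ h r T) =
    ((tableauOps n ℓ h r).f k T).map (tabMonomial n ℓ h r) := by
  by_cases hφ : phi k (tabMonomial n ℓ h r T) = 0
  · rw [tableau_f_eq_none hφ]
    simp [monomialOps, hφ]
  · obtain ⟨-, -, T', hf, -, -, -, -, -, -, hm⟩ := hT.exists_f h0 h1 hr hφ
    rw [hf, Option.map_some]
    exact monomial_f_eq_some.2 ⟨hφ, hm⟩

theorem IsTableauC.e_map (k : Idx n) : (monomialOps n).e k (tabMonomial n ℓ h r T) =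
    ((tableauOps n ℓ h r).e k T).map (tabMonomial n ℓ h r) := by
  by_cases hε : eps k (tabMonomial n ℓ h r T) = 0
  · rw [tableau_e_eq_none hε]
    simp [monomialOps, hε]
  · obtain ⟨-, -, T', hf, -, -, -, -, -, hm⟩ := hT.exists_e h0 h1 hr hε
    rw [hf, Option.map_some]
    exact monomial_e_eq_some.2 ⟨hε, hm⟩

theorem IsTableauC.f_isTableauC {k : Idx n} (hf : (tableauOps n ℓ h r).f k T = some T') :
    IsTableauC n ℓ h r T' ∧
      (monomialOps n).f k (tabMonomial n ℓ h r T) = some (tabMonomial n ℓ h r T') := by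
  refine ⟨?_, by rw [hT.f_map h0 h1 hr, hf]; rfl⟩
  have hφ : phi k (tabMonomial n ℓ h r T) ≠ 0 := fun hc => by
    rw [tableau_f_eq_none hc] at hf; cases hf
  obtain ⟨-, -, T'', hf', -, -, -, -, -, hT'', -⟩ := hT.exists_f h0 h1 hr hφ
  rwa [Option.some_injective _ (hf.symm.trans hf')]

theorem IsTableauC.e_isTableauC {k : Idx n} (he : (tableauOps n ℓ h r).e k T = some T') :
    IsTableauC n ℓ h r T' ∧ (∃ c, RaisedAt n c T' T) ∧
      (monomialOps n).e k (tabMonomial n ℓ h r T) = some (tabMonomial n ℓ h r T') := by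
  have hε : eps k (tabMonomial n ℓ h r T) ≠ 0 := fun hc => by
    rw [tableau_e_eq_none hc] at he; cases he
  obtain ⟨-, c, T'', hf', hR, -, -, -, hT'', -⟩ := hT.exists_e h0 h1 hr hε
  rw [Option.some_injective _ (he.symm.trans hf')]
  refine ⟨hT'', ⟨c, hR⟩, by rw [hT.e_map h0 h1 hr, hf']; rfl⟩

end

theorem isCrystalOn_tableauSet (h0 : 0 ≤ h) (h1 : h ≤ ℓ) (hr : 1 ≤ r) :
    IsCrystalOn (tableauOps n ℓ h r) (tableauSet n ℓ h r) := by
  have hC := isCrystalOn_monomialSet (isColoring_coloring n ℓ)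
  have hm : ∀ T ∈ tableauSet n ℓ h r, tabMonomial n ℓ h r T ∈ monomialSet n (coloring n ℓ) :=
    fun T hT => (IsTableauC.isFilling hT h0 h1).tabMonomial_mem r
  have hf := fun T (hT : T ∈ tableauSet n ℓ h r) k T' =>
    IsTableauC.f_isTableauC hT h0 h1 hr (k := k) (T' := T')
  have he := fun T (hT : T ∈ tableauSet n ℓ h r) k T' =>
    IsTableauC.e_isTableauC hT h0 h1 hr (k := k) (T' := T')
  exact {
    e_mem := fun k T hT T' h => (he T hT k T' h).1
    f_mem := fun k T hT T' h => (hf T hT k T' h).1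
    phi_eq := fun k T hT => hC.phi_eq k _ (hm T hT)
    e_wt := fun k T hT T' h => hC.e_wt k _ (hm T hT) _ (he T hT k T' h).2.2
    e_eps := fun k T hT T' h => hC.e_eps k _ (hm T hT) _ (he T hT k T' h).2.2
    e_phi := fun k T hT T' h => hC.e_phi k _ (hm T hT) _ (he T hT k T' h).2.2
    f_wt := fun k T hT T' h => hC.f_wt k _ (hm T hT) _ (hf T hT k T' h).2
    f_eps := fun k T hT T' h => hC.f_eps k _ (hm T hT) _ (hf T hT k T' h).2
    f_phi := fun k T hT T' h => hC.f_phi k _ (hm T hT) _ (hf T hT k T' h).2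
    e_iff_f := fun k T hT T' hT' => isTableauC_e_iff_f h0 h1 hr hT' hT k }

/-- The sum of the ranks of the entries. -/
noncomputable def rankSum (n : ℤ) (T : Tableau ℓ) : ℕ := (∑ a, (T a).rank n).toNat

theorem RaisedAt.rankSum_lt {c : Idx ℓ} (hR : RaisedAt n c T T') (hT : ∀ a, (T a).InB n) :
    rankSum n T < rankSum n T' := by
  have h1 : ∑ a, (T' a).rank n = ∑ a, (T a).rank n + 1 := by
    rw [← sub_eq_iff_eq_add', ← Finset.sum_sub_distrib, Finset.sum_eq_single c]
    · rw [hR.rank]; ring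
    · intro b _ hb
      rw [hR.eq b hb, sub_self]
    · simp
  have h2 : 0 ≤ ∑ a, (T a).rank n :=
    Finset.sum_nonneg fun a _ => by have := Letter.one_le_rank (hT a); omega
  unfold rankSum
  omega

end CrystalTypeC

namespace CrystalTypeC

/-! ### The highest weight tableau -/

open Quad

variable {n ℓ h r : ℤ} {T T' : Tableau ℓ}

/-- The tableau with entries `1, 2, …, ℓ`. -/
def highestTableau (ℓ : ℤ) : Tableau ℓ := fun a => .plain a

theorem isFilling_highestTableau (hℓ : ℓ ≤ n) (h0 : 0 ≤ h) (h1 : h ≤ ℓ) :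
    IsFilling n h (highestTableau ℓ) :=
  ⟨⟨fun a => ⟨a.2.1, a.2.2.trans hℓ⟩, fun _ _ hab _ => hab, fun _ _ hab _ => hab⟩, h0, h1⟩

theorem isTableauC_highestTableau (hℓ : ℓ ≤ n) : IsTableauC n ℓ h r (highestTableau ℓ) := by
  refine ⟨fun a => ⟨a.2.1, a.2.2.trans hℓ⟩, fun _ _ hab _ => hab, fun _ _ hab _ => hab, ?_, ?_, ?_,
    ?_, ?_⟩
  · rintro ⟨a, b, k, -, -, -, hb, -⟩; cases hb
  · rintro ⟨a, b, k, -, -, -, hb, -⟩; cases hb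
  · rintro ⟨a, b, k, -, -, -, hb, -⟩; cases hb
  · intro u v k hu hv _ huv
    have : (v : ℤ) ≤ u := huv
    omega
  · intro u v k hu hv hb; cases hb

theorem sum_idx_telescope {M : Type*} [AddCommGroup M] (G : ℤ → M) (hℓ : 0 ≤ ℓ) :
    ∑ a : Idx ℓ, (G a - G (a - 1)) = G ℓ - G 0 := by
  rw [← Finset.sum_subtype (Finset.Icc 1 ℓ) (by simp) (fun a : ℤ => G a - G (a - 1))]
  induction ℓ, hℓ using Int.leInduction with
  | base => simp
  | succ m hm ih =>
    have : Finset.Icc 1 (m + 1) = insert (m + 1) (Finset.Icc 1 m) := by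
      ext a; simp only [Finset.mem_Icc, Finset.mem_insert]; omega
    rw [this, Finset.sum_insert (by simp), ih, add_sub_cancel_right]
    abel

theorem Y_zero (n l : ℤ) : Y n 0 l = 0 := by
  unfold Y
  rw [dif_neg (by simp)]

theorem tabMonomial_highestTableau (h0 : 0 ≤ h) (h1 : h ≤ ℓ) :
    tabMonomial n ℓ h r (highestTableau ℓ) = highestMonomial n ℓ h r := by
  -- The boxes telescope within each column. The constant in the second branch adjusts `G` at the
  -- cut, where the suffix jumps by `2r` and leaves the two factors with index `h`.
  let G : ℤ → Monomial n := fun a => if a ≤ h then Y n a (ℓ - a) else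
    Y n h (ℓ - h) + Y n a (ℓ - a - 2 * r) - Y n h (ℓ - h - 2 * r)
  have key : ∀ a : Idx ℓ, box n (highestTableau ℓ a) (suffix ℓ h r a) = G a - G (a - 1) := by
    intro a
    simp only [highestTableau, box, suffix, G]
    by_cases ha : (a : ℤ) ≤ h
    · rw [if_pos ha, if_pos ha, if_pos (by omega)]
      congr 2 <;> ring
    · rw [if_neg ha, if_neg ha]
      by_cases ha' : (a : ℤ) = h + 1
      · rw [ha', add_sub_cancel_right, if_pos le_rfl,
          show ℓ + 1 - 2 * (h + 1) - 2 * r + (h + 1) - 1 = ℓ - (h + 1) - 2 * r by ring,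
          show ℓ + 1 - 2 * (h + 1) - 2 * r + (h + 1) = ℓ - h - 2 * r by ring]
        abel
      · rw [if_neg (by omega),
          show ℓ + 1 - 2 * (a : ℤ) - 2 * r + a - 1 = ℓ - a - 2 * r by ring,
          show ℓ + 1 - 2 * (a : ℤ) - 2 * r + a = ℓ - (a - 1) - 2 * r by ring]
        abel
  unfold tabMonomial
  rw [Finset.sum_congr rfl fun a _ => key a, sum_idx_telescope G (h0.trans h1)]
  simp only [G]
  rw [if_pos h0, Y_zero, sub_zero]
  unfold highestMonomial
  by_cases hh : ℓ ≤ h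
  · rw [if_pos hh, show h = ℓ by omega, sub_self, zero_sub, show -(2 * r) = -2 * r by ring]
    abel
  · rw [if_neg hh, sub_self, zero_sub, show -(2 * r) = -2 * r by ring]
    abel

theorem highestMonomial_mem (hℓ : ℓ ≤ n) (h0 : 0 ≤ h) (h1 : h ≤ ℓ) :
    highestMonomial n ℓ h r ∈ monomialSet n (coloring n ℓ) := by
  rw [← tabMonomial_highestTableau h0 h1]
  exact (isFilling_highestTableau hℓ h0 h1).tabMonomial_mem r

/-! ### A filling is determined by its profile -/

theorem IsFilling.ext_col (hT : IsFilling n h T) (hT' : IsFilling n h T')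
    (h1 : ∀ s, 0 ≤ s → s ≤ 2 * n → colOne n h T s = colOne n h T' s)
    (h2 : ∀ s, 0 ≤ s → s ≤ 2 * n → colTwo n h T s = colTwo n h T' s) : T = T' := by
  have key : ∀ {T T' : Tableau ℓ}, IsFilling n h T → IsFilling n h T' →
      (∀ s, 0 ≤ s → s ≤ 2 * n → colOne n h T s = colOne n h T' s) →
      (∀ s, 0 ≤ s → s ≤ 2 * n → colTwo n h T s = colTwo n h T' s) → ∀ a,
      (T' a).rank n ≤ (T a).rank n := by
    intro T T' hT hT' h1 h2 a
    have r1 := Letter.one_le_rank (hT.mem a)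
    have r2 := Letter.rank_le (hT.mem a)
    have r3 := Letter.rank_le (hT'.mem a)
    by_contra hc
    by_cases ha : (a : ℤ) ≤ h
    · have e1 := hT.colOne_rank hT.h_le ha
      have e2 := hT'.colOne_rank_sub_one hT.h_le ha
      have := colOne_antitone n h T' (show (T a).rank n ≤ (T' a).rank n - 1 by omega)
      rw [h1 _ (by omega) r2] at e1
      omega
    · have e1 := hT.colTwo_rank hT.h_nonneg (not_le.1 ha)
      have e2 := hT'.colTwo_rank_sub_one hT.h_nonneg (not_le.1 ha)
      have := colTwo_mono n h T' (show (T a).rank n ≤ (T' a).rank n - 1 by omega)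
      rw [h2 _ (by omega) r2] at e1
      omega
  funext a
  exact Letter.ext_rank (hT.mem a) (hT'.mem a) (le_antisymm
    (key hT' hT (fun s a b => (h1 s a b).symm) (fun s a b => (h2 s a b).symm) a)
    (key hT hT' h1 h2 a))

theorem IsFilling.ext_prof (hT : IsFilling n h T) (hT' : IsFilling n h T')
    (hp : ∀ j, 0 ≤ j → j ≤ n → prof n h T j = prof n h T' j) : T = T' := by
  refine hT.ext_col hT' (fun s h0 h2 => ?_) (fun s h0 h2 => ?_)
  · by_cases hs : s ≤ n
    · have := congrArg Quad.x (hp s h0 hs)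
      rwa [prof_of_le hs, prof_of_le hs] at this
    · have := congrArg Quad.y (hp (2 * n - s) (by omega) (by omega))
      rw [prof_of_le (by omega), prof_of_le (by omega)] at this
      dsimp only at this
      rwa [sub_sub_cancel] at this
  · by_cases hs : s ≤ n
    · have := congrArg Quad.v (hp s h0 hs)
      rwa [prof_of_le hs, prof_of_le hs] at this
    · have := congrArg Quad.w (hp (2 * n - s) (by omega) (by omega))
      rw [prof_of_le (by omega), prof_of_le (by omega)] at this
      dsimp only at this
      rwa [sub_sub_cancel] at this

theorem IsFilling.colOne_zero (hT : IsFilling n h T) {s : ℤ} (hs : s ≤ 0) :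
    colOne n h T s = h := by
  have h0 := hT.h_nonneg
  have e := sum_idx_interval (ℓ := ℓ) (p := 1) (q := h) le_rfl hT.h_le (by omega)
  rw [show h - 1 + 1 = h by ring] at e
  refine Eq.trans (Finset.sum_congr rfl fun a _ => if_congr ?_ rfl rfl) e
  have := a.2.1
  have := Letter.one_le_rank (hT.mem a)
  omega

theorem IsFilling.colOne_two_mul (hT : IsFilling n h T) {s : ℤ} (hs : 2 * n ≤ s) :
    colOne n h T s = 0 := by
  refine Finset.sum_eq_zero fun a _ => if_neg ?_
  have := Letter.rank_le (hT.mem a)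
  omega

theorem colTwo_self (n : ℤ) (T : Tableau ℓ) (s : ℤ) : colTwo n ℓ T s = 0 := by
  refine Finset.sum_eq_zero fun a _ => if_neg ?_
  have := a.2.2
  omega

/-! ### Uniqueness of the source for a single column -/

/-- With `f` counting the letters of rank greater than `s`, a drop at `s` means that the rank `s` is
present. Going down from `s` through present ranks one arrives either at rank 1 or at an absent rank
`t`. -/
theorem exists_start_of_drop {f : ℤ → ℤ} (hf : ∀ s, f (s - 1) = f s ∨ f (s - 1) = f s + 1)
    {s : ℤ} (hs : 0 ≤ s) :
    f 0 = f s + s ∨ ∃ t, 1 ≤ t ∧ t ≤ s ∧ f (t - 1) = f t ∧ f t = f s + (s - t) := by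
  induction s, hs using Int.leInduction with
  | base => left; ring
  | succ m hm ih =>
    have h1 := hf (m + 1)
    rw [add_sub_cancel_right] at h1
    rcases h1 with h1 | h1
    · exact Or.inr ⟨m + 1, by omega, le_rfl, by rw [add_sub_cancel_right, h1], by ring⟩
    · rcases ih with h2 | ⟨t, h2, h3, h4, h5⟩
      · left; omega
      · exact Or.inr ⟨t, h2, by omega, h4, by omega⟩

/-- If an absent rank is never followed by a present one, then the ranks that occur are an initial
segment, necessarily `1, …, ℓ`. -/
theorem eq_max_of_no_start {f : ℤ → ℤ} {N : ℤ}
    (hf : ∀ s, f (s - 1) = f s ∨ f (s - 1) = f s + 1) (h0 : f 0 = ℓ) (hN : f (2 * N) = 0)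
    (hl : 0 ≤ ℓ) (hlN : ℓ ≤ 2 * N)
    (hs : ∀ s, 1 ≤ s → s < 2 * N → f (s - 1) = f s → f (s + 1) = f s) :
    ∀ s, 0 ≤ s → s ≤ 2 * N → f s = max (ℓ - s) 0 := by
  have hconst : ∀ s, 1 ≤ s → s ≤ 2 * N → f (s - 1) = f s → ∀ t, s ≤ t → t ≤ 2 * N → f t = f s := by
    intro s h1 h2 h3 t ht
    have key : ∀ t, s ≤ t → t ≤ 2 * N → f t = f s ∧ f (t - 1) = f t := by
      intro t ht
      induction t, ht using Int.leInduction with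
      | base => exact fun _ => ⟨rfl, h3⟩
      | succ m hm ih =>
        intro hm2
        obtain ⟨i1, i2⟩ := ih (by omega)
        have := hs m (by omega) (by omega) i2
        rw [add_sub_cancel_right]
        omega
    exact fun ht2 => (key t ht ht2).1
  intro s h1 h2
  rcases exists_start_of_drop hf h1 with h3 | ⟨t, h3, h4, h5, h6⟩
  · by_cases hsl : s ≤ ℓ
    · rw [max_eq_left (by omega)]; omega
    · exfalso
      rcases exists_start_of_drop hf (show 0 ≤ 2 * N by omega) with h4 | ⟨t, h4, h5, h6, h7⟩
      · have : ∀ t, 0 ≤ t → t ≤ 2 * N → 0 ≤ f t := by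
          intro t ht ht2
          induction t, ht2 using Int.leInductionDown with
          | base => omega
          | pred m hm ih => have := hf m; have := ih (by omega); omega
        have := this s h1 h2
        omega
      · have := hconst t h4 h5 h6 (2 * N) h5 le_rfl
        have : ∀ t, 0 ≤ t → t ≤ 2 * N → 0 ≤ f t := by
          intro t ht ht2
          induction t, ht2 using Int.leInductionDown with
          | base => omega
          | pred m hm ih => have := hf m; have := ih (by omega); omega
        have := this s h1 h2
        omega
  · have e1 := hconst t h3 (by omega) h5 (2 * N) (by omega) le_rfl
    have e2 := hconst t h3 (by omega) h5 s h4 h2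
    have : f 0 ≤ f s + s := by
      have : ∀ t, 0 ≤ t → f 0 ≤ f t + t := by
        intro t ht
        induction t, ht using Int.leInduction with
        | base => omega
        | succ m hm ih => have := hf (m + 1); rw [add_sub_cancel_right] at this; omega
      exact this s h1
    rw [max_eq_right (by omega)]
    omega

/-- Call `s` a start if the rank `s` is absent and `s + 1` is present. A start gives a factor with
exponent `-1`, which `ε_k = 0` forces to be compensated by the other path at the same `k`. The run
that ends there has a start with a larger value of `2 f(s) + s`, so a start that maximizes this
value cannot exist. -/
theorem eq_highestTableau_of_eps (hℓ : ℓ ≤ n) (hT : IsFilling n ℓ T)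
    (hε : ∀ k, eps k (tabMonomial n ℓ ℓ r T) = 0) : T = highestTableau ℓ := by
  have hl0 := hT.h_nonneg
  obtain ⟨f, hf⟩ : ∃ f, f = colOne n ℓ T := ⟨_, rfl⟩
  have hstep : ∀ s, f (s - 1) = f s ∨ f (s - 1) = f s + 1 := fun s => hf ▸ hT.colOne_sub_one s
  have hf0 : f 0 = ℓ := hf ▸ hT.colOne_zero le_rfl
  have hfN : f (2 * n) = 0 := hf ▸ hT.colOne_two_mul le_rfl
  have hpos : ∀ s, 0 ≤ f s := fun s => hf ▸ colOne_nonneg n ℓ T s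
  -- The condition `ε_k = 0` bounds every partial sum by the total. Evaluated just below the level
  -- of the negative factor, it says that the mirror rank `2n - s` contributes exponent `1` at the
  -- same level or above; the inequality compares these levels.
  have hlocal : ∀ s, 1 ≤ s → s < 2 * n → f (s - 1) = f s → f (s + 1) = f s - 1 →
      f (2 * n - s - 1) = f (2 * n - s) + 1 ∧
      2 * f s + s ≤ 2 * f (2 * n - s) + (2 * n - s) := by
    intro s h1 h2 h3 h4
    have main : ∀ k : ℤ, 1 ≤ k → k ≤ n → ∀ a, height n ℓ r T k a ≤
        expo (prof n ℓ T (k - 1)) (prof n ℓ T k) (prof n ℓ T (k + 1)) .x +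
        expo (prof n ℓ T (k - 1)) (prof n ℓ T k) (prof n ℓ T (k + 1)) .y := by
      intro k hk1 hk2 a
      have e1 := hε ⟨k, hk1, hk2⟩
      rw [eps_eq, hT.tabMonomial_apply, totalSum_exponents] at e1
      have e2 := hT.height_le_phi r ⟨k, hk1, hk2⟩ a
      have e3 : expo (prof n ℓ T (k - 1)) (prof n ℓ T k) (prof n ℓ T (k + 1)) .v = 0 := by
        simp only [expo, prof, colTwo_self]; ring
      have e4 : expo (prof n ℓ T (k - 1)) (prof n ℓ T k) (prof n ℓ T (k + 1)) .w = 0 := by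
        simp only [expo, prof, colTwo_self]; ring
      dsimp only at e1 e2
      omega
    have hexp : ∀ k a : ℤ, k < n → height n ℓ r T k a =
        ramp (f (k - 1) - f k - (f k - f (k + 1))) (f k) a +
        ramp (f (2 * n - k - 1) - f (2 * n - k) - (f (2 * n - k) - f (2 * n - k + 1)))
          (n - k + f (2 * n - k)) a := by
      intro k a hk
      unfold height psum
      rw [prof_of_le (by omega), prof_of_le (by omega), prof_of_le (by omega), hf]
      simp only [expo, level, colTwo_self, ramp, sub_self, ite_self, add_zero]
      rw [show 2 * n - (k + 1) = 2 * n - k - 1 by ring,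
        show 2 * n - (k - 1) = 2 * n - k + 1 by ring]
      rfl
    have htot : ∀ k : ℤ, k < n →
        expo (prof n ℓ T (k - 1)) (prof n ℓ T k) (prof n ℓ T (k + 1)) .x +
        expo (prof n ℓ T (k - 1)) (prof n ℓ T k) (prof n ℓ T (k + 1)) .y =
        (f (k - 1) - f k - (f k - f (k + 1))) +
        (f (2 * n - k - 1) - f (2 * n - k) - (f (2 * n - k) - f (2 * n - k + 1))) := by
      intro k hk
      rw [prof_of_le (by omega), prof_of_le (by omega), prof_of_le (by omega), hf]
      simp only [expo]
      rw [show 2 * n - (k + 1) = 2 * n - k - 1 by ring,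
        show 2 * n - (k - 1) = 2 * n - k + 1 by ring]
    rcases lt_trichotomy s n with hs | hs | hs
    · have e1 := main s h1 hs.le (f s - 1)
      rw [hexp s _ hs, htot s hs] at e1
      have o1 := hstep (2 * n - s)
      have o2 := hstep (2 * n - s + 1)
      rw [add_sub_cancel_right] at o2
      unfold ramp at e1
      split_ifs at e1 <;> omega
    · exfalso
      subst hs
      have e1 := main s h1 le_rfl (f s - 1)
      unfold height psum at e1
      rw [prof_succ_self, prof_of_le le_rfl, prof_of_le (by omega)] at e1
      simp only [expo, level, colTwo_self, ramp, sub_self, ite_self, add_zero] at e1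
      rw [show 2 * s - s = s by ring, show 2 * s - (s - 1) = s + 1 by ring, ← hf] at e1
      split_ifs at e1 <;> omega
    · have e1 := main (2 * n - s) (by omega) (by omega) (n - (2 * n - s) + f s - 1)
      rw [hexp _ _ (by omega), htot _ (by omega), sub_sub_cancel] at e1
      have o1 := hstep (2 * n - s)
      have o2 := hstep (2 * n - s + 1)
      rw [add_sub_cancel_right] at o2
      unfold ramp at e1
      split_ifs at e1 <;> omega
  have hno : ∀ s, 1 ≤ s → s < 2 * n → f (s - 1) = f s → f (s + 1) = f s := by
    by_contra hc
    push Not at hc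
    obtain ⟨s₀, hs0, hs1, hs2, hs3⟩ := hc
    obtain ⟨s, hs, hmax⟩ := Finset.exists_max_image ((Finset.Icc 1 (2 * n - 1)).filter
      fun s => f (s - 1) = f s ∧ f (s + 1) ≠ f s) (fun s => 2 * f s + s)
      ⟨s₀, by simp only [Finset.mem_filter, Finset.mem_Icc]; omega⟩
    simp only [Finset.mem_filter, Finset.mem_Icc] at hs hmax
    have o1 := hstep (s + 1)
    rw [add_sub_cancel_right] at o1
    obtain ⟨i1, i2⟩ := hlocal s hs.1.1 (by omega) hs.2.1 (by omega)
    rcases exists_start_of_drop hstep (show 0 ≤ 2 * n - s - 1 by omega) with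
      h3 | ⟨t, h3, h4, h5, h6⟩
    -- Here all ranks up to `2n - s` are present, so `f (2n - s) = ℓ - (2n - s)`. With `ℓ ≤ n` the
    -- inequality of levels gives `f s ≤ 0`, although `s + 1` is present.
    · have := hpos (s + 1)
      omega
    · have hm := hmax t
      have hcon : f (t + 1) ≠ f t := by
        rcases h4.lt_or_eq with h7 | h7
        · intro h8
          have : ∀ u, t + 1 ≤ u → f u + (u - (t + 1)) ≥ f (t + 1) := by
            intro u hu
            induction u, hu using Int.leInduction with
            | base => omega
            | succ m hm ih => have := hstep (m + 1); rw [add_sub_cancel_right] at this; omega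
          have := this (2 * n - s - 1) (by omega)
          omega
        · rw [h7, sub_add_cancel]; omega
      have := hm ⟨⟨h3, by omega⟩, h5, hcon⟩
      omega
  have hall := eq_max_of_no_start hstep hf0 hfN hl0 (by omega) hno
  refine hT.ext_col (isFilling_highestTableau hℓ hl0 le_rfl) (fun s h1 h2 => ?_) fun s _ _ => by
    rw [colTwo_self, colTwo_self]
  have hT0 := isFilling_highestTableau (h := ℓ) hℓ hl0 le_rfl
  rw [← hf, hall s h1 h2]
  by_cases hs : s ≤ ℓ
  · rw [max_eq_left (by omega)]
    rcases h1.eq_or_lt with h3 | h3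
    · rw [← h3, hT0.colOne_zero le_rfl]; ring
    · exact (hT0.colOne_rank le_rfl (a := ⟨s, by omega, hs⟩) hs).symm
  · rw [max_eq_right (by omega), eq_comm]
    refine Finset.sum_eq_zero fun a _ => if_neg ?_
    have := a.2.2
    rintro ⟨-, h4⟩
    have h5 : s < (a : ℤ) := h4
    omega

end CrystalTypeC

namespace CrystalTypeC

/-! ### The states that describe the effect of `τ` on profiles -/

open Quad

/-- The two paths that keep their counts when the columns are cut one position later. -/
inductive Cut
  | vy
  | wy
  | xy
  | vx
  | vw

namespace Cut

/-- The new quadruple. -/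
def shift : Cut → Quad → Quad
  | vy, q => ⟨q.x + 1, q.y, q.v, q.w - 1⟩
  | wy, q => ⟨q.x + 1, q.y, q.v - 1, q.w⟩
  | xy, q => ⟨q.x, q.y, q.v - 1, q.w - 1⟩
  | vx, q => ⟨q.x, q.y + 1, q.v, q.w - 1⟩
  | vw, q => ⟨q.x + 1, q.y + 1, q.v, q.w⟩

/-- The quadruples at which a state is possible. -/
def Inv (r m : ℤ) : Cut → Quad → Prop
  | vy, q => q.v = 0 ∧ q.y = 0 ∧ 0 < q.w
  | wy, q => 0 < q.v ∧ q.y = 0 ∧ 1 ≤ m - q.w ∧ m - r - q.w ≤ -1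
  | xy, q => 0 < q.v ∧ q.x = 0 ∧ q.y = 0
  | vx, q => q.v = 0 ∧ 0 < q.x ∧ 0 < q.w ∧ m + 1 - r ≤ q.x ∧ q.x ≤ m - 1
  | vw, q => q.v = 0 ∧ q.w = 0

/-- The possible changes of the state. -/
def Trans (r m : ℤ) (p q : Quad) : Cut → Cut → Prop
  | vy, vy => True
  | vy, wy => p.w = q.w + 1
  | vy, xy => ¬ (p.w = q.w + 1 ∧ 1 ≤ m - q.w ∧ m - r - q.w ≤ -1)
  | wy, wy => p.w = q.w + 1
  | wy, xy => p.w = q.w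
  | xy, xy => True
  | vx, vx => p.x = q.x + 1
  | vy, vx => p.x = q.x
  | vx, vw => p.x = q.x + 1
  | vy, vw => ¬ (p.x = q.x + 1 ∧ q.x ≤ m - 1 ∧ m - r - q.x ≤ -1)
  | vw, vw => True
  | _, _ => False

/-- A step of the sequence of states. -/
structure Step (r m : ℤ) (a b : Cut) (p q : Quad) : Prop where
  left : a.Inv r (m + 1) p
  right : b.Inv r m q
  trans : Trans r m p q a b

end Cut

/-- The vertex chosen by `f̃`. -/
structure Chosen (r m : ℤ) (p q s : Quad) (i : Vertex) : Prop where
  peak : Peak (psum r m p q s) (level r m q i)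
  plus : Plus p q s i
  pick : PlusPick r m p q s i

end CrystalTypeC

/-! ### Raising a quadruple before and after the change of the columns -/

namespace CrystalTypeC
open Quad
variable {r m : ℤ} {p q s : Quad}

/-- The possible choices of `f̃` before and after the change of the columns, with the new state. -/
def Cut.next : Cut → Cut → Cut → Vertex → Vertex → Option Cut
  | .vw, .vw, .vw, .x, .x => some .vw
  | .vw, .vw, .vw, .y, .y => some .vw
  | .vx, .vw, .vw, .y, .y => some .vw
  | .vx, .vx, .vw, .w, .x => some .vw
  | .vx, .vx, .vw, .y, .y => some .vx
  | .vx, .vx, .vx, .w, .w => some .vx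
  | .vx, .vx, .vx, .y, .y => some .vx
  | .vy, .vw, .vw, .x, .x => some .vw
  | .vy, .vx, .vw, .w, .x => some .vw
  | .vy, .vx, .vx, .w, .w => some .vx
  | .vy, .vy, .vw, .w, .y => some .vw
  | .vy, .vy, .vw, .x, .x => some .vy
  | .vy, .vy, .vw, .x, .y => some .vx
  | .vy, .vy, .vx, .w, .w => some .vy
  | .vy, .vy, .vx, .x, .y => some .vx
  | .vy, .vy, .vy, .w, .w => some .vy
  | .vy, .vy, .vy, .x, .x => some .vy
  | .vy, .vy, .wy, .x, .x => some .vy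
  | .vy, .vy, .xy, .w, .w => some .vy
  | .vy, .wy, .wy, .v, .w => some .vy
  | .vy, .wy, .wy, .x, .x => some .wy
  | .vy, .wy, .xy, .v, .w => some .vy
  | .vy, .xy, .xy, .v, .x => some .vy
  | .vy, .xy, .xy, .w, .w => some .xy
  | .vy, .xy, .xy, .w, .x => some .wy
  | .wy, .wy, .wy, .v, .v => some .wy
  | .wy, .wy, .wy, .x, .x => some .wy
  | .wy, .wy, .xy, .v, .v => some .wy
  | .wy, .xy, .xy, .v, .v => some .xy
  | .wy, .xy, .xy, .w, .x => some .wy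
  | .xy, .xy, .xy, .v, .v => some .xy
  | .xy, .xy, .xy, .w, .w => some .xy
  | _, _, _, _, _ => none

-- The square that makes `τ` commute with `f̃_k`: both moves stay related by a state at `k`, with
-- the neighboring states unchanged. The paths moved on the two sides may differ, for instance `w`
-- before and `x` after; the state at `k` changes to account for this. The table `Cut.next` supplies
-- the new state as an explicit witness.
set_option maxHeartbeats 0 in
theorem Cut.exists_next (hr : 1 ≤ r) (hm : 1 ≤ m) (h0 : Loc r m p q) (h1 : Loc r (m - 1) q s) {a b c : Cut}
   (s0 : Cut.Step r m a b p q) (s1 : Cut.Step r (m-1) b c q s) {i i' : Vertex}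
   (hi : Chosen r m p q s i) (hi' : Chosen r m (a.shift p) (b.shift q) (c.shift s) i') :
   ∃ b', Cut.next a b c i i' = some b' ∧
      b'.shift (raise q i) = raise (b.shift q) i' ∧
      Cut.Step r m a b' p (raise q i) ∧ Cut.Step r (m - 1) b' c (raise q i) s := by
  obtain ⟨a1,a2,a3,a4,a5,a6,a7,a8,a9,a10,a11,a12,a13,a14,a15,a16⟩ := h0
  obtain ⟨b1,b2,b3,b4,b5,b6,b7,b8,b9,b10,b11,b12,b13,b14,b15,b16⟩ := h1
  obtain ⟨-, t1, t2⟩ := s1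
  obtain ⟨u1, u2, u3⟩ := s0
  obtain ⟨⟨e1, e2, e3⟩, e4, e5⟩ := hi
  obtain ⟨⟨f1, f2, f3⟩, f4, f5⟩ := hi'
  have g1 := e3 (level r m q .x)
  have g2 := e3 (level r m q .y)
  have g3 := e3 (level r m q .v)
  have g4 := e3 (level r m q .w)
  have g5 := fun h => e2 (level r m q .x) h
  have g6 := fun h => e2 (level r m q .y) h
  have g7 := fun h => e2 (level r m q .v) h
  have g8 := fun h => e2 (level r m q .w) h
  have k1 := f3 (level r m (b.shift q) .x)
  have k2 := f3 (level r m (b.shift q) .y)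
  have k3 := f3 (level r m (b.shift q) .v)
  have k4 := f3 (level r m (b.shift q) .w)
  have k5 := fun h => f2 (level r m (b.shift q) .x) h
  have k6 := fun h => f2 (level r m (b.shift q) .y) h
  have k7 := fun h => f2 (level r m (b.shift q) .v) h
  have k8 := fun h => f2 (level r m (b.shift q) .w) h
  clear e2 e3 f2 f3
  simp only [psum, ramp, expo, level] at g1 g2 g3 g4 g5 g6 g7 g8
  cases a <;> cases b <;> first | exact u3.elim | skip
  all_goals cases c <;> first | exact t2.elim | skip
  all_goals simp only [Cut.Inv, Cut.Trans] at u1 u2 u3 t1 t2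
  all_goals simp only [psum, ramp, expo, level, Cut.shift] at k1 k2 k3 k4 k5 k6 k7 k8
  all_goals cases i <;> simp only [Plus, PlusPick, level] at e4 e5
  all_goals try (exfalso; clear a12 a13 a14 a15 a16 b12 b13 b14 b15 b16 g1 g2 g3 g4 g5 g6 g7 g8 k1 k2 k3 k4 k5 k6 k7 k8 e1 f1 e5 f5; clear f4; omega)
  all_goals cases i' <;> simp only [Plus, PlusPick, Cut.shift, level] at f4 f5
  all_goals try (exfalso; clear a12 a13 a14 a15 a16 b12 b13 b14 b15 b16 g1 g2 g3 g4 g5 g6 g7 g8 k1 k2 k3 k4 k5 k6 k7 k8 e1 f1 e5 f5; omega)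
  -- In the combinations that the table does not list, `rfl` fails and the case has to be
  -- contradictory: the two peaks cannot lie on these paths simultaneously.
  all_goals
    first | refine ⟨_, rfl, ?_, ⟨?_, ?_, ?_⟩, ⟨?_, ?_, ?_⟩⟩ | exfalso
  all_goals try first | exact u1 | exact t2
  all_goals simp only [psum, ramp, expo, level, Cut.Inv, Cut.Trans, Cut.shift, raise]
    at e1 f1 ⊢
  all_goals try
    clear a12 a13 a14 a15 a16 b12 b13 b14 b15 b16 g1 g2 g3 g4 g5 g6 g7 g8 k1 k2 k3 k4 k5 k6 k7 k8
    clear e1 f1 e5 f5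
    omega
  all_goals dsimp only at g5 g6 g7 g8 k5 k6 k7 k8
  all_goals grind (splits := 40)

end CrystalTypeC

/-! ### Admissibility and existence of a raise under the change of the columns -/

namespace CrystalTypeC
open Quad
variable {r m : ℤ} {p q s : Quad}

/-- The inequalities between the counts of one column are assumed separately because they hold
automatically for the profile of an actual filling. The invariants and transition rules of the
states then supply what `Loc` requires. -/
theorem Cut.Step.loc (hr : 1 ≤ r) {a b : Cut} (hs : Cut.Step r m a b p q)
    (h : Loc r m p q) (hx : (b.shift q).y ≤ (b.shift q).x) (hv : (b.shift q).v ≤ (b.shift q).w)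
    (hv' : (a.shift p).v ≤ (a.shift p).w) (hx' : (a.shift p).y ≤ (a.shift p).x) :
    Loc r m (a.shift p) (b.shift q) := by
  obtain ⟨a1,a2,a3,a4,a5,a6,a7,a8,a9,a10,a11,a12,a13,a14,a15,a16⟩ := h
  obtain ⟨u1, u2, u3⟩ := hs
  cases a <;> cases b <;> first | exact u3.elim | skip
  all_goals simp only [Cut.Inv, Cut.Trans, Cut.shift] at u1 u2 u3 hx hv hx' hv'
  all_goals simp only [Cut.shift]
  all_goals
    refine ⟨?_, ?_, ?_, ?_, ?_, ?_, ?_, ?_, ?_, ?_, ?_, ?_, ?_, ?_, ?_, ?_⟩ <;> dsimp only <;>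
      grind (splits := 40)

/-- At `n` one has `v = w`, which excludes `vy`; the bounds in the invariants of `wy` and `vx`
cannot hold for `m = 0`. -/
theorem Cut.Step.eq_or_eq_of_end {a b : Cut} (h0 : Loc r 0 p q) (he : End q)
    (s0 : Cut.Step r 0 a b p q) : b = .xy ∨ b = .vw := by
  obtain ⟨-, u2, -⟩ := s0
  obtain ⟨hxy, hvw, hmid⟩ := he
  have := h0.x_nonneg
  have := h0.w_nonneg
  cases b <;> simp only [Cut.Inv] at u2 <;> first | (left; rfl) | (right; rfl) | (exfalso; omega)

theorem Cut.Step.end_shift {a b : Cut} (h0 : Loc r 0 p q) (he : End q)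
    (s0 : Cut.Step r 0 a b p q) : End (b.shift q) := by
  have hb := s0.eq_or_eq_of_end h0 he
  have u2 := s0.right
  obtain ⟨hxy, hvw, hmid⟩ := he
  obtain rfl | rfl := hb <;> simp only [Cut.Inv] at u2 <;>
    refine ⟨?_, ?_, ?_⟩ <;> simp only [Cut.shift] <;> omega

/-- The effect of `f̃_n`. -/
def raiseEnd (q : Quad) : Vertex → Quad
  | .x => (raise q .x).raise .y
  | .y => (raise q .x).raise .y
  | .v => (raise q .v).raise .w
  | .w => (raise q .v).raise .w

/-- Only `xy` and `vw` are possible at `n`, and each move for `k = n` changes both paths of a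
column, so it suffices to try these two states. -/
theorem Cut.exists_next_end (hr : 1 ≤ r) (h0 : Loc r 0 p q) (he : End q) {a b : Cut}
    (s0 : Cut.Step r 0 a b p q) {i i' : Vertex} (hi : Chosen r 0 p q q i)
    (hi' : Chosen r 0 (a.shift p) (b.shift q) (b.shift q) i') :
    ∃ b' : Cut, b'.shift (raiseEnd q i) = raiseEnd (b.shift q) i' ∧
      Cut.Step r 0 a b' p (raiseEnd q i) := by
  have hb := s0.eq_or_eq_of_end h0 he
  obtain ⟨u1, u2, u3⟩ := s0
  obtain ⟨a1,a2,a3,a4,a5,a6,a7,a8,a9,a10,a11,a12,a13,a14,a15,a16⟩ := h0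
  obtain ⟨hxy, hvw, hmid⟩ := he
  obtain ⟨⟨e1, e2, e3⟩, e4, e5⟩ := hi
  obtain ⟨⟨f1, f2, f3⟩, f4, f5⟩ := hi'
  have g1 := e3 (level r 0 q .x)
  have g3 := e3 (level r 0 q .v)
  have g5 := fun h => e2 (level r 0 q .x) h
  have g7 := fun h => e2 (level r 0 q .v) h
  clear e2 e3 f2 f3
  obtain rfl | rfl := hb <;> cases a <;> first | exact u3.elim | skip
  all_goals simp only [Cut.Inv, Cut.Trans] at u1 u2 u3
  all_goals cases i <;> simp only [Plus, PlusPick, level] at e4 e5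
  all_goals try (exfalso; omega)
  all_goals cases i' <;> simp only [Plus, PlusPick, level, Cut.shift] at f4 f5
  all_goals try (exfalso; omega)
  all_goals simp only [psum, ramp, expo, level, Cut.shift] at e1 f1 g1 g3 g5 g7
  all_goals
    first
      | (exfalso; grind (splits := 40))
      | (refine ⟨.vw, ?_, ⟨?_, ?_, ?_⟩⟩ <;>
          simp only [raiseEnd, raise, Cut.shift, Cut.Inv, Cut.Trans] <;> grind (splits := 40))
      | (refine ⟨.xy, ?_, ⟨?_, ?_, ?_⟩⟩ <;>
          simp only [raiseEnd, raise, Cut.shift, Cut.Inv, Cut.Trans] <;> grind (splits := 40))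

/-- If `f̃_n` is defined, then it is defined after the change of the columns. -/
theorem Cut.not_chosen_of_shift_nonpos_end (hr : 1 ≤ r) (h0 : Loc r 0 p q) (he : End q)
    {a b : Cut} (s0 : Cut.Step r 0 a b p q) {i : Vertex}
    (hi : Chosen r 0 p q q i)
    (hi' : ∀ L, psum r 0 (a.shift p) (b.shift q) (b.shift q) L ≤ 0) : False := by
  have hb := s0.eq_or_eq_of_end h0 he
  obtain ⟨u1, u2, u3⟩ := s0
  obtain ⟨a1,a2,a3,a4,a5,a6,a7,a8,a9,a10,a11,a12,a13,a14,a15,a16⟩ := h0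
  obtain ⟨hxy, hvw, hmid⟩ := he
  obtain ⟨⟨e1, -, -⟩, e4, e5⟩ := hi
  have k1 := hi' (level r 0 (b.shift q) .x)
  have k3 := hi' (level r 0 (b.shift q) .v)
  clear hi'
  obtain rfl | rfl := hb <;> cases a <;> first | exact u3.elim | skip
  all_goals simp only [Cut.Inv, Cut.Trans] at u1 u2 u3
  all_goals cases i <;> simp only [Plus, PlusPick, level] at e4 e5
  all_goals try omega
  all_goals simp only [psum, ramp, expo, level, Cut.shift] at e1 k1 k3
  all_goals grind (splits := 40)

/-- If `f̃_n` is defined after the change of the columns, then it is defined. -/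
theorem Cut.not_chosen_shift_of_nonpos_end (hr : 1 ≤ r) (h0 : Loc r 0 p q) (he : End q)
    {a b : Cut} (s0 : Cut.Step r 0 a b p q) {i : Vertex}
    (hi : Chosen r 0 (a.shift p) (b.shift q) (b.shift q) i)
    (hi' : ∀ L, psum r 0 p q q L ≤ 0) : False := by
  have hb := s0.eq_or_eq_of_end h0 he
  obtain ⟨u1, u2, u3⟩ := s0
  obtain ⟨a1,a2,a3,a4,a5,a6,a7,a8,a9,a10,a11,a12,a13,a14,a15,a16⟩ := h0
  obtain ⟨hxy, hvw, hmid⟩ := he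
  obtain ⟨⟨e1, -, -⟩, e4, e5⟩ := hi
  have k1 := hi' (level r 0 q .x)
  have k3 := hi' (level r 0 q .v)
  clear hi'
  obtain rfl | rfl := hb <;> cases a <;> first | exact u3.elim | skip
  all_goals simp only [Cut.Inv, Cut.Trans] at u1 u2 u3
  all_goals cases i <;> simp only [Plus, PlusPick, level, Cut.shift] at e4 e5
  all_goals try omega
  all_goals simp only [psum, ramp, expo, level, Cut.shift] at e1 k1 k3
  all_goals grind (splits := 40)

set_option maxHeartbeats 0 in
/-- If `f̃_k` is defined, then it is defined after the change of the columns. -/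
theorem Cut.not_chosen_of_shift_nonpos (hr : 1 ≤ r) (h0 : Loc r m p q) (h1 : Loc r (m - 1) q s)
    {a b c : Cut} (s0 : Cut.Step r m a b p q) (s1 : Cut.Step r (m - 1) b c q s) {i : Vertex}
    (hi : Chosen r m p q s i)
    (hi' : ∀ L, psum r m (a.shift p) (b.shift q) (c.shift s) L ≤ 0) : False := by
  obtain ⟨a1,a2,a3,a4,a5,a6,a7,a8,a9,a10,a11,a12,a13,a14,a15,a16⟩ := h0
  obtain ⟨b1,b2,b3,b4,b5,b6,b7,b8,b9,b10,b11,b12,b13,b14,b15,b16⟩ := h1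
  obtain ⟨-, t1, t2⟩ := s1
  obtain ⟨u1, u2, u3⟩ := s0
  obtain ⟨⟨e1, -, -⟩, e4, e5⟩ := hi
  have k1 := hi' (level r m (b.shift q) .x)
  have k2 := hi' (level r m (b.shift q) .y)
  have k3 := hi' (level r m (b.shift q) .v)
  have k4 := hi' (level r m (b.shift q) .w)
  clear hi'
  cases a <;> cases b <;> first | exact u3.elim | skip
  all_goals cases c <;> first | exact t2.elim | skip
  all_goals simp only [Cut.Inv, Cut.Trans] at u1 u2 u3 t1 t2
  all_goals cases i <;> simp only [Plus, PlusPick, level] at e4 e5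
  all_goals try (clear a12 a13 a14 a15 a16 b12 b13 b14 b15 b16 k1 k2 k3 k4 e1 e5; omega)
  all_goals simp only [psum, ramp, expo, level, Cut.shift] at e1 k1 k2 k3 k4
  all_goals grind (splits := 40)

set_option maxHeartbeats 0 in
/-- If `f̃_k` is defined after the change of the columns, then it is defined. -/
theorem Cut.not_chosen_shift_of_nonpos (hr : 1 ≤ r) (h0 : Loc r m p q) (h1 : Loc r (m - 1) q s)
    {a b c : Cut} (s0 : Cut.Step r m a b p q) (s1 : Cut.Step r (m - 1) b c q s) {i : Vertex}
    (hi : Chosen r m (a.shift p) (b.shift q) (c.shift s) i)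
    (hi' : ∀ L, psum r m p q s L ≤ 0) : False := by
  obtain ⟨a1,a2,a3,a4,a5,a6,a7,a8,a9,a10,a11,a12,a13,a14,a15,a16⟩ := h0
  obtain ⟨b1,b2,b3,b4,b5,b6,b7,b8,b9,b10,b11,b12,b13,b14,b15,b16⟩ := h1
  obtain ⟨-, t1, t2⟩ := s1
  obtain ⟨u1, u2, u3⟩ := s0
  obtain ⟨⟨e1, -, -⟩, e4, e5⟩ := hi
  have k1 := hi' (level r m q .x)
  have k2 := hi' (level r m q .y)
  have k3 := hi' (level r m q .v)
  have k4 := hi' (level r m q .w)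
  clear hi'
  cases a <;> cases b <;> first | exact u3.elim | skip
  all_goals cases c <;> first | exact t2.elim | skip
  all_goals simp only [Cut.Inv, Cut.Trans] at u1 u2 u3 t1 t2
  all_goals cases i <;> simp only [Plus, PlusPick, level, Cut.shift] at e4 e5
  all_goals try (clear a12 a13 a14 a15 a16 b12 b13 b14 b15 b16 k1 k2 k3 k4 e1 e5; omega)
  all_goals simp only [psum, ramp, expo, level, Cut.shift] at e1 k1 k2 k3 k4
  all_goals grind (splits := 40)

end CrystalTypeC

namespace CrystalTypeC

/-! ### The effect of `τ` on profiles -/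

open Quad

variable {n ℓ h r : ℤ} {T T' : Tableau ℓ}

/-- The states that belong to a sequence of quadruples. -/
structure IsCut (n r : ℤ) (Q : ℤ → Quad) (σ : ℤ → Cut) : Prop where
  zero : σ 0 = .vy
  step : ∀ j, 1 ≤ j → j ≤ n → Cut.Step r (n - j) (σ (j - 1)) (σ j) (Q (j - 1)) (Q j)

theorem colOne_succ {v : Idx ℓ} (hv : (v : ℤ) = h + 1) (s : ℤ) : colOne n (h + 1) T s =
    colOne n h T s + if s < (T v).rank n then 1 else 0 := by
  rw [← sub_eq_iff_eq_add', colOne, colOne, ← Finset.sum_sub_distrib, Finset.sum_eq_single v]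
  · split_ifs <;> omega
  · intro b _ hb
    have : (b : ℤ) ≠ v := fun h => hb (Subtype.ext h)
    split_ifs <;> omega
  · simp

theorem colTwo_succ {v : Idx ℓ} (hv : (v : ℤ) = h + 1) (s : ℤ) : colTwo n (h + 1) T s =
    colTwo n h T s - if (T v).rank n ≤ s then 1 else 0 := by
  rw [eq_sub_iff_add_eq', ← eq_sub_iff_add_eq, colTwo, colTwo, ← Finset.sum_sub_distrib,
    Finset.sum_eq_single v]
  · split_ifs <;> omega
  · intro b _ hb
    have : (b : ℤ) ≠ v := fun h => hb (Subtype.ext h)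
    split_ifs <;> omega
  · simp

theorem colOne_congr (hT : ∀ c : Idx ℓ, (c : ℤ) ≤ h → T' c = T c) (s : ℤ) :
    colOne n h T' s = colOne n h T s :=
  Finset.sum_congr rfl fun c _ => by
    by_cases hc : (c : ℤ) ≤ h
    · rw [hT c hc]
    · simp [hc]

theorem colTwo_congr (hT : ∀ c : Idx ℓ, h < (c : ℤ) → T' c = T c) (s : ℤ) :
    colTwo n h T' s = colTwo n h T s :=
  Finset.sum_congr rfl fun c _ => by
    by_cases hc : h < (c : ℤ)
    · rw [hT c hc]
    · simp [hc]

/-- Lowering every rank of a run by one raises the count by one exactly at the new ranks `ρ + b₁ -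
1, …, ρ + b₂ - 1`. -/
theorem colTwo_run {ρ : ℤ} {b₁ b₂ : Idx ℓ} (hb : h < (b₁ : ℤ))
    (hrun : ∀ c : Idx ℓ, b₁ ≤ c → c ≤ b₂ → (T c).rank n = ρ + c)
    (hrun' : ∀ c : Idx ℓ, b₁ ≤ c → c ≤ b₂ → (T' c).rank n = ρ + c - 1)
    (heq : ∀ c : Idx ℓ, h < (c : ℤ) → ¬ (b₁ ≤ c ∧ c ≤ b₂) → T' c = T c) (s : ℤ) :
    colTwo n h T' s = colTwo n h T s +
      if (b₁ : ℤ) ≤ s - ρ + 1 ∧ s - ρ + 1 ≤ b₂ then 1 else 0 := by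
  have hb₁ := b₁.2
  have hb₂ := b₂.2
  simp only [Set.mem_Icc] at hb₁ hb₂
  have key : ∀ c : Idx ℓ, (if h < (c : ℤ) ∧ (T' c).rank n ≤ s then (1 : ℤ) else 0) =
      (if h < (c : ℤ) ∧ (T c).rank n ≤ s then (1 : ℤ) else 0) +
      if (c : ℤ) = s - ρ + 1 ∧ (b₁ : ℤ) ≤ c ∧ (c : ℤ) ≤ b₂ then 1 else 0 := by
    intro c
    by_cases hc : b₁ ≤ c ∧ c ≤ b₂
    · have h1 := hrun c hc.1 hc.2
      have h2 := hrun' c hc.1 hc.2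
      have h3 : (b₁ : ℤ) ≤ c := hc.1
      have h4 : (c : ℤ) ≤ b₂ := hc.2
      split_ifs <;> omega
    · have hc' : ¬ ((b₁ : ℤ) ≤ c ∧ (c : ℤ) ≤ b₂) := hc
      by_cases hch : h < (c : ℤ)
      · rw [heq c hch hc]
        split_ifs <;> omega
      · split_ifs <;> omega
  rw [colTwo, colTwo, Finset.sum_congr rfl fun c _ => key c, Finset.sum_add_distrib]
  congr 1
  split_ifs with h1
  · rw [Finset.sum_eq_single ⟨s - ρ + 1, by omega, by omega⟩]
    · rw [if_pos ⟨rfl, h1⟩]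
    · intro c _ hc
      rw [if_neg]
      exact fun h2 => hc (Subtype.ext h2.1)
    · simp
  · refine Finset.sum_eq_zero fun c _ => if_neg ?_
    rintro ⟨h2, h3⟩
    exact h1 (h2 ▸ h3)

theorem colOne_run {ρ : ℤ} {b₁ b₂ : Idx ℓ} (hb : (b₂ : ℤ) ≤ h)
    (hrun : ∀ c : Idx ℓ, b₁ ≤ c → c ≤ b₂ → (T c).rank n = ρ + c)
    (hrun' : ∀ c : Idx ℓ, b₁ ≤ c → c ≤ b₂ → (T' c).rank n = ρ + c - 1)
    (heq : ∀ c : Idx ℓ, (c : ℤ) ≤ h → ¬ (b₁ ≤ c ∧ c ≤ b₂) → T' c = T c) (s : ℤ) :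
    colOne n h T' s = colOne n h T s -
      if (b₁ : ℤ) ≤ s - ρ + 1 ∧ s - ρ + 1 ≤ b₂ then 1 else 0 := by
  have hb₁ := b₁.2
  have hb₂ := b₂.2
  simp only [Set.mem_Icc] at hb₁ hb₂
  have key : ∀ c : Idx ℓ, (if (c : ℤ) ≤ h ∧ s < (T' c).rank n then (1 : ℤ) else 0) =
      (if (c : ℤ) ≤ h ∧ s < (T c).rank n then (1 : ℤ) else 0) -
      if (c : ℤ) = s - ρ + 1 ∧ (b₁ : ℤ) ≤ c ∧ (c : ℤ) ≤ b₂ then 1 else 0 := by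
    intro c
    by_cases hc : b₁ ≤ c ∧ c ≤ b₂
    · have h1 := hrun c hc.1 hc.2
      have h2 := hrun' c hc.1 hc.2
      have h3 : (b₁ : ℤ) ≤ c := hc.1
      have h4 : (c : ℤ) ≤ b₂ := hc.2
      split_ifs <;> omega
    · have hc' : ¬ ((b₁ : ℤ) ≤ c ∧ (c : ℤ) ≤ b₂) := hc
      by_cases hch : (c : ℤ) ≤ h
      · rw [heq c hch hc]
        split_ifs <;> omega
      · split_ifs <;> omega
  rw [colOne, colOne, Finset.sum_congr rfl fun c _ => key c, Finset.sum_sub_distrib]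
  congr 1
  split_ifs with h1
  · rw [Finset.sum_eq_single ⟨s - ρ + 1, by omega, by omega⟩]
    · rw [if_pos ⟨rfl, h1⟩]
    · intro c _ hc
      rw [if_neg]
      exact fun h2 => hc (Subtype.ext h2.1)
    · simp
  · refine Finset.sum_eq_zero fun c _ => if_neg ?_
    rintro ⟨h2, h3⟩
    exact h1 (h2 ▸ h3)

theorem prof_x_antitone {i j : ℤ} (hij : i ≤ j) : (prof n h T j).x ≤ (prof n h T i).x := by
  dsimp only [prof]; exact colOne_antitone _ _ _ (by omega)

theorem prof_y_mono {i j : ℤ} (hij : i ≤ j) : (prof n h T i).y ≤ (prof n h T j).y := by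
  dsimp only [prof]; exact colOne_antitone _ _ _ (by omega)

theorem prof_v_mono {i j : ℤ} (hij : i ≤ j) : (prof n h T i).v ≤ (prof n h T j).v := by
  dsimp only [prof]; exact colTwo_mono _ _ _ (by omega)

theorem prof_w_antitone {i j : ℤ} (hij : i ≤ j) : (prof n h T j).w ≤ (prof n h T i).w := by
  dsimp only [prof]; exact colTwo_mono _ _ _ (by omega)

theorem prof_v_le_w {i j : ℤ} (hi : i ≤ n) (hj : j ≤ n) : (prof n h T i).v ≤ (prof n h T j).w := by
  dsimp only [prof]; exact colTwo_mono _ _ _ (by omega)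

theorem prof_y_le_x {i j : ℤ} (hi : i ≤ n) (hj : j ≤ n) : (prof n h T i).y ≤ (prof n h T j).x := by
  dsimp only [prof]; exact colOne_antitone _ _ _ (by omega)

theorem prof_x_nonneg (j : ℤ) : 0 ≤ (prof n h T j).x := by
  dsimp only [prof]; exact colOne_nonneg _ _ _ _

theorem prof_y_nonneg (j : ℤ) : 0 ≤ (prof n h T j).y := by
  dsimp only [prof]; exact colOne_nonneg _ _ _ _

theorem prof_v_nonneg (j : ℤ) : 0 ≤ (prof n h T j).v := by
  dsimp only [prof]; exact colTwo_nonneg _ _ _ _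

theorem prof_w_nonneg (j : ℤ) : 0 ≤ (prof n h T j).w := by
  dsimp only [prof]; exact colTwo_nonneg _ _ _ _

namespace IsFilling

variable (hT : IsFilling n h T)
include hT

theorem x_of_plain {a : Idx ℓ} {j : ℤ} (ha : (a : ℤ) ≤ h) (hj : j ≤ n) (haj : T a = .plain j) :
    (prof n h T j).x = h - a ∧ (prof n h T (j - 1)).x = h - a + 1 := by
  have h1 := hT.colOne_rank hT.h_le ha
  have h2 := hT.colOne_rank_sub_one hT.h_le ha
  rw [haj, Letter.rank_plain] at h1 h2
  rw [prof_of_le hj, prof_of_le (by omega)]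
  exact ⟨h1, h2⟩

theorem v_of_plain {a : Idx ℓ} {j : ℤ} (ha : h < (a : ℤ)) (hj : j ≤ n) (haj : T a = .plain j) :
    (prof n h T j).v = a - h ∧ (prof n h T (j - 1)).v = a - h - 1 := by
  have h1 := hT.colTwo_rank hT.h_nonneg ha
  have h2 := hT.colTwo_rank_sub_one hT.h_nonneg ha
  rw [haj, Letter.rank_plain] at h1 h2
  rw [prof_of_le hj, prof_of_le (by omega)]
  exact ⟨h1, h2⟩

theorem w_of_bar {a : Idx ℓ} {j : ℤ} (ha : h < (a : ℤ)) (hj : j ≤ n) (haj : T a = .bar j) :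
    (prof n h T j).w = a - h - 1 ∧ (prof n h T (j - 1)).w = a - h := by
  have h1 := hT.colTwo_rank hT.h_nonneg ha
  have h2 := hT.colTwo_rank_sub_one hT.h_nonneg ha
  rw [haj, Letter.rank_bar] at h1 h2
  rw [prof_of_le hj, prof_of_le (by omega), show 2 * n - (j - 1) = 2 * n + 1 - j by ring,
    show 2 * n - j = 2 * n + 1 - j - 1 by ring]
  exact ⟨h2, h1⟩

end IsFilling

theorem rank_le_of_x {a : Idx ℓ} (ha : (a : ℤ) ≤ h) {j : ℤ} (hj : j ≤ n)
    (hx : (prof n h T j).x = 0) : (T a).rank n ≤ j := by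
  rw [prof_of_le hj] at hx
  by_contra hc
  exact (colOne_pos ha (not_le.1 hc)).ne' hx

theorem rank_le_of_y {a : Idx ℓ} (ha : (a : ℤ) ≤ h) {j : ℤ} (hj : j ≤ n)
    (hy : (prof n h T j).y = 0) : (T a).rank n ≤ 2 * n - j := by
  rw [prof_of_le hj] at hy
  by_contra hc
  exact (colOne_pos ha (not_le.1 hc)).ne' hy

end CrystalTypeC

/-! ### The states of `τ` in each of its cases -/

namespace CrystalTypeC

open Quad

variable {n ℓ h r : ℤ} {T : Tableau ℓ}

theorem isCut_of_inv {Q : ℤ → Quad} {σ : ℤ → Cut} (h0 : σ 0 = .vy)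
    (hinv : ∀ j, 0 ≤ j → j ≤ n → (σ j).Inv r (n - j) (Q j))
    (htrans : ∀ j, 1 ≤ j → j ≤ n → Cut.Trans r (n - j) (Q (j - 1)) (Q j) (σ (j - 1)) (σ j)) :
    IsCut n r Q σ :=
  ⟨h0, fun j hj hjn => ⟨by
    have := hinv (j - 1) (by omega) (by omega)
    rwa [show n - (j - 1) = n - j + 1 by ring] at this, hinv j (by omega) hjn, htrans j hj hjn⟩⟩

/-- The data that describe the effect of `τ` on a tableau. -/
structure IsShift (n h r : ℤ) (T T' : Tableau ℓ) (σ : ℤ → Cut) : Prop where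
  cut : IsCut n r (prof n h T) σ
  filling : IsFilling n (h + 1) T'
  prof_eq : ∀ j, 0 ≤ j → j ≤ n → prof n (h + 1) T' j = (σ j).shift (prof n h T j)

theorem IsColumns.rank_mono_one (hT : IsColumns n h T) {a b : Idx ℓ} (hab : (a : ℤ) ≤ b)
    (hb : (b : ℤ) ≤ h) : (T a).rank n ≤ (T b).rank n := by
  rcases hab.eq_or_lt with h1 | h1
  · exact (congrArg (fun c => (T c).rank n) (idx_eq h1)).le
  · exact (hT.col₁ a b h1 hb).le

theorem IsColumns.rank_mono_two (hT : IsColumns n h T) {a b : Idx ℓ} (hab : (a : ℤ) ≤ b)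
    (ha : h < (a : ℤ)) : (T a).rank n ≤ (T b).rank n := by
  rcases hab.eq_or_lt with h1 | h1
  · exact (congrArg (fun c => (T c).rank n) (idx_eq h1)).le
  · exact (hT.col₂ a b h1 ha).le

/-- The beginning of the maximal run is the least position from which all entries up to `b` follow
the pattern, so the case is decided by the partner `b` alone. -/
theorem exists_caseA {v b : Idx ℓ} {k : ℤ} (hv : (v : ℤ) = h + 1)
    (hTv : T v = .plain k) (hTb : T b = .bar k) (hlow : n - r - k + 1 < (b : ℤ) - h)
    (hup : (b : ℤ) - h ≤ n - k) : ∃ b'', CaseA n ℓ h r T k b b'' := by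
  have hb := b.2
  simp only [Set.mem_Icc] at hb
  obtain ⟨z, ⟨hz1, hz2, hz⟩, hmin⟩ := Int.exists_least_of_bdd
    (P := fun z => 1 ≤ z ∧ z ≤ b ∧ ∀ c : Idx ℓ, z ≤ c → c ≤ b → T c = .bar (k + ((b : ℤ) - c)))
    ⟨1, fun z hz => hz.1⟩ ⟨b, hb.1, le_rfl, fun c hc hc' => by
      rw [le_antisymm hc' hc, hTb, sub_self, add_zero]⟩
  refine ⟨⟨z, hz1, by omega⟩, ⟨v, hv, hTv⟩, hTb, hlow, hup, hz2, fun c hc => hz c hc, ?_⟩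
  intro c hc hTc
  have hc1 := c.2.1
  dsimp only at hc
  have := hmin (z - 1) ⟨by omega, by omega, fun d hd hd' => ?_⟩
  · omega
  · rcases hd.eq_or_lt with h2 | h2
    · rw [← idx_eq (hc.trans h2), hTc]
    · exact hz d (by omega) hd'

theorem exists_caseB {v a : Idx ℓ} {k : ℤ} (hv : (v : ℤ) = h + 1)
    (hTv : T v = .bar k) (hTa : T a = .plain k) (hlow : n - r - k + 1 ≤ h - (a : ℤ))
    (hup : h - (a : ℤ) < n - k) : ∃ a'', CaseB n ℓ h r T k a a'' := by
  have ha := a.2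
  simp only [Set.mem_Icc] at ha
  obtain ⟨z, ⟨hz1, hz2, hz⟩, hmin⟩ := Int.exists_least_of_bdd
    (P := fun z => 1 ≤ z ∧ z ≤ a ∧ ∀ c : Idx ℓ, z ≤ c → c ≤ a → T c = .plain (k - ((a : ℤ) - c)))
    ⟨1, fun z hz => hz.1⟩ ⟨a, ha.1, le_rfl, fun c hc hc' => by
      rw [le_antisymm hc' hc, hTa, sub_self, sub_zero]⟩
  refine ⟨⟨z, hz1, by omega⟩, ⟨v, hv, hTv⟩, hTa, hlow, hup, hz2, fun c hc => hz c hc, ?_⟩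
  intro c hc hTc
  have hc1 := c.2.1
  dsimp only at hc
  have := hmin (z - 1) ⟨by omega, by omega, fun d hd hd' => ?_⟩
  · omega
  · rcases hd.eq_or_lt with h2 | h2
    · rw [← idx_eq (hc.trans h2), hTc]
    · exact hz d (by omega) hd'

section cases

variable (hT : IsTableauC n ℓ h r T) (h0 : 0 ≤ h) (h1 : h ≤ ℓ - 1) (hr : 1 ≤ r)
include hT h0 h1 hr

/-- Let `κ` be the largest label of the run. The new letter `κ + 1` in the first column instead of
`k` and the shifted run change the counts only for `k ≤ j ≤ κ` in comparison with a plain cut; this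
stretch is the state `wy`. -/
theorem IsTableauC.isShift_tauA {k : ℤ} {b b'' : Idx ℓ} (hA : CaseA n ℓ h r T k b b'') :
    ∃ σ, IsShift n h r T (tauA h T k b b'') σ := by
  have hF := hT.isFilling h0 (by omega)
  have hAd := hT.adm h0 (by omega) hr
  obtain ⟨⟨v, hv, hTv⟩, hTb, hlow, hup, hle, hrun, hmax⟩ := hA
  have hkn := hT.mem v
  rw [hTv] at hkn
  simp only [Letter.InB] at hkn
  have hbi := b.2
  have hbi'' := b''.2
  simp only [Set.mem_Icc] at hbi hbi''
  have hle' : (b'' : ℤ) ≤ b := hle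
  have hbh : h < (b : ℤ) := by
    by_contra hc
    have hu := hF.rank_mono_one (a := b) (b := ⟨h, by omega, by omega⟩) (not_lt.1 hc) le_rfl
    rw [hTb, Letter.rank_bar] at hu
    exact hT.not_plain_bar (u := ⟨h, by omega, by omega⟩) rfl hv
      (by rw [hTv, Letter.rank_plain]; omega) (by omega)
  have hbv : h + 1 < (b'' : ℤ) := by
    by_contra hc
    have := hrun v (show (b'' : ℤ) ≤ v by omega) (show (v : ℤ) ≤ b by omega)
    rw [hTv] at this
    cases this
  obtain ⟨κ, hκ⟩ : ∃ κ, κ = k + ((b : ℤ) - b'') := ⟨_, rfl⟩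
  have hvk := hF.v_of_plain (by omega) hkn.2 hTv
  have hbar : ∀ j, k ≤ j → j ≤ κ → (prof n h T j).w = b - (j - k) - h - 1 ∧
      (prof n h T (j - 1)).w = b - (j - k) - h := by
    intro j hj hj'
    refine hF.w_of_bar (a := ⟨b - (j - k), by omega, by omega⟩) ?_ (by omega) ?_
    · show h < (b : ℤ) - (j - k)
      omega
    · rw [hrun _ (show (b'' : ℤ) ≤ b - (j - k) by omega) (show (b : ℤ) - (j - k) ≤ b by omega)]
      congr 1
      show k + ((b : ℤ) - (b - (j - k))) = j
      ring
  have hw0 := (hbar κ (by omega) le_rfl).1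
  have hnotin : ∀ c : Idx ℓ, h < (c : ℤ) → T c ≠ .bar (κ + 1) := by
    intro c hc hTc
    have h2 := hF.w_of_bar hc (by omega) hTc
    rw [show κ + 1 - 1 = κ by ring] at h2
    refine hmax c (by omega) ?_
    rw [hTc]
    congr 1
    omega
  have hwκ : (prof n h T κ).w = (prof n h T (κ + 1)).w := by
    rcases hF.w_step (j := κ + 1) (by omega) with ⟨a, ha, h2, -⟩ | ⟨-, h2⟩
    · exact absurd h2 (hnotin a ha)
    · rw [show κ + 1 - 1 = κ by ring] at h2
      exact h2.symm
  -- By maximality the barred `κ + 1` is missing, so `w` does not drop at `κ + 1` and `c5` forbids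
  -- letters of the first column beyond `κ`. Hence `κ + 1` may be appended to that column.
  have hxκ : (prof n h T κ).x = 0 := by
    have h2 := prof_x_nonneg (n := n) (h := h) (T := T) κ
    have h3 := (hAd.loc (κ + 1) (by omega) (by omega)).c5
    rw [show κ + 1 - 1 = κ by ring] at h3
    have h4 := prof_v_mono (n := n) (h := h) (T := T) (show k ≤ κ + 1 by omega)
    by_contra hc
    have := h3 (by omega) (by omega)
    omega
  have hv0 : ∀ j, j < k → (prof n h T j).v = 0 := fun j hj => by
    have h2 := prof_v_mono (n := n) (h := h) (T := T) (show j ≤ k - 1 by omega)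
    have h3 := prof_v_nonneg (n := n) (h := h) (T := T) j
    omega
  have hv1 : ∀ j, k ≤ j → 0 < (prof n h T j).v := fun j hj => by
    have h2 := prof_v_mono (n := n) (h := h) (T := T) hj
    omega
  have hy0 : ∀ j, j ≤ n → (prof n h T j).y = 0 := fun j hj => by
    have h2 := prof_y_mono (n := n) (h := h) (T := T) hj
    have h3 := prof_y_nonneg (n := n) (h := h) (T := T) j
    have h4 := hAd.fin.mid
    have h5 := hAd.fin.xy
    have h6 := hv1 n hkn.2
    omega
  have hx0 : ∀ j, κ < j → (prof n h T j).x = 0 := fun j hj => by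
    have h2 := prof_x_antitone (n := n) (h := h) (T := T) hj.le
    have h3 := prof_x_nonneg (n := n) (h := h) (T := T) j
    omega
  have hT'v : ∀ c : Idx ℓ, (c : ℤ) = h + 1 → tauA h T k b b'' c = .plain (κ + 1) := fun c hc => by
    rw [tauA, if_pos hc, hκ]
  have hT'run : ∀ c : Idx ℓ, b'' ≤ c → c ≤ b → tauA h T k b b'' c = .bar (k + ((b : ℤ) - c) + 1) :=
    fun c hc hc' => by
      have : (b'' : ℤ) ≤ c := hc
      rw [tauA, if_neg (by omega), if_pos ⟨hc, hc'⟩]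
  have hT'eq : ∀ c : Idx ℓ, (c : ℤ) ≠ h + 1 → ¬ (b'' ≤ c ∧ c ≤ b) → tauA h T k b b'' c = T c :=
    fun c hc hc' => by rw [tauA, if_neg hc, if_neg hc']
  generalize tauA h T k b b'' = T' at hT'v hT'run hT'eq
  have hrank : ∀ c : Idx ℓ, h + 1 < (c : ℤ) →
      (T' c).rank n = (T c).rank n - if (b'' : ℤ) ≤ c ∧ (c : ℤ) ≤ b then 1 else 0 := by
    intro c hc
    split_ifs with hc'
    · rw [hT'run c hc'.1 hc'.2, hrun c hc'.1 hc'.2, Letter.rank_bar, Letter.rank_bar]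
      ring
    · rw [hT'eq c (by omega) hc', sub_zero]
  have hone : ∀ c : Idx ℓ, (c : ℤ) ≤ h → T' c = T c := fun c hc =>
    hT'eq c (by omega) fun hc' => by
      have : (b'' : ℤ) ≤ c := hc'.1
      omega
  refine ⟨fun j => if j < k then .vy else if j ≤ κ then .wy else .xy, ?_, ?_, ?_⟩
  · refine isCut_of_inv ?_ ?_ ?_
    · rw [if_pos (by omega)]
    · intro j hj hjn
      split_ifs with h2 h3
      · refine ⟨hv0 j h2, hy0 j hjn, ?_⟩
        have h4 := prof_v_le_w (n := n) (h := h) (T := T) hkn.2 hjn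
        omega
      · have := hbar j (by omega) h3
        exact ⟨hv1 j (by omega), hy0 j hjn, by omega, by omega⟩
      · exact ⟨hv1 j (by omega), hx0 j (by omega), hy0 j hjn⟩
    · intro j hj hjn
      split_ifs with h2 h3 h4 h5 h6 h7 h8 <;> simp only [Cut.Trans] <;> try omega
      · have := hbar j (by omega) (by omega)
        omega
      · have := hbar j (by omega) (by omega)
        omega
      · obtain rfl : j = κ + 1 := by omega
        rw [show κ + 1 - 1 = κ by ring]
        exact hwκ
  · refine ⟨⟨fun c => ?_, fun c d hcd hd => ?_, fun c d hcd hc => ?_⟩, by omega, by omega⟩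
    · by_cases hc : (c : ℤ) = h + 1
      · rw [hT'v c hc]
        exact ⟨by omega, by omega⟩
      · by_cases hc' : b'' ≤ c ∧ c ≤ b
        · rw [hT'run c hc'.1 hc'.2]
          have h2 : (b'' : ℤ) ≤ c := hc'.1
          have h3 : (c : ℤ) ≤ b := hc'.2
          exact ⟨by omega, by omega⟩
        · rw [hT'eq c hc hc']
          exact hT.mem c
    · have hcd' : (c : ℤ) < d := hcd
      rw [hone c (by omega)]
      by_cases hd' : (d : ℤ) = h + 1
      · have := rank_le_of_x (T := T) (a := c) (by omega) (by omega) hxκ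
        rw [hT'v d hd', Letter.rank_plain]
        omega
      · rw [hone d (by omega)]
        exact hF.col₁ c d hcd (by omega)
    · have hcd' : (c : ℤ) < d := hcd
      rw [hrank c hc, hrank d (by omega)]
      have h2 := hF.col₂ c d hcd (by omega)
      by_cases h4 : (b'' : ℤ) ≤ d ∧ (d : ℤ) ≤ b
      swap
      · rw [if_neg h4]
        split_ifs <;> omega
      by_cases h3 : (b'' : ℤ) ≤ c ∧ (c : ℤ) ≤ b
      · rw [if_pos h4, if_pos h3]
        omega
      rw [if_pos h4, if_neg h3]
      have h5 : (c : ℤ) < b'' := by omega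
      have h6 := hF.col₂ c b'' h5 (by omega)
      have h7 := hF.rank_mono_two (a := b'') h4.1 (by omega)
      have h8 : (T c).rank n ≠ 2 * n + 1 - (κ + 1) := fun h9 =>
        hnotin c (by omega) ((Letter.rank_eq_bar (hT.mem c) (by omega)).1 h9)
      rw [hrun b'' le_rfl hle, Letter.rank_bar] at h6 h7
      omega
  · intro j hj hjn
    rw [prof_of_le hjn, prof_of_le hjn]
    have e1 : ∀ s, colOne n (h + 1) T' s = colOne n h T s + if s < κ + 1 then 1 else 0 := by
      intro s
      rw [colOne_succ hv, colOne_congr hone, hT'v v hv, Letter.rank_plain]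
    have e2 : ∀ s, colTwo n (h + 1) T' s = colTwo n h T s - (if k ≤ s then 1 else 0) +
        if (b'' : ℤ) ≤ s - (2 * n + 1 - k - b) + 1 ∧ s - (2 * n + 1 - k - b) + 1 ≤ b
          then 1 else 0 := by
      intro s
      rw [colTwo_run (T := T) hbv (ρ := 2 * n + 1 - k - b) (fun c hc hc' => ?_) (fun c hc hc' => ?_)
        (fun c hc hc' => hT'eq c (by omega) hc') s, colTwo_succ hv, hTv, Letter.rank_plain]
      · rw [hrun c hc hc', Letter.rank_bar]; ring
      · rw [hT'run c hc hc', Letter.rank_bar]; ring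
    clear hvk hw0 hwκ hxκ hlow hv
    by_cases h2 : j < k
    · rw [if_pos h2]
      simp only [Cut.shift, Quad.mk.injEq]
      refine ⟨?_, ?_, ?_, ?_⟩ <;> simp only [e1, e2] <;> split_ifs <;> omega
    by_cases h3 : j ≤ κ
    · rw [if_neg h2, if_pos h3]
      simp only [Cut.shift, Quad.mk.injEq]
      refine ⟨?_, ?_, ?_, ?_⟩ <;> simp only [e1, e2] <;> split_ifs <;> omega
    · rw [if_neg h2, if_neg h3]
      simp only [Cut.shift, Quad.mk.injEq]
      refine ⟨?_, ?_, ?_, ?_⟩ <;> simp only [e1, e2] <;> split_ifs <;> omega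

/-- Here `κ` is the smallest label of the run. Its shift and the new barred letter `κ - 1` alter a
plain cut for `κ - 1 ≤ j < k`, which is the stretch of the state `vx`. -/
theorem IsTableauC.isShift_tauB (hrn : r ≤ n - ℓ) {k : ℤ} {a a'' : Idx ℓ}
    (hB : CaseB n ℓ h r T k a a'') : ∃ σ, IsShift n h r T (tauB h T k a a'') σ := by
  have hF := hT.isFilling h0 (by omega)
  have hAd := hT.adm h0 (by omega) hr
  obtain ⟨⟨v, hv, hTv⟩, hTa, hlow, hup, hle, hrun, hmax⟩ := hB
  have hkn := hT.mem v
  rw [hTv] at hkn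
  simp only [Letter.InB] at hkn
  have hai := a.2
  have hai'' := a''.2
  simp only [Set.mem_Icc] at hai hai''
  have hle' : (a'' : ℤ) ≤ a := hle
  have hah : (a : ℤ) ≤ h := by
    by_contra hc
    have := hF.rank_mono_two (a := v) (b := a) (by omega) (by omega)
    rw [hTv, hTa, Letter.rank_bar, Letter.rank_plain] at this
    omega
  obtain ⟨κ, hκ⟩ : ∃ κ, κ = k - ((a : ℤ) - a'') := ⟨_, rfl⟩
  -- The label `κ - 1` must be a letter. The lower bound on `h - a` and `r ≤ n - ℓ` keep the run
  -- away from the letter 1.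
  have hκ1 : 2 ≤ κ := by
    have h2 := hT.mem a''
    rw [hrun a'' le_rfl hle] at h2
    simp only [Letter.InB] at h2
    omega
  have hwk := hF.w_of_bar (by omega) hkn.2 hTv
  have hplain : ∀ j, κ ≤ j → j ≤ k → (prof n h T j).x = h - (a - (k - j)) ∧
      (prof n h T (j - 1)).x = h - (a - (k - j)) + 1 := by
    intro j hj hj'
    refine hF.x_of_plain (a := ⟨a - (k - j), by omega, by omega⟩) ?_ (by omega) ?_
    · show (a : ℤ) - (k - j) ≤ h
      omega
    · rw [hrun _ (show (a'' : ℤ) ≤ a - (k - j) by omega) (show (a : ℤ) - (k - j) ≤ a by omega)]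
      congr 1
      show k - ((a : ℤ) - (a - (k - j))) = j
      ring
  have hxκ := (hplain κ le_rfl (by omega)).2
  have hnotin : ∀ c : Idx ℓ, (c : ℤ) ≤ h → T c ≠ .plain (κ - 1) := by
    intro c hc hTc
    have h2 := hF.x_of_plain hc (by omega) hTc
    refine hmax c (by omega) ?_
    rw [hTc]
    congr 1
    omega
  have hxκ' : (prof n h T (κ - 1 - 1)).x = (prof n h T (κ - 1)).x := by
    rcases hF.x_step (j := κ - 1) (by omega) with ⟨c, hc, h2, -⟩ | ⟨-, h2⟩
    · exact absurd h2 (hnotin c hc)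
    · exact h2
  have hw0 : ∀ j, k ≤ j → (prof n h T j).w = 0 := fun j hj => by
    have h2 := prof_w_antitone (n := n) (h := h) (T := T) hj
    have h3 := prof_w_nonneg (n := n) (h := h) (T := T) j
    omega
  have hw1 : ∀ j, j < k → 0 < (prof n h T j).w := fun j hj => by
    have h2 := prof_w_antitone (n := n) (h := h) (T := T) (show j ≤ k - 1 by omega)
    omega
  have hv0 : ∀ j, j ≤ n → (prof n h T j).v = 0 := fun j hj => by
    have h2 := prof_v_le_w (n := n) (h := h) (T := T) hj hkn.2
    have h3 := prof_v_nonneg (n := n) (h := h) (T := T) j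
    omega
  -- As `κ - 1` is missing from the first column, `c6` forbids barred letters there with labels up
  -- to `κ - 1`, so the barred `κ - 1` may be appended.
  have hyκ : (prof n h T (κ - 1)).y = 0 := by
    have h2 := prof_y_nonneg (n := n) (h := h) (T := T) (κ - 1)
    have h3 := (hAd.loc (κ - 1) (by omega) (by omega)).c6 (hw1 _ (by omega))
    by_contra hc
    have := h3 (by omega)
    omega
  have hT'v : ∀ c : Idx ℓ, (c : ℤ) = h + 1 → tauB h T k a a'' c = .bar (κ - 1) := fun c hc => by
    rw [tauB, if_pos hc, hκ]
  have hT'run : ∀ c : Idx ℓ, a'' ≤ c → c ≤ a → tauB h T k a a'' c = .plain (k - ((a : ℤ) - c) - 1) :=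
    fun c hc hc' => by
      have : (c : ℤ) ≤ a := hc'
      rw [tauB, if_neg (by omega), if_pos ⟨hc, hc'⟩]
  have hT'eq : ∀ c : Idx ℓ, (c : ℤ) ≠ h + 1 → ¬ (a'' ≤ c ∧ c ≤ a) → tauB h T k a a'' c = T c :=
    fun c hc hc' => by rw [tauB, if_neg hc, if_neg hc']
  generalize tauB h T k a a'' = T' at hT'v hT'run hT'eq
  have hrank : ∀ c : Idx ℓ, (c : ℤ) ≤ h →
      (T' c).rank n = (T c).rank n - if (a'' : ℤ) ≤ c ∧ (c : ℤ) ≤ a then 1 else 0 := by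
    intro c hc
    split_ifs with hc'
    · rw [hT'run c hc'.1 hc'.2, hrun c hc'.1 hc'.2, Letter.rank_plain, Letter.rank_plain]
    · rw [hT'eq c (by omega) hc', sub_zero]
  have htwo : ∀ c : Idx ℓ, h + 1 < (c : ℤ) → T' c = T c := fun c hc =>
    hT'eq c (by omega) fun hc' => by
      have : (c : ℤ) ≤ a := hc'.2
      omega
  refine ⟨fun j => if j < κ - 1 then .vy else if j < k then .vx else .vw, ?_, ?_, ?_⟩
  · refine isCut_of_inv ?_ ?_ ?_
    · rw [if_pos (by omega)]
    · intro j hj hjn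
      split_ifs with h2 h3
      · refine ⟨hv0 j hjn, ?_, hw1 j (by omega)⟩
        have h4 := prof_y_mono (n := n) (h := h) (T := T) h2.le
        have h5 := prof_y_nonneg (n := n) (h := h) (T := T) j
        omega
      · have := (hplain (j + 1) (by omega) (by omega)).2
        rw [show j + 1 - 1 = j by ring] at this
        exact ⟨hv0 j hjn, by omega, hw1 j h3, by omega, by omega⟩
      · exact ⟨hv0 j hjn, hw0 j (by omega)⟩
    · intro j hj hjn
      split_ifs with h2 h3 h4 h5 h6 h7 h8 <;> simp only [Cut.Trans] <;> try omega
      · obtain rfl : j = κ - 1 := by omega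
        exact hxκ'
      · have := hplain j (by omega) (by omega)
        omega
      · have := hplain j (by omega) (by omega)
        omega
  · refine ⟨⟨fun c => ?_, fun c d hcd hd => ?_, fun c d hcd hc => ?_⟩, by omega, by omega⟩
    · by_cases hc : (c : ℤ) = h + 1
      · rw [hT'v c hc]
        exact ⟨by omega, by omega⟩
      · by_cases hc' : a'' ≤ c ∧ c ≤ a
        · rw [hT'run c hc'.1 hc'.2]
          have h2 : (a'' : ℤ) ≤ c := hc'.1
          have h3 : (c : ℤ) ≤ a := hc'.2
          exact ⟨by omega, by omega⟩
        · rw [hT'eq c hc hc']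
          exact hT.mem c
    · have hcd' : (c : ℤ) < d := hcd
      rw [hrank c (by omega)]
      by_cases hd' : (d : ℤ) = h + 1
      · have := rank_le_of_y (T := T) (a := c) (by omega) (by omega) hyκ
        rw [hT'v d hd', Letter.rank_bar]
        split_ifs <;> omega
      · rw [hrank d (by omega)]
        have h2 := hF.col₁ c d hcd (by omega)
        by_cases h4 : (a'' : ℤ) ≤ d ∧ (d : ℤ) ≤ a
        swap
        · rw [if_neg h4]
          split_ifs <;> omega
        by_cases h3 : (a'' : ℤ) ≤ c ∧ (c : ℤ) ≤ a
        · rw [if_pos h4, if_pos h3]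
          omega
        rw [if_pos h4, if_neg h3]
        have h5 : (c : ℤ) < a'' := by omega
        have h6 := hF.col₁ c a'' h5 (by omega)
        have h7 := hF.rank_mono_one (a := a'') h4.1 (by omega)
        have h8 : (T c).rank n ≠ κ - 1 := fun h9 =>
          hnotin c (by omega) ((Letter.rank_eq_plain (hT.mem c) (by omega)).1 h9)
        rw [hrun a'' le_rfl hle, Letter.rank_plain] at h6 h7
        omega
    · have hcd' : (c : ℤ) < d := hcd
      rw [htwo c hc, htwo d (by omega)]
      exact hF.col₂ c d hcd (by omega)
  · intro j hj hjn
    rw [prof_of_le hjn, prof_of_le hjn]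
    have e1 : ∀ s, colTwo n (h + 1) T' s = colTwo n h T s - if 2 * n + 1 - k ≤ s then 1 else 0 := by
      intro s
      rw [colTwo_congr htwo, colTwo_succ hv, hTv, Letter.rank_bar]
    have e2 : ∀ s, colOne n (h + 1) T' s = colOne n h T s -
        (if (a'' : ℤ) ≤ s - (k - a) + 1 ∧ s - (k - a) + 1 ≤ a then 1 else 0) +
        if s < 2 * n + 1 - (κ - 1) then 1 else 0 := by
      intro s
      rw [colOne_succ hv, hT'v v hv, Letter.rank_bar,
        colOne_run (T := T) hah (ρ := k - a) (fun c hc hc' => ?_) (fun c hc hc' => ?_)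
        (fun c hc hc' => hT'eq c (by omega) hc') s]
      · rw [hrun c hc hc', Letter.rank_plain]; ring
      · rw [hT'run c hc hc', Letter.rank_plain]; ring
    clear hwk hxκ hxκ' hyκ hlow hv hrn
    by_cases h2 : j < κ - 1
    · rw [if_pos h2]
      simp only [Cut.shift, Quad.mk.injEq]
      refine ⟨?_, ?_, ?_, ?_⟩ <;> simp only [e1, e2] <;> split_ifs <;> omega
    by_cases h3 : j < k
    · rw [if_neg h2, if_pos h3]
      simp only [Cut.shift, Quad.mk.injEq]
      refine ⟨?_, ?_, ?_, ?_⟩ <;> simp only [e1, e2] <;> split_ifs <;> omega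
    · rw [if_neg h2, if_neg h3]
      simp only [Cut.shift, Quad.mk.injEq]
      refine ⟨?_, ?_, ?_, ?_⟩ <;> simp only [e1, e2] <;> split_ifs <;> omega

/-- Without a partner of `k` the conclusion of `c5` fails at `k`, so all letters of the first column
precede `k` and the letter can change its column. -/
theorem IsTableauC.isShift_plain {v : Idx ℓ} {k : ℤ} (hv : (v : ℤ) = h + 1)
    (hTv : T v = .plain k) (hA : ∀ b b'', ¬ CaseA n ℓ h r T k b b'') : ∃ σ, IsShift n h r T T σ := by
  have hF := hT.isFilling h0 (by omega)
  have hAd := hT.adm h0 (by omega) hr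
  have hkn := hT.mem v
  rw [hTv] at hkn
  simp only [Letter.InB] at hkn
  have hvk := hF.v_of_plain (by omega) hkn.2 hTv
  have hnot : ¬ ((prof n h T (k - 1)).w = (prof n h T k).w + 1 ∧ 1 ≤ n - k - (prof n h T k).w ∧
      n - k - r - (prof n h T k).w ≤ -1) := by
    rintro ⟨h2, h3, h4⟩
    rcases hF.w_step hkn.2 with ⟨b, hb, hTb, h5, h6⟩ | ⟨-, h5⟩
    · obtain ⟨b'', hb''⟩ := exists_caseA (n := n) (r := r) hv hTv hTb (by omega) (by omega)
      exact hA b b'' hb''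
    · omega
  have hxk : (prof n h T (k - 1)).x = 0 := by
    have h2 := prof_x_nonneg (n := n) (h := h) (T := T) (k - 1)
    have h3 := (hAd.loc k (by omega) (by omega)).c5 (by omega)
    by_contra hc
    have := h3 (by omega)
    omega
  have hv0 : ∀ j, j < k → (prof n h T j).v = 0 := fun j hj => by
    have h2 := prof_v_mono (n := n) (h := h) (T := T) (show j ≤ k - 1 by omega)
    have h3 := prof_v_nonneg (n := n) (h := h) (T := T) j
    omega
  have hv1 : ∀ j, k ≤ j → 0 < (prof n h T j).v := fun j hj => by
    have h2 := prof_v_mono (n := n) (h := h) (T := T) hj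
    omega
  have hy0 : ∀ j, j ≤ n → (prof n h T j).y = 0 := fun j hj => by
    have h2 := prof_y_mono (n := n) (h := h) (T := T) hj
    have h3 := prof_y_nonneg (n := n) (h := h) (T := T) j
    have h4 := hAd.fin.mid
    have h5 := hAd.fin.xy
    have h6 := hv1 n hkn.2
    omega
  have hx0 : ∀ j, k ≤ j → (prof n h T j).x = 0 := fun j hj => by
    have h2 := prof_x_antitone (n := n) (h := h) (T := T) (show k - 1 ≤ j by omega)
    have h3 := prof_x_nonneg (n := n) (h := h) (T := T) j
    omega
  refine ⟨fun j => if j < k then .vy else .xy, ?_, ?_, ?_⟩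
  · refine isCut_of_inv ?_ ?_ ?_
    · rw [if_pos (by omega)]
    · intro j hj hjn
      split_ifs with h2
      · refine ⟨hv0 j h2, hy0 j hjn, ?_⟩
        have h4 := prof_v_le_w (n := n) (h := h) (T := T) hkn.2 hjn
        omega
      · exact ⟨hv1 j (by omega), hx0 j (by omega), hy0 j hjn⟩
    · intro j hj hjn
      split_ifs with h2 h3 h4 <;> simp only [Cut.Trans] <;> try omega
      obtain rfl : j = k := by omega
      exact hnot
  · refine ⟨⟨hT.mem, fun c d hcd hd => ?_, fun c d hcd hc => hF.col₂ c d hcd (by omega)⟩,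
      by omega, by omega⟩
    have hcd' : (c : ℤ) < d := hcd
    by_cases hd' : (d : ℤ) = h + 1
    · have := rank_le_of_x (T := T) (a := c) (by omega) (by omega) hxk
      rw [idx_eq (hd'.trans hv.symm), hTv, Letter.rank_plain]
      omega
    · exact hF.col₁ c d hcd (by omega)
  · intro j hj hjn
    rw [prof_of_le hjn, prof_of_le hjn]
    simp only [colTwo_succ hv, colOne_succ hv, hTv, Letter.rank_plain]
    split_ifs <;> simp only [Cut.shift, Quad.mk.injEq] <;> refine ⟨?_, ?_, ?_, ?_⟩ <;>
      first | trivial | omega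

/-- The same with `c6`: no partner means that no letter of the first column lies beyond the barred
`k + 1`, so the barred `k` can be appended. -/
theorem IsTableauC.isShift_bar {v : Idx ℓ} {k : ℤ} (hv : (v : ℤ) = h + 1)
    (hTv : T v = .bar k) (hB : ∀ a a'', ¬ CaseB n ℓ h r T k a a'') : ∃ σ, IsShift n h r T T σ := by
  have hF := hT.isFilling h0 (by omega)
  have hAd := hT.adm h0 (by omega) hr
  have hkn := hT.mem v
  rw [hTv] at hkn
  simp only [Letter.InB] at hkn
  have hwk := hF.w_of_bar (by omega) hkn.2 hTv
  have hnot : ¬ ((prof n h T (k - 1)).x = (prof n h T k).x + 1 ∧ (prof n h T k).x ≤ n - k - 1 ∧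
      n - k - r - (prof n h T k).x ≤ -1) := by
    rintro ⟨h2, h3, h4⟩
    rcases hF.x_step hkn.2 with ⟨a, ha, hTa, h5, h6⟩ | ⟨-, h5⟩
    · obtain ⟨a'', ha''⟩ := exists_caseB (n := n) (r := r) hv hTv hTa (by omega) (by omega)
      exact hB a a'' ha''
    · omega
  have hyk : (prof n h T k).y = 0 := by
    have h2 := prof_y_nonneg (n := n) (h := h) (T := T) k
    have h3 := (hAd.loc k (by omega) (by omega)).c6 (by omega)
    by_contra hc
    have := h3 (by omega)
    omega
  have hw0 : ∀ j, k ≤ j → (prof n h T j).w = 0 := fun j hj => by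
    have h2 := prof_w_antitone (n := n) (h := h) (T := T) hj
    have h3 := prof_w_nonneg (n := n) (h := h) (T := T) j
    omega
  have hw1 : ∀ j, j < k → 0 < (prof n h T j).w := fun j hj => by
    have h2 := prof_w_antitone (n := n) (h := h) (T := T) (show j ≤ k - 1 by omega)
    omega
  have hv0 : ∀ j, j ≤ n → (prof n h T j).v = 0 := fun j hj => by
    have h2 := prof_v_le_w (n := n) (h := h) (T := T) hj hkn.2
    have h3 := prof_v_nonneg (n := n) (h := h) (T := T) j
    omega
  refine ⟨fun j => if j < k then .vy else .vw, ?_, ?_, ?_⟩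
  · refine isCut_of_inv ?_ ?_ ?_
    · rw [if_pos (by omega)]
    · intro j hj hjn
      split_ifs with h2
      · refine ⟨hv0 j hjn, ?_, hw1 j h2⟩
        have h4 := prof_y_mono (n := n) (h := h) (T := T) h2.le
        have h5 := prof_y_nonneg (n := n) (h := h) (T := T) j
        omega
      · exact ⟨hv0 j hjn, hw0 j (by omega)⟩
    · intro j hj hjn
      split_ifs with h2 h3 h4 <;> simp only [Cut.Trans] <;> try omega
      obtain rfl : j = k := by omega
      exact hnot
  · refine ⟨⟨hT.mem, fun c d hcd hd => ?_, fun c d hcd hc => hF.col₂ c d hcd (by omega)⟩,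
      by omega, by omega⟩
    have hcd' : (c : ℤ) < d := hcd
    by_cases hd' : (d : ℤ) = h + 1
    · have := rank_le_of_y (T := T) (a := c) (by omega) (by omega) hyk
      rw [idx_eq (hd'.trans hv.symm), hTv, Letter.rank_bar]
      omega
    · exact hF.col₁ c d hcd (by omega)
  · intro j hj hjn
    rw [prof_of_le hjn, prof_of_le hjn]
    simp only [colTwo_succ hv, colOne_succ hv, hTv, Letter.rank_bar]
    split_ifs <;> simp only [Cut.shift, Quad.mk.injEq] <;> refine ⟨?_, ?_, ?_, ?_⟩ <;>
      first | trivial | omega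

/-- The effect of `τ` on the profile. -/
theorem IsTableauC.exists_isShift (hrn : r ≤ n - ℓ) : ∃ σ, IsShift n h r T (tau n ℓ h r T) σ := by
  rw [tau]
  split_ifs with hA hB
  · exact hT.isShift_tauA h0 h1 hr hA.choose_spec
  · exact hT.isShift_tauB h0 h1 hr hrn hB.choose_spec
  · obtain ⟨k, hk⟩ | ⟨k, hk⟩ : (∃ k, T ⟨h + 1, by omega, by omega⟩ = .plain k) ∨
        ∃ k, T ⟨h + 1, by omega, by omega⟩ = .bar k := by
      cases T ⟨h + 1, by omega, by omega⟩
      · exact Or.inl ⟨_, rfl⟩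
      · exact Or.inr ⟨_, rfl⟩
    · exact hT.isShift_plain h0 h1 hr rfl hk fun b b'' h2 => hA ⟨(k, b, b''), h2⟩
    · exact hT.isShift_bar h0 h1 hr rfl hk fun a a'' h2 => hB ⟨(k, a, a''), h2⟩

end cases
end CrystalTypeC

namespace CrystalTypeC

/-! ### The states are determined by the profile -/

open Quad

variable {n ℓ h r : ℤ} {T T' : Tableau ℓ}

/-- The states that occur if the second column starts with an unbarred letter. -/
def Cut.IsPlain (a : Cut) : Prop := a = .vy ∨ a = .wy ∨ a = .xy

/-- The states that occur if the second column starts with a barred letter. -/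
def Cut.IsBarred (a : Cut) : Prop := a = .vy ∨ a = .vx ∨ a = .vw

namespace Cut.Step

variable {m : ℤ} {a a' b b' : Cut} {p q : Quad}

theorem isPlain (hs : Cut.Step r m a b p q) (hb : b.IsPlain) : a.IsPlain := by
  have h3 := hs.trans
  unfold Cut.IsPlain at *
  cases a <;> cases b <;> simp [Cut.Trans] at *

theorem isBarred (hs : Cut.Step r m a b p q) (hb : b.IsBarred) : a.IsBarred := by
  have h3 := hs.trans
  unfold Cut.IsBarred at *
  cases a <;> cases b <;> simp [Cut.Trans] at *

/-- For an unbarred head the automaton is deterministic from left to right: the sign of `v` and the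
drop of `w` decide. -/
theorem right_unique (hs : Cut.Step r m a b p q) (hs' : Cut.Step r m a b' p q) (hb : b.IsPlain)
    (hb' : b'.IsPlain) : b = b' := by
  obtain ⟨-, h2, h3⟩ := hs
  obtain ⟨-, h2', h3'⟩ := hs'
  obtain rfl | rfl | rfl := hb <;> obtain rfl | rfl | rfl := hb' <;> cases a <;>
    first | rfl | exact h3.elim | exact h3'.elim | skip
  all_goals simp only [Cut.Inv, Cut.Trans] at *; omega

/-- For a barred head it is deterministic only from right to left: the start of a stretch of `vx` is
not visible from `vy`, but its end is visible from `vw`. -/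
theorem left_unique (hs : Cut.Step r m a b p q) (hs' : Cut.Step r m a' b p q) (ha : a.IsBarred)
    (ha' : a'.IsBarred) (hb : b.IsBarred) : a = a' := by
  obtain ⟨h1, h2, h3⟩ := hs
  obtain ⟨h1', -, h3'⟩ := hs'
  obtain rfl | rfl | rfl := hb <;> obtain rfl | rfl | rfl := ha <;>
    obtain rfl | rfl | rfl := ha' <;> first | rfl | exact h3.elim | exact h3'.elim | skip
  all_goals simp only [Cut.Inv, Cut.Trans] at *; omega

end Cut.Step

namespace IsCut

variable {Q : ℤ → Quad} {σ σ' : ℤ → Cut}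

theorem isPlain (hσ : IsCut n r Q σ) (hn : (σ n).IsPlain) {j : ℤ} (hj : 0 ≤ j) (hjn : j ≤ n) :
    (σ j).IsPlain := by
  induction j, hjn using Int.leInductionDown with
  | base => exact hn
  | pred j hjn ih => exact (hσ.step j (by omega) hjn).isPlain (ih (by omega))

theorem isBarred (hσ : IsCut n r Q σ) (hn : (σ n).IsBarred) {j : ℤ} (hj : 0 ≤ j) (hjn : j ≤ n) :
    (σ j).IsBarred := by
  induction j, hjn using Int.leInductionDown with
  | base => exact hn
  | pred j hjn ih => exact (hσ.step j (by omega) hjn).isBarred (ih (by omega))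

theorem last (hσ : IsCut n r Q σ) (hA : Adm n r Q) (hn : 1 ≤ n) : σ n = .xy ∨ σ n = .vw := by
  have h1 := hσ.step n hn le_rfl
  have h2 := hA.loc n hn le_rfl
  rw [sub_self] at h1 h2
  exact h1.eq_or_eq_of_end h2 hA.fin

/-- The sign of `v` at `n` decides between `xy` and `vw`, hence between the two kinds of heads; the
sequence is then propagated in the deterministic direction. -/
theorem unique (hσ : IsCut n r Q σ) (hσ' : IsCut n r Q σ') (hA : Adm n r Q) (hn : 1 ≤ n) {j : ℤ}
    (hj : 0 ≤ j) (hjn : j ≤ n) : σ j = σ' j := by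
  have h1 := (hσ.step n hn le_rfl).right
  have h2 := (hσ'.step n hn le_rfl).right
  rcases hσ.last hA hn with h3 | h3 <;> rcases hσ'.last hA hn with h4 | h4 <;>
    rw [h3] at h1 <;> rw [h4] at h2 <;> simp only [Cut.Inv] at h1 h2
  · have e1 : ∀ {j : ℤ}, 0 ≤ j → j ≤ n → (σ j).IsPlain :=
      hσ.isPlain (by rw [h3]; exact Or.inr (Or.inr rfl))
    have e2 : ∀ {j : ℤ}, 0 ≤ j → j ≤ n → (σ' j).IsPlain :=
      hσ'.isPlain (by rw [h4]; exact Or.inr (Or.inr rfl))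
    induction j, hj using Int.leInduction with
    | base => rw [hσ.zero, hσ'.zero]
    | succ j hj ih =>
      have s1 := hσ.step (j + 1) (by omega) hjn
      have s2 := hσ'.step (j + 1) (by omega) hjn
      rw [show j + 1 - 1 = j by ring] at s1 s2
      rw [← ih (by omega)] at s2
      exact s1.right_unique s2 (e1 (by omega) hjn) (e2 (by omega) hjn)
  · omega
  · omega
  · have e1 : ∀ {j : ℤ}, 0 ≤ j → j ≤ n → (σ j).IsBarred :=
      hσ.isBarred (by rw [h3]; exact Or.inr (Or.inr rfl))
    have e2 : ∀ {j : ℤ}, 0 ≤ j → j ≤ n → (σ' j).IsBarred :=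
      hσ'.isBarred (by rw [h4]; exact Or.inr (Or.inr rfl))
    induction j, hjn using Int.leInductionDown with
    | base => rw [h3, h4]
    | pred j hjn ih =>
      have s1 := hσ.step j (by omega) hjn
      have s2 := hσ'.step j (by omega) hjn
      rw [← ih (by omega)] at s2
      exact s1.left_unique s2 (e1 (by omega) (by omega)) (e2 (by omega) (by omega))
        (e1 (by omega) hjn)

end IsCut

namespace IsShift

variable {σ : ℤ → Cut}

/-- Shifted tableaux are admissible again. -/
theorem adm (hS : IsShift n h r T T' σ) (hA : Adm n r (prof n h T)) (hr : 1 ≤ r) (hn : 1 ≤ n) :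
    Adm n r (prof n (h + 1) T') := by
  refine ⟨fun j hj hjn => ?_, ?_⟩
  · have e1 := hS.prof_eq (j - 1) (by omega) (by omega)
    have e2 := hS.prof_eq j (by omega) hjn
    rw [e1, e2]
    refine (hS.cut.step j hj hjn).loc hr (hA.loc j hj hjn) ?_ ?_ ?_ ?_
    · rw [← e2]; exact prof_y_le_x hjn hjn
    · rw [← e2]; exact prof_v_le_w hjn hjn
    · rw [← e1]; exact prof_v_le_w (by omega) (by omega)
    · rw [← e1]; exact prof_y_le_x (by omega) (by omega)
  · have h1 := hS.cut.step n hn le_rfl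
    have h2 := hA.loc n hn le_rfl
    rw [sub_self] at h1 h2
    rw [hS.prof_eq n (by omega) le_rfl]
    exact h1.end_shift h2 hA.fin

theorem isTableauC (hS : IsShift n h r T T' σ) (hA : Adm n r (prof n h T)) (hr : 1 ≤ r)
    (hn : 1 ≤ n) : IsTableauC n ℓ (h + 1) r T' :=
  (hS.adm hA hr hn).isTableauC hS.filling hr

/-- A shift is determined by its source. -/
theorem unique {T₁ T₂ : Tableau ℓ} {σ' : ℤ → Cut} (hS : IsShift n h r T T₁ σ)
    (hS' : IsShift n h r T T₂ σ') (hA : Adm n r (prof n h T)) (hn : 1 ≤ n) : T₁ = T₂ :=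
  hS.filling.ext_prof hS'.filling fun j hj hjn => by
    rw [hS.prof_eq j hj hjn, hS'.prof_eq j hj hjn, hS.cut.unique hS'.cut hA hn hj hjn]

end IsShift
end CrystalTypeC

namespace CrystalTypeC

/-! ### `τ` commutes with the crystal operators -/

open Quad

variable {n ℓ h r : ℤ} {T T' T₁ T₁' : Tableau ℓ}

theorem height_nonpos (hF : IsFilling n h T) {k : Idx n}
    (hφ : phi k (tabMonomial n ℓ h r T) = 0) (L : ℤ) :
    psum r (n - k) (prof n h T (k - 1)) (prof n h T k) (prof n h T (k + 1)) L ≤ 0 :=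
  (hF.height_le_phi r k L).trans_eq hφ

theorem RaisedAt.prof_eq_end {c : Idx ℓ} (hR : RaisedAt n c T T') {i : Vertex}
    (hi : AtPlus n h T n c i) {j : ℤ} (hj : j ≤ n) :
    prof n h T' j = if j = n then raiseEnd (prof n h T n) i else prof n h T j := by
  cases i
  · exact hR.prof_eq_end_x hi hj
  · exact absurd hi.2.2 (lt_irrefl n)
  · exact hR.prof_eq_end_v hi hj
  · exact absurd hi.2.2 (lt_irrefl n)

namespace IsShift

variable {σ : ℤ → Cut}

theorem step (hS : IsShift n h r T T' σ) {k : ℤ} (hk : 1 ≤ k) (hkn : k < n) :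
    Cut.Step r (n - k) (σ (k - 1)) (σ k) (prof n h T (k - 1)) (prof n h T k) ∧
      Cut.Step r (n - k - 1) (σ k) (σ (k + 1)) (prof n h T k) (prof n h T (k + 1)) := by
  have h2 := hS.cut.step (k + 1) (by omega) (by omega)
  rw [show k + 1 - 1 = k by ring, show n - (k + 1) = n - k - 1 by ring] at h2
  exact ⟨hS.cut.step k hk hkn.le, h2⟩

end IsShift

theorem Adm.loc_succ {Q : ℤ → Quad} (hA : Adm n r Q) {k : ℤ} (hk : 0 ≤ k) (hkn : k < n) :
    Loc r (n - k - 1) (Q k) (Q (k + 1)) := by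
  have h2 := hA.loc (k + 1) (by omega) (by omega)
  rwa [show k + 1 - 1 = k by ring, show n - (k + 1) = n - k - 1 by ring] at h2

theorem Adm.loc_end {Q : ℤ → Quad} (hA : Adm n r Q) (hn : 1 ≤ n) : Loc r 0 (Q (n - 1)) (Q n) := by
  have h2 := hA.loc n hn le_rfl
  rwa [sub_self] at h2

namespace IsShift

variable {σ : ℤ → Cut} (hS : IsShift n h r T T' σ) (hA : Adm n r (prof n h T)) (hr : 1 ≤ r)
include hS hA hr

/-- Raising a tableau and its shift at the same vertex gives a shift. -/
theorem raise {k : Idx n} {c c' : Idx ℓ} {i i' : Vertex} (hF : IsFilling n (h + 1) T₁')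
    (hR : RaisedAt n c T T₁) (hi : AtPlus n h T k c i)
    (hc : Chosen r (n - k) (prof n h T (k - 1)) (prof n h T k) (prof n h T (k + 1)) i)
    (hR' : RaisedAt n c' T' T₁') (hi' : AtPlus n (h + 1) T' k c' i')
    (hc' : Chosen r (n - k) (prof n (h + 1) T' (k - 1)) (prof n (h + 1) T' k)
      (prof n (h + 1) T' (k + 1)) i') : ∃ σ', IsShift n h r T₁ T₁' σ' := by
  have hk := k.2
  simp only [Set.mem_Icc] at hk
  rcases hk.2.lt_or_eq with hkn | hkn
  · obtain ⟨s1, s2⟩ := hS.step hk.1 hkn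
    rw [hS.prof_eq _ (by omega) (by omega), hS.prof_eq k (by omega) (by omega),
      hS.prof_eq (k + 1) (by omega) (by omega)] at hc'
    obtain ⟨b', -, e1, e2, e3⟩ := Cut.exists_next hr (by omega) (hA.loc k hk.1 hk.2)
      (hA.loc_succ (by omega) hkn) s1 s2 hc hc'
    refine ⟨fun j => if j = k then b' else σ j, ⟨?_, fun j hj hjn => ?_⟩, hF, fun j hj hjn => ?_⟩
    · rw [if_neg (by omega)]
      exact hS.cut.zero
    · rw [hR.prof_eq hkn hi, hR.prof_eq hkn hi]
      by_cases h1 : j = k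
      · rw [if_neg (by omega), if_pos h1, if_pos h1, if_neg (by omega), h1]
        exact e2
      · by_cases h2 : j - 1 = k
        · rw [if_pos h2, if_neg h1, if_neg h1, if_pos h2, show j = k + 1 by omega,
            show n - ((k : ℤ) + 1) = n - k - 1 by ring]
          exact e3
        · rw [if_neg h2, if_neg h1, if_neg h1, if_neg h2]
          exact hS.cut.step j hj hjn
    · rw [hR.prof_eq hkn hi, hR'.prof_eq hkn hi']
      by_cases h1 : j = k
      · rw [if_pos h1, if_pos h1, if_pos h1, e1, hS.prof_eq k (by omega) (by omega)]
      · rw [if_neg h1, if_neg h1, if_neg h1, hS.prof_eq j hj hjn]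
  · rw [hkn] at hc hc' hi hi'
    have s1 := hS.cut.step n (by omega) le_rfl
    rw [sub_self] at s1 hc hc'
    rw [prof_succ_self, hS.prof_eq _ (by omega) (by omega), hS.prof_eq n (by omega) le_rfl] at hc'
    rw [prof_succ_self] at hc
    obtain ⟨b', e1, e2⟩ := Cut.exists_next_end hr (hA.loc_end (by omega)) hA.fin s1 hc hc'
    refine ⟨fun j => if j = n then b' else σ j, ⟨?_, fun j hj hjn => ?_⟩, hF, fun j hj hjn => ?_⟩
    · rw [if_neg (by omega)]
      exact hS.cut.zero
    · rw [hR.prof_eq_end hi hjn, hR.prof_eq_end hi (by omega)]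
      by_cases h1 : j = n
      · rw [if_neg (by omega), if_pos h1, if_pos h1, if_neg (by omega), h1, sub_self]
        exact e2
      · rw [if_neg (by omega), if_neg h1, if_neg h1, if_neg (by omega)]
        exact hS.cut.step j hj hjn
    · rw [hR.prof_eq_end hi hjn, hR'.prof_eq_end hi' hjn]
      by_cases h1 : j = n
      · rw [if_pos h1, if_pos h1, if_pos h1, e1, hS.prof_eq n (by omega) le_rfl]
      · rw [if_neg h1, if_neg h1, if_neg h1, hS.prof_eq j hj hjn]

theorem false_of_nonpos_right {k : Idx n} {i : Vertex}
    (hc : Chosen r (n - k) (prof n h T (k - 1)) (prof n h T k) (prof n h T (k + 1)) i)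
    (hc' : ∀ L, psum r (n - k) (prof n (h + 1) T' (k - 1)) (prof n (h + 1) T' k)
      (prof n (h + 1) T' (k + 1)) L ≤ 0) : False := by
  have hk := k.2
  simp only [Set.mem_Icc] at hk
  rcases hk.2.lt_or_eq with hkn | hkn
  · obtain ⟨s1, s2⟩ := hS.step hk.1 hkn
    rw [hS.prof_eq _ (by omega) (by omega), hS.prof_eq k (by omega) (by omega),
      hS.prof_eq (k + 1) (by omega) (by omega)] at hc'
    exact Cut.not_chosen_of_shift_nonpos hr (hA.loc k hk.1 hk.2) (hA.loc_succ (by omega) hkn) s1 s2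
      hc hc'
  · rw [hkn] at hc hc'
    have s1 := hS.cut.step n (by omega) le_rfl
    rw [sub_self] at s1 hc hc'
    rw [prof_succ_self, hS.prof_eq _ (by omega) (by omega), hS.prof_eq n (by omega) le_rfl] at hc'
    rw [prof_succ_self] at hc
    exact Cut.not_chosen_of_shift_nonpos_end hr (hA.loc_end (by omega)) hA.fin s1 hc hc'

theorem false_of_nonpos_left {k : Idx n} {i : Vertex}
    (hc : ∀ L, psum r (n - k) (prof n h T (k - 1)) (prof n h T k) (prof n h T (k + 1)) L ≤ 0)
    (hc' : Chosen r (n - k) (prof n (h + 1) T' (k - 1)) (prof n (h + 1) T' k)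
      (prof n (h + 1) T' (k + 1)) i) : False := by
  have hk := k.2
  simp only [Set.mem_Icc] at hk
  rcases hk.2.lt_or_eq with hkn | hkn
  · obtain ⟨s1, s2⟩ := hS.step hk.1 hkn
    rw [hS.prof_eq _ (by omega) (by omega), hS.prof_eq k (by omega) (by omega),
      hS.prof_eq (k + 1) (by omega) (by omega)] at hc'
    exact Cut.not_chosen_shift_of_nonpos hr (hA.loc k hk.1 hk.2) (hA.loc_succ (by omega) hkn) s1 s2
      hc' hc
  · rw [hkn] at hc hc'
    have s1 := hS.cut.step n (by omega) le_rfl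
    rw [sub_self] at s1 hc hc'
    rw [prof_succ_self, hS.prof_eq _ (by omega) (by omega), hS.prof_eq n (by omega) le_rfl] at hc'
    rw [prof_succ_self] at hc
    exact Cut.not_chosen_shift_of_nonpos_end hr (hA.loc_end (by omega)) hA.fin s1 hc' hc

end IsShift

/-- `f̃_k` in terms of the chosen vertex. -/
theorem IsTableauC.exists_chosen (hT : IsTableauC n ℓ h r T) (h0 : 0 ≤ h) (h1 : h ≤ ℓ) (hr : 1 ≤ r)
    {k : Idx n} (hφ : phi k (tabMonomial n ℓ h r T) ≠ 0) :
    ∃ (i : Vertex) (c : Idx ℓ) (T₁ : Tableau ℓ), (tableauOps n ℓ h r).f k T = some T₁ ∧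
      IsTableauC n ℓ h r T₁ ∧ RaisedAt n c T T₁ ∧ AtPlus n h T k c i ∧
      Chosen r (n - k) (prof n h T (k - 1)) (prof n h T k) (prof n h T (k + 1)) i := by
  obtain ⟨i, c, T₁, hf, hR, hi, -, hpick, hpeak, hT₁, -⟩ := hT.exists_f h0 h1 hr hφ
  exact ⟨i, c, T₁, hf, hT₁, hR, hi, hpeak, (hi.plus (r := r) (hT.isFilling h0 h1) k.2.2).1, hpick⟩

section tau

variable (hT : IsTableauC n ℓ h r T) (h0 : 0 ≤ h) (h1 : h ≤ ℓ - 1) (hr : 1 ≤ r) (hrn : r ≤ n - ℓ)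
include hT h0 h1 hr hrn

theorem IsTableauC.tau : IsTableauC n ℓ (h + 1) r (tau n ℓ h r T) := by
  obtain ⟨σ, hS⟩ := hT.exists_isShift h0 h1 hr hrn
  exact hS.isTableauC (hT.adm h0 (by omega) hr) hr (by omega)

theorem phi_tau_eq_zero_iff (k : Idx n) :
    phi k (tabMonomial n ℓ (h + 1) r (tau n ℓ h r T)) = 0 ↔ phi k (tabMonomial n ℓ h r T) = 0 := by
  obtain ⟨σ, hS⟩ := hT.exists_isShift h0 h1 hr hrn
  have hA := hT.adm h0 (by omega) hr
  constructor
  · intro hφ'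
    by_contra hφ
    obtain ⟨i, c, T₁, -, -, -, -, hc⟩ := hT.exists_chosen h0 (by omega) hr hφ
    exact hS.false_of_nonpos_right hA hr hc (height_nonpos hS.filling hφ')
  · intro hφ
    by_contra hφ'
    obtain ⟨i, c, T₁, -, -, -, -, hc⟩ :=
      (hT.tau h0 h1 hr hrn).exists_chosen (by omega) (by omega) hr hφ'
    exact hS.false_of_nonpos_left hA hr (height_nonpos (hT.isFilling h0 (by omega)) hφ) hc

/-- Applying `f̃_k` to `T` and to `τ(T)` gives a pair that is again related by states. So is `f̃_k
T` with its own image, and a shift is determined by its source. -/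
theorem tableau_f_tau (k : Idx n) : (tableauOps n ℓ (h + 1) r).f k (tau n ℓ h r T) =
    ((tableauOps n ℓ h r).f k T).map (tau n ℓ h r) := by
  by_cases hφ : phi k (tabMonomial n ℓ h r T) = 0
  · rw [tableau_f_eq_none hφ, tableau_f_eq_none ((phi_tau_eq_zero_iff hT h0 h1 hr hrn k).2 hφ)]
    rfl
  · obtain ⟨σ, hS⟩ := hT.exists_isShift h0 h1 hr hrn
    have hA := hT.adm h0 (by omega) hr
    obtain ⟨i, c, T₁, hf, hT₁, hR, hi, hc⟩ := hT.exists_chosen h0 (by omega) hr hφ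
    obtain ⟨i', c', T₁', hf', hT₁', hR', hi', hc'⟩ :=
      (hT.tau h0 h1 hr hrn).exists_chosen (by omega) (by omega) hr
        (mt (phi_tau_eq_zero_iff hT h0 h1 hr hrn k).1 hφ)
    obtain ⟨σ₁, hS₁⟩ := hS.raise hA hr (hT₁'.isFilling (by omega) (by omega)) hR hi hc hR' hi' hc'
    obtain ⟨σ₂, hS₂⟩ := hT₁.exists_isShift h0 h1 hr hrn
    rw [hf, hf', Option.map_some, hS₁.unique hS₂ (hT₁.adm h0 (by omega) hr) (by omega)]

/-- The weight is the second difference of `x + y - v - w`, and every state adds 2 to this quantity.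
-/
theorem wt_tau : (tableauOps n ℓ (h + 1) r).wt (tau n ℓ h r T) = (tableauOps n ℓ h r).wt T := by
  obtain ⟨σ, hS⟩ := hT.exists_isShift h0 h1 hr hrn
  have hF := hT.isFilling h0 (by omega)
  funext k
  have hk := k.2
  simp only [Set.mem_Icc] at hk
  have key : ∀ (a : Cut) (q : Quad), (a.shift q).x + (a.shift q).y - (a.shift q).v - (a.shift q).w =
      q.x + q.y - q.v - q.w + 2 := by
    intro a q
    cases a <;> simp only [Cut.shift] <;> ring
  have key' : ∀ j, 0 ≤ j → j ≤ n + 1 → (prof n (h + 1) (tau n ℓ h r T) j).x +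
      (prof n (h + 1) (tau n ℓ h r T) j).y - (prof n (h + 1) (tau n ℓ h r T) j).v -
      (prof n (h + 1) (tau n ℓ h r T) j).w = (prof n h T j).x + (prof n h T j).y -
      (prof n h T j).v - (prof n h T j).w + 2 := by
    intro j hj hjn
    by_cases h2 : j = n + 1
    · rw [h2, prof_succ_self, prof_succ_self, hS.prof_eq n (by omega) le_rfl, key]
    · rw [hS.prof_eq j hj (by omega), key]
  have k1 := key' (k - 1) (by omega) (by omega)
  have k2 := key' k (by omega) (by omega)
  have k3 := key' (k + 1) (by omega) (by omega)
  show (monomialOps n).wt _ k = (monomialOps n).wt _ k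
  rw [wt_eq, wt_eq, hF.tabMonomial_apply, hS.filling.tabMonomial_apply, totalSum_exponents,
    totalSum_exponents]
  simp only [expo]
  omega

end tau

/-- The value `φ_k` is the number of times `f̃_k` can be applied, so it suffices that `τ` commutes
with `f̃_k` and preserves its vanishing. -/
theorem phi_tau (h0 : 0 ≤ h) (h1 : h ≤ ℓ - 1) (hr : 1 ≤ r) (hrn : r ≤ n - ℓ)
    (hT : IsTableauC n ℓ h r T) (k : Idx n) :
    phi k (tabMonomial n ℓ (h + 1) r (tau n ℓ h r T)) = phi k (tabMonomial n ℓ h r T) := by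
  induction hN : (phi k (tabMonomial n ℓ h r T)).toNat using Nat.strong_induction_on
    generalizing T with
  | _ N ih =>
    by_cases hφ : phi k (tabMonomial n ℓ h r T) = 0
    · rw [hφ]
      exact (phi_tau_eq_zero_iff hT h0 h1 hr hrn k).2 hφ
    · obtain ⟨-, -, T₁, hf, hT₁, -⟩ := hT.exists_chosen h0 (by omega) hr hφ
      have hf' := tableau_f_tau hT h0 h1 hr hrn k
      rw [hf, Option.map_some] at hf'
      have e1 := (isCrystalOn_tableauSet h0 (by omega) hr).f_phi k T hT T₁ hf
      have e2 := (isCrystalOn_tableauSet (by omega) (by omega) hr).f_phi k _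
        (hT.tau h0 h1 hr hrn) _ hf'
      simp only [tableauOps] at e1 e2
      have e3 := phi_nonneg k (tabMonomial n ℓ h r T₁)
      have e4 := ih _ (by omega) hT₁ rfl
      omega

section tau

variable (hT : IsTableauC n ℓ h r T) (h0 : 0 ≤ h) (h1 : h ≤ ℓ - 1) (hr : 1 ≤ r) (hrn : r ≤ n - ℓ)
include hT h0 h1 hr hrn

theorem eps_tau (k : Idx n) :
    eps k (tabMonomial n ℓ (h + 1) r (tau n ℓ h r T)) = eps k (tabMonomial n ℓ h r T) := by
  have e1 := congrFun (wt_tau hT h0 h1 hr hrn) k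
  rw [show (tableauOps n ℓ (h + 1) r).wt _ k = _ from wt_eq k _,
    show (tableauOps n ℓ h r).wt _ k = _ from wt_eq k _] at e1
  rw [eps_eq, eps_eq, phi_tau h0 h1 hr hrn hT, e1]

theorem tableau_e_tau (k : Idx n) : (tableauOps n ℓ (h + 1) r).e k (tau n ℓ h r T) =
    ((tableauOps n ℓ h r).e k T).map (tau n ℓ h r) := by
  by_cases hε : eps k (tabMonomial n ℓ h r T) = 0
  · rw [tableau_e_eq_none hε, tableau_e_eq_none ((eps_tau hT h0 h1 hr hrn k).trans hε)]
    rfl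
  · obtain ⟨-, -, T₁, he, -, -, -, -, hT₁, -⟩ := hT.exists_e h0 (by omega) hr hε
    have hf := ((isCrystalOn_tableauSet h0 (by omega) hr).e_iff_f k T hT T₁ hT₁).1 he
    have hf' := tableau_f_tau hT₁ h0 h1 hr hrn k
    rw [hf, Option.map_some] at hf'
    rw [he, Option.map_some]
    exact ((isCrystalOn_tableauSet (by omega) (by omega) hr).e_iff_f k _ (hT.tau h0 h1 hr hrn) _
      (hT₁.tau h0 h1 hr hrn)).2 hf'

end tau
end CrystalTypeC

namespace CrystalTypeC

/-! ### Uniqueness of the source -/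

open Quad

variable {n ℓ h r : ℤ} {T : Tableau ℓ}

/-- The image has no barred letters, so its `y` vanishes and its `w` is constant. This leaves only
the states `vy` and `xy`, under which the change of the columns does not alter any letter. -/
theorem IsShift.eq_highestTableau {σ : ℤ → Cut} (hS : IsShift n h r T (highestTableau ℓ) σ)
    (hT : IsFilling n h T) (hA : Adm n r (prof n h T)) (hℓ : ℓ ≤ n) (h1 : h ≤ ℓ - 1) :
    T = highestTableau ℓ := by
  have h0 := hT.h_nonneg
  have hy : ∀ j, j ≤ n → (prof n (h + 1) (highestTableau ℓ) j).y = 0 := by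
    intro j hj
    rw [prof_of_le hj]
    dsimp only
    refine Finset.sum_eq_zero fun a _ => if_neg ?_
    have := a.2.2
    simp only [highestTableau, Letter.rank_plain]
    omega
  have hw : ∀ i j, i ≤ n → j ≤ n → (prof n (h + 1) (highestTableau ℓ) i).w =
      (prof n (h + 1) (highestTableau ℓ) j).w := by
    intro i j hi hj
    rw [prof_of_le hi, prof_of_le hj]
    dsimp only
    refine Finset.sum_congr rfl fun a _ => if_congr ?_ rfl rfl
    have := a.2.2
    simp only [highestTableau, Letter.rank_plain]
    omega
  have hx : ∀ j, j ≤ n → (0 < (prof n (h + 1) (highestTableau ℓ) j).x ↔ j < h + 1) := by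
    intro j hj
    rw [prof_of_le hj]
    constructor
    · intro h2
      obtain ⟨u, hu, hu'⟩ := hS.filling.exists_last_of_colOne_pos h2
      simp only [highestTableau, Letter.rank_plain] at hu'
      omega
    · intro h2
      exact colOne_pos (T := highestTableau ℓ) (a := (⟨h + 1, by omega, by omega⟩ : Idx ℓ)) le_rfl h2
  have hstate : ∀ j, 0 ≤ j → j ≤ n → σ j = .vy ∨ σ j = .xy := by
    intro j hj hjn
    have e := hS.prof_eq j hj hjn
    have h2 := hy j hjn
    have h3 := prof_y_nonneg (n := n) (h := h) (T := T) j
    have h4 := hS.cut.step (j + 1) (by omega)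
    have h5 := hw j (j + 1) hjn
    have h6 := hS.prof_eq (j + 1) (by omega)
    rw [show j + 1 - 1 = j by ring] at h4
    cases hσ : σ j
    · exact Or.inl rfl
    -- From `wy` one can go to `wy` while `w` drops, or to `xy` while `w` stays and the shift lowers
    -- it; both contradict that `w` of the image is constant. At `n` the state `wy` is impossible.
    · exfalso
      have hjn' : j + 1 ≤ n := by
        by_contra hc
        have := hS.cut.last hA (by omega)
        rw [show n = j by omega, hσ] at this
        simp at this
      have h7 := (h4 hjn').trans
      rw [e, h6 hjn', hσ] at h5
      rw [hσ] at h7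
      cases hσ' : σ (j + 1) <;> rw [hσ'] at h5 h7 <;> simp only [Cut.Trans, Cut.shift] at h5 h7 <;>
        have := h5 hjn' <;> omega
    · exact Or.inr rfl
    · rw [e, hσ] at h2
      simp only [Cut.shift] at h2
      omega
    · rw [e, hσ] at h2
      simp only [Cut.shift] at h2
      omega
  refine hT.ext_prof (isFilling_highestTableau hℓ h0 (by omega)) fun j hj hjn => ?_
  have e := hS.prof_eq j hj hjn
  have e' : prof n (h + 1) (highestTableau ℓ) j = _ := prof_of_le hjn (h + 1) (highestTableau ℓ)
  rw [colOne_succ (v := ⟨h + 1, by omega, by omega⟩) rfl,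
    colOne_succ (v := ⟨h + 1, by omega, by omega⟩) rfl,
    colTwo_succ (v := ⟨h + 1, by omega, by omega⟩) rfl,
    colTwo_succ (v := ⟨h + 1, by omega, by omega⟩) rfl] at e'
  simp only [highestTableau, Letter.rank_plain] at e'
  have hxj := hx j hjn
  have hinv : (σ j).Inv r (n - j) (prof n h T j) := by
    by_cases h2 : j = 0
    · have := (hS.cut.step (j + 1) (by omega) (by omega)).left
      rwa [show j + 1 - 1 = j by ring, show n - (j + 1) + 1 = n - j by ring] at this
    · exact (hS.cut.step j (by omega) hjn).right
  have hx0 := prof_x_nonneg (n := n) (h := h) (T := T) j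
  rw [prof_of_le hjn h (highestTableau ℓ)]
  rcases hstate j hj hjn with hσ | hσ <;> rw [hσ] at e hinv <;>
    simp only [Cut.shift, Cut.Inv] at e hinv <;> rw [e] at hxj e' <;>
    simp only [Quad.mk.injEq] at e' hxj <;> obtain ⟨e1, e2, e3, e4⟩ := e' <;> ext <;> dsimp only
  all_goals
    split_ifs at e1 e2 e3 e4 <;> omega

/-- Repeated application of `τ` preserves `ε_k = 0` and ends in a single column. The alternative `h
= ℓ` covers the situation to which `r = 0` is reduced, where `1 ≤ n - ℓ` may fail. -/
theorem IsTableauC.eq_highestTableau (hℓ : ℓ ≤ n) (hr : 1 ≤ r) (hrn : h = ℓ ∨ r ≤ n - ℓ) (h0 : 0 ≤ h)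
    (h1 : h ≤ ℓ) (hT : IsTableauC n ℓ h r T) (hε : ∀ k, eps k (tabMonomial n ℓ h r T) = 0) :
    T = highestTableau ℓ := by
  induction hd : (ℓ - h).toNat generalizing h T with
  | zero =>
    obtain rfl : h = ℓ := by omega
    exact eq_highestTableau_of_eps hℓ (hT.isFilling h0 h1) hε
  | succ d ih =>
    have hrn : r ≤ n - ℓ := hrn.resolve_left (by omega)
    obtain ⟨σ, hS⟩ := hT.exists_isShift h0 (by omega) hr hrn
    have h2 := ih (Or.inr hrn) (by omega) (by omega) (hT.tau h0 (by omega) hr hrn)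
      (fun k => (eps_tau hT h0 (by omega) hr hrn k).trans (hε k)) (by omega)
    rw [h2] at hS
    exact hS.eq_highestTableau (hT.isFilling h0 h1) (hT.adm h0 h1 hr) hℓ (by omega)

/-- A nonempty crystal with a suitable height function has a source. -/
theorem IsCrystalOn.exists_source {B : Type} {D : CrystalOps n B} {S : Set B}
    (hS : IsCrystalOn D S) {b : B} (hb : b ∈ S) (μ : B → ℕ)
    (hμ : ∀ i, ∀ b ∈ S, ∀ b', D.e i b = some b' → μ b' < μ b) :
    ∃ b₀ ∈ S, ∀ i, D.e i b₀ = none := by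
  induction hm : μ b using Nat.strong_induction_on generalizing b with
  | _ m ih =>
    by_cases h : ∀ i, D.e i b = none
    · exact ⟨b, hb, h⟩
    · push Not at h
      obtain ⟨i, hi⟩ := h
      obtain ⟨b', hb'⟩ := Option.ne_none_iff_exists'.1 hi
      exact ih _ (hm ▸ hμ i b hb b' hb') (hS.e_mem i b hb b' hb') rfl

theorem tableau_e_rankSum_lt (hr : 1 ≤ r) (h0 : 0 ≤ h) (h1 : h ≤ ℓ) (k : Idx n) (T : Tableau ℓ)
    (hT : T ∈ tableauSet n ℓ h r) (T' : Tableau ℓ) (he : (tableauOps n ℓ h r).e k T = some T') :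
    rankSum n T' < rankSum n T := by
  obtain ⟨hT', ⟨c, hR⟩, -⟩ := IsTableauC.e_isTableauC hT h0 h1 hr he
  exact hR.rankSum_lt hT'.mem

section

variable (hℓ : ℓ ≤ n) (hr : 1 ≤ r) (h0 : 0 ≤ h)
include hℓ hr h0

theorem eq_highestTableau_of_e (hrn : h = ℓ ∨ r ≤ n - ℓ) (h1 : h ≤ ℓ) (hT : IsTableauC n ℓ h r T)
    (he : ∀ k, (tableauOps n ℓ h r).e k T = none) : T = highestTableau ℓ := by
  refine hT.eq_highestTableau hℓ hr hrn h0 h1 fun k => ?_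
  by_contra hε
  obtain ⟨-, -, T₁, h2, -⟩ := hT.exists_e h0 h1 hr hε
  rw [he k] at h2
  cases h2

/-- No computation is needed: descending along `ẽ` ends at some source, and uniqueness identifies it
with `highestTableau ℓ`. -/
theorem eps_highestTableau (hrn : h = ℓ ∨ r ≤ n - ℓ) (h1 : h ≤ ℓ) (k : Idx n) :
    eps k (tabMonomial n ℓ h r (highestTableau ℓ)) = 0 := by
  obtain ⟨T, hT, he⟩ := (isCrystalOn_tableauSet h0 h1 hr).exists_source
    (isTableauC_highestTableau hℓ) (rankSum n) (tableau_e_rankSum_lt hr h0 h1)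
  obtain rfl := eq_highestTableau_of_e hℓ hr h0 hrn h1 hT he
  by_contra hε
  obtain ⟨-, -, T₁, h2, -⟩ := (isTableauC_highestTableau hℓ).exists_e h0 h1 hr hε
  rw [he k] at h2
  cases h2

theorem tau_highestTableau (hrn : r ≤ n - ℓ) (h1 : h ≤ ℓ - 1) :
    tau n ℓ h r (highestTableau ℓ) = highestTableau ℓ := by
  have hT : IsTableauC n ℓ h r (highestTableau ℓ) := isTableauC_highestTableau hℓ
  refine (hT.tau h0 h1 hr hrn).eq_highestTableau hℓ hr (Or.inr hrn) (by omega) (by omega) fun k => ?_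
  rw [eps_tau hT h0 h1 hr hrn, eps_highestTableau hℓ hr h0 (Or.inr hrn) (by omega)]

theorem isCrystalIso_tabMonomial (hrn : h = ℓ ∨ r ≤ n - ℓ) (h1 : h ≤ ℓ) :
    IsCrystalIso (tableauOps n ℓ h r) (monomialOps n) (tableauSet n ℓ h r)
      (component (highestMonomial n ℓ h r)) (tabMonomial n ℓ h r) := by
  rw [← tabMonomial_highestTableau h0 h1]
  refine isCrystalIso_of_source (isCrystalOn_tableauSet h0 h1 hr) ?_
    (isTableauC_highestTableau hℓ) (fun T hT he => eq_highestTableau_of_e hℓ hr h0 hrn h1 hT he)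
    (rankSum n) (tableau_e_rankSum_lt hr h0 h1) (fun _ _ => rfl) (fun _ _ _ => rfl)
    (fun _ _ _ => rfl) (fun k T hT => IsTableauC.e_map hT h0 h1 hr k)
    (fun k T hT => IsTableauC.f_map hT h0 h1 hr k)
  rw [tabMonomial_highestTableau h0 h1]
  exact isCrystalOn_component (highestMonomial_mem hℓ h0 h1)

/-- The composite `T ↦ m_{τ(T)}` satisfies the hypotheses of the source criterion itself, so the
bijectivity of `τ` need not be shown beforehand. -/
theorem isCrystalIso_tau (hrn : r ≤ n - ℓ) (h1 : h ≤ ℓ - 1) :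
    IsCrystalIso (tableauOps n ℓ h r) (monomialOps n) (tableauSet n ℓ h r)
      (component (highestMonomial n ℓ (h + 1) r))
      (fun T => tabMonomial n ℓ (h + 1) r (tau n ℓ h r T)) := by
  have e : highestMonomial n ℓ (h + 1) r =
      tabMonomial n ℓ (h + 1) r (tau n ℓ h r (highestTableau ℓ)) := by
    rw [tau_highestTableau hℓ hr h0 hrn h1, tabMonomial_highestTableau (by omega) (by omega)]
  have hC := isCrystalOn_component
    (highestMonomial_mem (r := r) (h := h + 1) hℓ (by omega) (by omega))
  rw [e] at hC ⊢
  refine isCrystalIso_of_source (b₀ := highestTableau ℓ)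
    (ψ := fun T => tabMonomial n ℓ (h + 1) r (tau n ℓ h r T))
    (isCrystalOn_tableauSet h0 (by omega) hr) hC
    (isTableauC_highestTableau hℓ)
    (fun T hT he => eq_highestTableau_of_e hℓ hr h0 (Or.inr hrn) (by omega) hT he)
    (rankSum n) (tableau_e_rankSum_lt hr h0 (by omega)) (fun T hT => ?_) (fun k T hT => ?_)
    (fun k T hT => ?_) (fun k T hT => ?_) (fun k T hT => ?_)
  · exact wt_tau hT h0 h1 hr hrn
  · exact eps_tau hT h0 h1 hr hrn k
  · exact phi_tau h0 h1 hr hrn hT k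
  · rw [(IsTableauC.tau hT h0 h1 hr hrn).e_map (by omega) (by omega) hr,
      tableau_e_tau hT h0 h1 hr hrn, Option.map_map]
    rfl
  · rw [(IsTableauC.tau hT h0 h1 hr hrn).f_map (by omega) (by omega) hr,
      tableau_f_tau hT h0 h1 hr hrn, Option.map_map]
    rfl

end
end CrystalTypeC

namespace CrystalTypeC

/-! ### The case `r = 0` -/

variable {n ℓ h : ℤ} {T : Tableau ℓ}

/-- For `r = 0` the suffix does not depend on the column. The value 1 on the right only makes the
results for `r ≥ 1` applicable; with `h = ℓ` the second column is empty. -/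
theorem suffix_zero (a : Idx ℓ) : suffix ℓ h 0 a = suffix ℓ ℓ 1 a := by
  unfold suffix
  rw [if_pos a.2.2, mul_zero, sub_zero, ite_self]

theorem tabMonomial_zero (n ℓ h : ℤ) : tabMonomial n ℓ h 0 = tabMonomial n ℓ ℓ 1 := by
  funext T
  simp only [tabMonomial, suffix_zero]

theorem boxesAt_zero (n h : ℤ) (k : Idx n) (T : Tableau ℓ) (q x : ℤ) :
    boxesAt n ℓ h 0 k T q x = boxesAt n ℓ ℓ 1 k T q x := by
  simp only [boxesAt, suffix_zero]

theorem not_crossing_zero (s : Finset (Idx ℓ)) : ¬ Crossing ℓ h 0 s := fun hs => hs.1 rfl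

theorem not_crossing_self (r : ℤ) (s : Finset (Idx ℓ)) : ¬ Crossing ℓ ℓ r s := by
  rintro ⟨-, -, b, -, hb⟩
  have := b.2.2
  omega

theorem tableauOps_zero (n ℓ h : ℤ) : tableauOps n ℓ h 0 = tableauOps n ℓ ℓ 1 := by
  unfold tableauOps
  simp only [tabMonomial_zero, boxesAt_zero, not_crossing_zero, not_crossing_self, if_false]

theorem highestMonomial_zero (n ℓ h : ℤ) : highestMonomial n ℓ h 0 = highestMonomial n ℓ ℓ 1 := by
  unfold highestMonomial
  simp

/-- The bounds in `c5` and `c6` are contradictory for `r = 0`, so the first column must end below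
the head of the second. With `max r 1 = 1` the condition `c4` has the same bound as `c2` and `c3`,
and the three together are `c2` for the joined column. -/
theorem isTableauC_zero_iff (h0 : 0 ≤ h) (h1 : h ≤ ℓ) :
    IsTableauC n ℓ h 0 T ↔ IsTableauC n ℓ ℓ 1 T := by
  have hmax : max (0 : ℤ) 1 = 1 := rfl
  have hout : ∀ a : Idx ℓ, ¬ ℓ + 1 ≤ (a : ℤ) := fun a => by
    have := a.2.2
    omega
  constructor
  · intro hT
    have hF := hT.isFilling h0 h1
    have hmid : ∀ u v : Idx ℓ, (u : ℤ) = h → (v : ℤ) = h + 1 → (T u).rank n < (T v).rank n := by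
      intro u v hu hv
      by_contra hc
      cases hTv : T v with
      | plain k =>
        obtain ⟨k', -, b', b, -, -, h2, h3⟩ := hT.c5 u v k hu hv hTv (not_lt.1 hc)
        omega
      | bar k =>
        obtain ⟨k', -, b', b, -, -, h2, h3⟩ := hT.c6 u v k hu hv hTv (not_lt.1 hc)
        omega
    refine ⟨hT.mem, fun a b hab _ => ?_, fun a b _ ha => absurd ha (hout a), ?_, ?_, ?_, ?_, ?_⟩
    · have hab' : (a : ℤ) < b := hab
      have ha := a.2
      have hb := b.2
      simp only [Set.mem_Icc] at ha hb
      by_cases h2 : (b : ℤ) ≤ h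
      · exact hT.col₁ a b hab h2
      · by_cases h3 : h + 1 ≤ (a : ℤ)
        · exact hT.col₂ a b hab h3
        · have h4 := hF.rank_mono_one (a := a) (b := ⟨h, by omega, by omega⟩)
            (show (a : ℤ) ≤ h by omega) le_rfl
          have h5 := hF.rank_mono_two (a := ⟨h + 1, by omega, by omega⟩) (b := b)
            (show h + 1 ≤ (b : ℤ) by omega) (show h < h + 1 by omega)
          have h6 := hmid ⟨h, by omega, by omega⟩ ⟨h + 1, by omega, by omega⟩ rfl rfl
          show (T a).rank n < (T b).rank n
          omega
    · rintro ⟨a, b, k, hab, -, hTa, hTb, hk⟩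
      by_cases h2 : (b : ℤ) ≤ h
      · exact hT.c2 ⟨a, b, k, hab, h2, hTa, hTb, hk⟩
      · by_cases h3 : h + 1 ≤ (a : ℤ)
        · exact hT.c3 ⟨a, b, k, h3, hab, hTa, hTb, hk⟩
        · exact hT.c4 ⟨a, b, k, by omega, by omega, hTa, hTb, by rw [hmax]; omega⟩
    · rintro ⟨a, b, k, ha, -⟩
      exact hout a ha
    · rintro ⟨a, b, k, -, hb, -⟩
      exact hout b hb
    · exact fun u v k hu hv => absurd hv.ge (hout v)
    · exact fun u v k hu hv => absurd hv.ge (hout v)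
  · intro hT
    have hlt : ∀ a b : Idx ℓ, a < b → prec n (T a) (T b) := fun a b hab => hT.col₁ a b hab b.2.2
    refine ⟨hT.mem, fun a b hab _ => hlt a b hab, fun a b hab _ => hlt a b hab, ?_, ?_, ?_, ?_, ?_⟩
    · rintro ⟨a, b, k, hab, -, hTa, hTb, hk⟩
      exact hT.c2 ⟨a, b, k, hab, b.2.2, hTa, hTb, hk⟩
    · rintro ⟨a, b, k, -, hab, hTa, hTb, hk⟩
      exact hT.c2 ⟨a, b, k, hab, b.2.2, hTa, hTb, hk⟩
    · rintro ⟨a, b, k, ha, hb, hTa, hTb, hk⟩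
      rw [hmax] at hk
      exact hT.c2 ⟨a, b, k, idx_lt (by omega), b.2.2, hTa, hTb, by omega⟩
    · intro u v k hu hv _ huv
      exact absurd (hlt u v (idx_lt (by omega))) (not_lt.2 huv)
    · intro u v k hu hv _ huv
      exact absurd (hlt u v (idx_lt (by omega))) (not_lt.2 huv)

theorem tableauSet_zero (h0 : 0 ≤ h) (h1 : h ≤ ℓ) : tableauSet n ℓ h 0 = tableauSet n ℓ ℓ 1 :=
  Set.ext fun _ => isTableauC_zero_iff h0 h1

/-- The bounds on the position of a partner exclude each other for `r = 0`, so neither exceptional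
case occurs. -/
theorem tau_zero (n ℓ h : ℤ) (T : Tableau ℓ) : tau n ℓ h 0 T = T := by
  unfold tau
  rw [dif_neg, dif_neg]
  · rintro ⟨x, hx⟩
    have := hx.lower
    have := hx.upper
    omega
  · rintro ⟨x, hx⟩
    have := hx.lower
    have := hx.upper
    omega

/-! ### The two isomorphisms -/

section

variable {r : ℤ} (hℓ : ℓ ≤ n) (hr : 0 ≤ r) (hrn : r ≤ n - ℓ) (h0 : 0 ≤ h)
include hℓ hr hrn h0

/-- `T ↦ m_T` is an isomorphism of crystals. -/
theorem isCrystalIso_tableauSet (h1 : h ≤ ℓ) :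
    IsCrystalIso (tableauOps n ℓ h r) (monomialOps n) (tableauSet n ℓ h r)
      (component (highestMonomial n ℓ h r)) (tabMonomial n ℓ h r) := by
  rcases hr.eq_or_lt with rfl | hr
  · rw [tableauOps_zero, tableauSet_zero h0 h1, highestMonomial_zero, tabMonomial_zero]
    exact isCrystalIso_tabMonomial hℓ le_rfl (h0.trans h1) (Or.inl rfl) le_rfl
  · exact isCrystalIso_tabMonomial hℓ hr h0 (Or.inr hrn) h1

/-- `m_T ↦ m_{τ(T)}` is an isomorphism of crystals. -/
theorem mapsTo_tau_and_exists_isCrystalIso (h1 : h ≤ ℓ - 1) :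
    Set.MapsTo (tau n ℓ h r) (tableauSet n ℓ h r) (tableauSet n ℓ (h + 1) r) ∧
    ∃ ψ : Monomial n → Monomial n,
      (∀ T ∈ tableauSet n ℓ h r,
        ψ (tabMonomial n ℓ h r T) = tabMonomial n ℓ (h + 1) r (tau n ℓ h r T)) ∧
      IsCrystalIso (monomialOps n) (monomialOps n) (component (highestMonomial n ℓ h r))
        (component (highestMonomial n ℓ (h + 1) r)) ψ := by
  have hiso := isCrystalIso_tableauSet hℓ hr hrn h0 (by omega)
  have : Nonempty (Tableau ℓ) := ⟨highestTableau ℓ⟩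
  rcases hr.eq_or_lt with rfl | hr
  · have hiso' := isCrystalIso_tableauSet (h := h + 1) hℓ hr hrn (by omega) (by omega)
    rw [tableauOps_zero, tabMonomial_zero, tableauSet_zero h0 (by omega)] at hiso
    rw [tableauOps_zero, tabMonomial_zero, tableauSet_zero (by omega) (by omega)] at hiso'
    simp only [tau_zero, tabMonomial_zero, tableauSet_zero h0 (show h ≤ ℓ by omega),
      tableauSet_zero (n := n) (show 0 ≤ h + 1 by omega) (show h + 1 ≤ ℓ by omega)]
    exact ⟨fun T hT => by rwa [tau_zero], hiso.exists_factor hiso'⟩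
  · exact ⟨fun T hT => IsTableauC.tau hT h0 h1 hr hrn,
      hiso.exists_factor (isCrystalIso_tau hℓ hr h0 hrn h1)⟩

end

end CrystalTypeC

theorem mainTheorem10 (n ℓ h r : ℤ) (one_le_ℓ : 1 ≤ ℓ) (ℓ_le_n : ℓ ≤ n) (r_nonneg : 0 ≤ r)
    (r_le : r ≤ n - ℓ) (h_nonneg : 0 ≤ h) (h_le : h ≤ ℓ) :
    (∃ s, CrystalTypeC.IsColoring n s ∧
      CrystalTypeC.component (CrystalTypeC.highestMonomial n ℓ h r) ⊆
        CrystalTypeC.monomialSet n s) ∧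
    CrystalTypeC.IsCrystalIso
      (CrystalTypeC.tableauOps n ℓ h r) (CrystalTypeC.monomialOps n)
      (CrystalTypeC.tableauSet n ℓ h r)
      (CrystalTypeC.component (CrystalTypeC.highestMonomial n ℓ h r))
      (CrystalTypeC.tabMonomial n ℓ h r) ∧
    (h ≤ ℓ - 1 →
      Set.MapsTo (CrystalTypeC.tau n ℓ h r)
        (CrystalTypeC.tableauSet n ℓ h r) (CrystalTypeC.tableauSet n ℓ (h + 1) r) ∧
      ∃ ψ : CrystalTypeC.Monomial n → CrystalTypeC.Monomial n,
        (∀ T ∈ CrystalTypeC.tableauSet n ℓ h r,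
          ψ (CrystalTypeC.tabMonomial n ℓ h r T) =
            CrystalTypeC.tabMonomial n ℓ (h + 1) r (CrystalTypeC.tau n ℓ h r T)) ∧
        CrystalTypeC.IsCrystalIso
          (CrystalTypeC.monomialOps n) (CrystalTypeC.monomialOps n)
          (CrystalTypeC.component (CrystalTypeC.highestMonomial n ℓ h r))
          (CrystalTypeC.component (CrystalTypeC.highestMonomial n ℓ (h + 1) r)) ψ) := by
  exact ⟨⟨_, CrystalTypeC.isColoring_coloring n ℓ,
    CrystalTypeC.component_subset (CrystalTypeC.isColoring_coloring n ℓ)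
      (CrystalTypeC.highestMonomial_mem ℓ_le_n h_nonneg h_le)⟩,
    CrystalTypeC.isCrystalIso_tableauSet ℓ_le_n r_nonneg r_le h_nonneg h_le,
    CrystalTypeC.mapsTo_tau_and_exists_isCrystalIso ℓ_le_n r_nonneg r_le h_nonneg⟩
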